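/- Let $\sigma\subset\mathbb C$ be a bounded quasicircle, i.e. the image of the unit circle under a quasiconformal homeomorphism of $\mathbb C$ onto itself, such that $\sigma\cap[0,\infty[\,=\{1\}$ and such that $0$ lies in the bounded component of $\mathbb C\setminus\sigma$. Let $\gamma_1$ be the lift of $\sigma$ by the exponential map with endpoints $2\pi i$ and $4\pi i$, that is $$\gamma_1=\{w\in\mathbb C : e^w\in\sigma,\ 2\pi\le \operatorname{Im} w\le 4\pi\},$$ put $\gamma_k=2^{k-1}\gamma_1$ for $k\in\mathbb Z$, $\Gamma^+=\bigcup_{k\in\mathbb Z}\gamma_k$ and $\Gamma=-\Gamma^+\cup\{0\}\cup\Gamma^+$. Let $\Omega$ be a connected component of $\mathbb C\setminus\Gamma$ and let $\tau:\Omega\to\mathcal H=\{\operatorname{Re} z>0\}$ be a conformal bijection with $\tau^{-1}(w)\to\infty$ as $w\to\infty$ in $\mathcal H$, so that $(\tau,\Omega)$ is a tract model. Let $f=e^{\tau}:\Omega\to\{|z|>1\}$. An expanding repeller of $f$ is a non-empty compact set $X\subset\Omega$ with $f(X)=X$ such that, for some $c>0$ and $\lambda>1$, $|(f^n)'(x)|\ge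 c\lambda^n$ for all $x\in X$ and $n\ge 0$, and such that $X$ has an open neighbourhood $V\subset\Omega$ for which every point whose whole forward orbit under $f$ stays in $V$ belongs to $X$. Let $\mathrm{HypDim}(f)$ be the supremum of the Hausdorff dimensions of all expanding repellers of $f$. Let $\Theta=\mathrm{Mdim}(\sigma)$ be the (upper) Minkowski dimension of $\sigma$. Suppose that $\Theta<2$ and that the $\Theta$-dimensional Hausdorff measure of $\sigma$ is positive, $HM^{\Theta}(\sigma)>0$. Then $$\mathrm{HypDim}(f)>\Theta .$$ -/

import Mathlib

open MeasureTheory Filter Topology Bornology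
open scoped NNReal ENNReal

noncomputable section

/-- A self-homeomorphism of the plane is quasiconformal. We use the global (metric) form of the
definition, also called quasisymmetry: the images of all round disks, at all scales, have
uniformly bounded eccentricity. Orientation is left free. -/
def IsQuasiconformalPlane (h : ℂ ≃ₜ ℂ) : Prop :=
  ∃ H : ℝ, ∀ x y z : ℂ, ‖y - x‖ ≤ ‖z - x‖ → ‖h y - h x‖ ≤ H * ‖h z - h x‖

/-- A bounded quasicircle: the image of the unit circle under a quasiconformal homeomorphism of
the plane onto itself. -/
def IsBoundedQuasicircle (σ : Set ℂ) : Prop :=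
  ∃ h : ℂ ≃ₜ ℂ, IsQuasiconformalPlane h ∧ σ = h '' Metric.sphere 0 1

/-- The closed ray `[0, ∞[` in the complex plane. -/
def closedPositiveRay : Set ℂ := {z | z.im = 0 ∧ 0 ≤ z.re}

/-- The generating curves: a bounded quasicircle meeting `[0, ∞[` exactly in `1` and
having the origin in the bounded component of its complement. -/
structure IsGeneratingCurve (σ : Set ℂ) : Prop where
  quasicircle : IsBoundedQuasicircle σ
  inter_ray : σ ∩ closedPositiveRay = {1}
  zero_inside : IsBounded (connectedComponentIn σᶜ 0)

/-- The arc `γ₁`, the lift of `σ` by the exponential map with endpoints `2πi` and `4πi`.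
If `σ` meets `[0, ∞[` only in `1`, then `exp ⁻¹' σ` meets each line `Im w = 2πk` only in `2πik`, so
the lift is the part of `exp ⁻¹' σ` in the closed strip between the two endpoints. -/
def liftedArc (σ : Set ℂ) : Set ℂ :=
  {w | Complex.exp w ∈ σ ∧ 2 * Real.pi ≤ w.im ∧ w.im ≤ 4 * Real.pi}

/-- `Γ⁺`, the union over `k ∈ ℤ` of the arcs `γ_k = 2^(k-1) γ₁`. -/
def upperCurve (σ : Set ℂ) : Set ℂ :=
  ⋃ k : ℤ, (fun z : ℂ => (2 : ℂ) ^ (k - 1) * z) '' liftedArc σ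

/-- `Γ = -Γ⁺ ∪ {0} ∪ Γ⁺`. -/
def selfSimilarCurve (σ : Set ℂ) : Set ℂ :=
  (fun z : ℂ => -z) '' upperCurve σ ∪ {0} ∪ upperCurve σ

/-- The open right half-plane. -/
def rightHalfPlane : Set ℂ := {z | 0 < z.re}

/-- `(τ, Ω)` is a tract model: `τ` maps the open set `Ω` conformally onto the right half-plane, and
`τ⁻¹(w) → ∞` as `w → ∞` in the half-plane. (The first part makes `Ω` a simply connected
domain, and the second one makes it unbounded.) -/
structure IsTractModel (τ : ℂ → ℂ) (Ω : Set ℂ) : Prop where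
  isOpen : IsOpen Ω
  differentiableOn : DifferentiableOn ℂ τ Ω
  bijOn : Set.BijOn τ Ω rightHalfPlane
  tendsto_infinity :
    Tendsto (Function.invFunOn τ Ω) (cobounded ℂ ⊓ 𝓟 rightHalfPlane) (cobounded ℂ)

/-- `X` is an expanding repeller of the holomorphic map `f` defined on the open set `Ω`:
a non-empty compact subset of `Ω` with `f(X) = X`, on which `f` is uniformly expanding, and which is
the set of all points whose whole forward orbit stays in some neighbourhood `V ⊆ Ω` of `X`. -/
structure IsExpandingRepeller (f : ℂ → ℂ) (Ω X : Set ℂ) : Prop where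
  nonempty : X.Nonempty
  isCompact : IsCompact X
  subset : X ⊆ Ω
  image_eq : f '' X = X
  expanding : ∃ c > (0 : ℝ), ∃ l > (1 : ℝ), ∀ n : ℕ, ∀ x ∈ X, c * l ^ n ≤ ‖deriv (f^[n]) x‖
  repelling : ∃ V : Set ℂ, IsOpen V ∧ X ⊆ V ∧ V ⊆ Ω ∧ ∀ z, (∀ n : ℕ, f^[n] z ∈ V) → z ∈ X

/-- The hyperbolic dimension of `f : Ω → ℂ`, the supremum of the Hausdorff dimensions of its
expanding repellers. -/
def hypDim (f : ℂ → ℂ) (Ω : Set ℂ) : ℝ≥0∞ :=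
  ⨆ (X : Set ℂ) (_ : IsExpandingRepeller f Ω X), dimH X

/-- The (upper) Minkowski dimension `limsup_{ε → 0} log N(ε) / log (1/ε)`, where `N(ε)` is the
least number of closed `ε`-balls centred on the set that cover it. -/
def minkowskiDim (s : Set ℂ) : EReal :=
  limsup (fun ε : ℝ≥0 =>
      ENNReal.log (Metric.coveringNumber ε s : ℝ≥0∞) / ((Real.log (1 / (ε : ℝ)) : ℝ) : EReal))
    (𝓝[>] 0)

end

/-! Write `φ` for the inverse of `τ` and let `l` be a logarithm of `φ` on the half-plane. In
logarithmic coordinates the inverse branches of `f = exp ∘ τ` are `w ↦ l (w + 2πik)`, with `|l'| =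
|φ'| / |φ|`. Suppose finitely many compositions `g` of branches, all of the same length, map a disc
about `w₀` well into itself. The points whose orbits follow these compositions form an expanding
repeller, and its dimension exceeds `Θ` as soon as `∑ |g'(w₀)| ^ Θ > 2 ^ Θ`
(`IsReturnFamily.isExpandingRepeller`, `IsReturnFamily.lt_dimH`). The task is therefore to make the
sums `∑ₖ |l'(w + 2πik)| ^ Θ` large and to iterate.

Since `Γ` is invariant under doubling, `τ` conjugates `z ↦ 2z` to an automorphism of the half-plane.
It has the form `w ↦ aw + ib` with `a > 1` (`IsTractModel.exists_affine`): Koebe's theorem excludes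
translations, and a length-area argument shows that infinity is a single boundary point of `Ω`. So
the part of `Ω` of size `2 ^ n` with `Re τ = x` is a copy of the part of size `1` with `Re τ = x / a
^ n`.

Because `σ` is a quasicircle, a set `E` of points of `γ₁` with positive `Θ`-measure is uniformly
accessible from `Ω` (`IsGeneratingCurve.exists_accessible`): for `p ∈ E` and small `x` there is `q ∈
Ω` with `Re τ q = x` whose distance to `p` is at most a constant times its distance to the boundary,
hence at most a constant times `x |φ'(τ q)|`. Fix `w` with `Re w = x` and a scale `2 ^ n` with `x ≤
u a ^ n`. The points `w + 2πik` are `2π`-dense on a vertical line, whereas by Koebe distortion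
`|φ'|` is nearly constant at scale `x`. Hence about `x / 400` disjoint subfamilies of the discs of
radius comparable to `x |φ'(w + 2πik)|` about `φ (w + 2πik)` each cover `2 ^ n E`, and the positive
content of `E` bounds the contribution of this annulus below by `κ x ^ (1 - Θ)`, with `κ`
independent of `n` (`AccessibleTract.exists_row_sum`).

Adding a number of disjoint annuli proportional to `M`, with `x` and `n` comparable to `M`, gives a
multiple of `M ^ (2 - Θ)`, which is unbounded because `Θ < 2` (`AccessibleTract.exists_block_sum`).
The new real part `log |φ| ≈ n log 2` is again comparable to `M`, so the step can be repeated inside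
one strip and the sums over words grow exponentially. One last letter brings every word back near a
fixed `w₀` at a cost independent of the length (`AccessibleTract.exists_words`). -/

/-! ### Univalent functions: weak forms of the theorems of Bieberbach and Koebe -/

open Set Metric Complex in
/-- The derivative of an injective holomorphic function does not vanish. -/
theorem deriv_ne_zero_of_injOn {f : ℂ → ℂ} {U : Set ℂ} (hU : IsOpen U)
    (hf : DifferentiableOn ℂ f U) (hi : InjOn f U) {c : ℂ} (hc : c ∈ U) : deriv f c ≠ 0 := by
  intro h0
  have hUc : U ∈ 𝓝 c := hU.mem_nhds hc
  have han : AnalyticAt ℂ (fun z => f z - f c) c :=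
    (hf.analyticAt hUc).sub analyticAt_const
  have hord : analyticOrderAt (fun z => f z - f c) c ≠ ⊤ := by
    intro htop
    rw [analyticOrderAt_eq_top] at htop
    have h1 : ∀ᶠ z in 𝓝[≠] c, z ∈ U ∧ f z - f c = 0 ∧ z ≠ c :=
      (show ∀ᶠ z in 𝓝[≠] c, z ∈ U from nhdsWithin_le_nhds hUc).and
        ((htop.filter_mono nhdsWithin_le_nhds).and self_mem_nhdsWithin)
    obtain ⟨z, hzU, hz, hzc⟩ := h1.exists
    exact hzc (hi hzU hc (sub_eq_zero.1 hz))
  obtain ⟨g, hg, hgc, hfg⟩ := (han.analyticOrderAt_ne_top).1 hord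
  set n := analyticOrderNatAt (fun z => f z - f c) c with hn
  have hn0 : n ≠ 0 := by
    intro hn0
    have := hfg.self_of_nhds
    simp [hn0] at this
    exact hgc this.symm
  have hn1 : n ≠ 1 := by
    intro hn1
    have hd : HasDerivAt (fun z => f z - f c) (g c) c := by
      have h1 : HasDerivAt (fun z => (z - c) * g z) (1 * g c + (c - c) * deriv g c) c :=
        ((hasDerivAt_id c).sub_const c).mul hg.differentiableAt.hasDerivAt
      simp only [one_mul, sub_self, zero_mul, add_zero] at h1
      refine h1.congr_of_eventuallyEq ?_
      filter_upwards [hfg] with z hz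
      simpa [hn1] using hz
    have h2 := (hd.add_const (f c)).deriv
    simp only [sub_add_cancel] at h2
    exact hgc (h2.symm.trans h0)
  -- An `n`-th root of `(f - f c) / g c`, locally invertible at `c`. For `n ≥ 2`, two values of `k`
  -- that differ by a primitive `n`-th root of unity give the same value of `f`.
  set k : ℂ → ℂ := fun z => (z - c) * (g z / g c) ^ (1 / n : ℂ) with hk
  have hnC : (n : ℂ) ≠ 0 := by exact_mod_cast hn0
  have hks : HasStrictDerivAt k 1 c := by
    have hr : AnalyticAt ℂ (fun z => (g z / g c) ^ (1 / n : ℂ)) c := by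
      refine (hg.div_const).cpow analyticAt_const ?_
      simp [hgc]
    have h1 : HasStrictDerivAt k (1 * (g c / g c) ^ (1 / n : ℂ) + (c - c) * deriv (fun z => (g z / g c) ^ (1 / n : ℂ)) c) c :=
      HasStrictDerivAt.mul (HasDerivAtFilter.sub_const c (hasStrictDerivAt_id c))
        hr.hasStrictDerivAt
    simpa [hgc] using h1
  have hkc : k c = 0 := by simp [hk]
  have hmap : map k (𝓝 c) = 𝓝 0 := by
    rw [← hkc]; exact hks.map_nhds_eq one_ne_zero
  have hpow : ∀ᶠ z in 𝓝 c, f z - f c = g c * k z ^ n := by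
    filter_upwards [hfg] with z hz
    rw [hz]
    simp only [hk, mul_pow, one_div, smul_eq_mul]
    rw [Complex.cpow_nat_inv_pow _ hn0]
    field_simp
  have hV : k '' (U ∩ {z | f z - f c = g c * k z ^ n}) ∈ 𝓝 (0 : ℂ) := by
    rw [← hmap]; exact image_mem_map (inter_mem hUc hpow)
  obtain ⟨ε, hε, hball⟩ := Metric.mem_nhds_iff.1 hV
  set ζ := Complex.exp (2 * Real.pi * I / n) with hζ
  have hprim : IsPrimitiveRoot ζ n := Complex.isPrimitiveRoot_exp n hn0
  have hζ1 : ζ ≠ 1 := hprim.ne_one (by omega)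
  have hζn : ‖ζ‖ = 1 := hprim.norm'_eq_one hn0
  have hm1 : ((ε / 2 : ℝ) : ℂ) ∈ ball (0 : ℂ) ε := by
    simp [abs_of_pos hε]; linarith
  have hm2 : ζ * ((ε / 2 : ℝ) : ℂ) ∈ ball (0 : ℂ) ε := by
    simp [hζn, abs_of_pos hε]; linarith
  obtain ⟨z1, ⟨hz1U, hz1⟩, hk1⟩ := hball hm1
  obtain ⟨z2, ⟨hz2U, hz2⟩, hk2⟩ := hball hm2
  have hfe : f z1 = f z2 := by
    have : f z1 - f c = f z2 - f c := by
      rw [hz1, hz2, hk1, hk2, mul_pow, hprim.pow_eq_one, one_mul]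
    exact sub_left_injective this
  have := hi hz1U hz2U hfe
  rw [this, hk2] at hk1
  have hε2 : ((ε / 2 : ℝ) : ℂ) ≠ 0 := by
    rw [Ne, Complex.ofReal_eq_zero]; positivity
  exact hζ1 (mul_right_cancel₀ hε2 (by rw [hk1, one_mul]))

open Set Metric Complex in
/-- The area of the image of an injective holomorphic function. -/
theorem lintegral_norm_deriv_sq_eq_volume_image {f : ℂ → ℂ} {S : Set ℂ} (hS : MeasurableSet S)
    (hf : ∀ z ∈ S, DifferentiableAt ℂ f z) (hi : InjOn f S) :
    ∫⁻ z in S, ENNReal.ofReal (‖deriv f z‖ ^ 2) = volume (f '' S) := by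
  rw [← lintegral_abs_det_fderiv_eq_addHaar_image volume hS
    (f' := fun z => ((ContinuousLinearMap.toSpanSingleton ℂ (deriv f z)).restrictScalars ℝ)) _ hi]
  · refine lintegral_congr fun z => ?_
    congr 1
    have : (((ContinuousLinearMap.toSpanSingleton ℂ (deriv f z)).restrictScalars ℝ)).det =
        ‖deriv f z‖ ^ 2 := by
      simp [ContinuousLinearMap.det, LinearMap.det_restrictScalars,
      Algebra.norm_complex_eq, Complex.normSq_eq_norm_sq]
    rw [this, abs_of_nonneg (by positivity)]
  · intro z hz
    exact ((hf z hz).hasDerivAt.hasFDerivAt.restrictScalars ℝ).hasFDerivWithinAt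

open Set Metric Complex in
theorem setLIntegral_reProdIm (s t : Set ℝ) (F : ℂ → ℝ≥0∞) (hF : Measurable F) :
    ∫⁻ z in s ×ℂ t, F z = ∫⁻ x in s, ∫⁻ y in t, F (x + y * I) := by
  have h := setLIntegral_prod (μ := (volume : Measure ℝ)) (ν := (volume : Measure ℝ)) (s := s) (t := t)
    (fun p : ℝ × ℝ => F (p.1 + p.2 * I)) (by fun_prop)
  rw [← h]
  rw [← (Complex.volume_preserving_equiv_real_prod.symm).setLIntegral_comp_preimage_emb
    measurableEquivRealProd.symm.measurableEmbedding]
  have hset : (measurableEquivRealProd.symm ⁻¹' (s ×ℂ t)) = s ×ˢ t := by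
    ext p; simp [Complex.mem_reProdIm, Complex.measurableEquivRealProd]
  rw [hset]
  refine lintegral_congr fun p => ?_
  congr 1
  apply Complex.ext <;> simp [measurableEquivRealProd]

open Set Metric Complex in
/-- A circle mean estimate: discarding the higher order part only decreases the mean square. -/
theorem integral_norm_sq_laurent_ge {q : ℂ → ℂ} (hq : DifferentiableOn ℂ q (ball 0 1)) (b : ℂ)
    {s : ℝ} (hs : s < 0) :
    2 * Real.pi * (Real.exp (-2 * s) + ‖b‖ ^ 2 * Real.exp (2 * s)) ≤
      ∫ θ in (0:ℝ)..2 * Real.pi,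
        ‖-(exp (s + θ * I))⁻¹ + b * exp (s + θ * I) + exp (s + θ * I) ^ 2 * q (exp (s + θ * I))‖ ^ 2 := by
  set r := Real.exp s with hr
  have hr0 : 0 < r := Real.exp_pos s
  have hr1 : r < 1 := by simpa [hr] using hs
  have hrC : (r : ℂ) ≠ 0 := by exact_mod_cast hr0.ne'
  have hz : ∀ θ : ℝ, exp (s + θ * I) = circleMap 0 r θ := by
    intro θ; simp [circleMap, hr, Complex.exp_add]
  have hzn : ∀ θ : ℝ, ‖circleMap 0 r θ‖ = r := by intro θ; simp [abs_of_pos hr0]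
  simp only [hz]
  -- On `‖z‖ = r` the conjugate of `z` is `r² / z`, so the cross terms of the squared modulus are
  -- the real part of this holomorphic function. It vanishes at `0`, hence has mean zero.
  set Ψ : ℂ → ℂ := fun z => -2 * b * (r : ℂ)⁻¹ ^ 2 * z ^ 2 +
    2 * (-(r : ℂ)⁻¹ ^ 2 * z ^ 3 * q z + (starRingEnd ℂ) b * r ^ 2 * z * q z) with hΨ
  have hcb : closedBall (0:ℂ) r ⊆ ball 0 1 := closedBall_subset_ball hr1
  have hΨd : DifferentiableOn ℂ Ψ (ball 0 1) := by
    simp only [hΨ]; fun_prop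
  have hΨi : ∫ θ in (0:ℝ)..2 * Real.pi, Ψ (circleMap 0 r θ) = 0 := by
    have h1 : DiffContOnCl ℂ Ψ (ball 0 |r|) := by
      rw [abs_of_pos hr0]
      exact (hΨd.mono hcb).diffContOnCl_ball subset_rfl
    have h2 := h1.circleAverage
    rw [Real.circleAverage_def] at h2
    have h3 : Ψ 0 = 0 := by simp [hΨ]
    rw [h3, smul_eq_zero] at h2
    exact h2.resolve_left (by positivity)
  have hcm : Continuous (circleMap 0 r) := continuous_circleMap 0 r
  have hmem : ∀ θ, circleMap 0 r θ ∈ ball (0:ℂ) 1 := fun θ => by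
    rw [mem_ball_zero_iff, hzn]; exact hr1
  have hΨc : Continuous fun θ => Ψ (circleMap 0 r θ) :=
    hΨd.continuousOn.comp_continuous hcm hmem
  have hqc : Continuous fun θ => q (circleMap 0 r θ) :=
    hq.continuousOn.comp_continuous hcm hmem
  have hne : ∀ θ, circleMap 0 r θ ≠ 0 := fun θ => by
    rw [← norm_pos_iff, hzn]; exact hr0
  have hre : ∫ θ in (0:ℝ)..2 * Real.pi, (Ψ (circleMap 0 r θ)).re = 0 := by
    have := reCLM.intervalIntegral_comp_comm (hΨc.intervalIntegrable (μ := volume) 0 (2 * Real.pi))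
    simp only [reCLM_apply] at this
    rw [this, hΨi]; simp
  have hconst : ∫ θ in (0:ℝ)..2 * Real.pi, (r⁻¹ ^ 2 + ‖b‖ ^ 2 * r ^ 2 + (Ψ (circleMap 0 r θ)).re) =
      2 * Real.pi * (r⁻¹ ^ 2 + ‖b‖ ^ 2 * r ^ 2) := by
    rw [intervalIntegral.integral_add (f := fun _ => r⁻¹ ^ 2 + ‖b‖ ^ 2 * r ^ 2)
      (g := fun θ => (Ψ (circleMap 0 r θ)).re) (continuous_const.intervalIntegrable _ _)
      ((continuous_re.comp hΨc).intervalIntegrable _ _), hre]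
    simp
    ring
  have he1 : Real.exp (-2 * s) = r⁻¹ ^ 2 := by
    rw [hr, ← Real.exp_neg, ← Real.exp_nat_mul]; congr 1; push_cast; ring
  have he2 : Real.exp (2 * s) = r ^ 2 := by
    rw [hr, ← Real.exp_nat_mul]; norm_cast
  rw [he1, he2, ← hconst]
  refine intervalIntegral.integral_mono_on (by positivity) ?_ ?_ ?_
  · exact (continuous_const.add (continuous_re.comp hΨc)).intervalIntegrable _ _
  · refine Continuous.intervalIntegrable ?_ _ _
    refine (Continuous.norm ?_).pow 2
    exact ((hcm.inv₀ hne).neg.add (continuous_const.mul hcm)).add ((hcm.pow 2).mul hqc)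
  · intro θ _
    set z := circleMap 0 r θ with hzdef
    have hzz : z ≠ 0 := hne θ
    have hzr : (starRingEnd ℂ) z = r ^ 2 / z := by
      rw [eq_div_iff hzz, mul_comm, Complex.mul_conj, Complex.normSq_eq_norm_sq, hzdef, hzn]
      push_cast; rfl
    have hexp : ‖-z⁻¹ + b * z + z ^ 2 * q z‖ ^ 2 =
        r⁻¹ ^ 2 + ‖b‖ ^ 2 * r ^ 2 + (Ψ z).re + ‖z ^ 2 * q z‖ ^ 2 := by
      rw [← Complex.normSq_eq_norm_sq, Complex.normSq_add, Complex.normSq_add]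
      have e1 : normSq (-z⁻¹) = r⁻¹ ^ 2 := by
        rw [Complex.normSq_eq_norm_sq, norm_neg, norm_inv, hzdef, hzn]
      have e2 : normSq (b * z) = ‖b‖ ^ 2 * r ^ 2 := by
        rw [Complex.normSq_eq_norm_sq, norm_mul, hzdef, hzn, mul_pow]
      have e3 : (-z⁻¹ * (starRingEnd ℂ) (b * z)).re = (-b * (r:ℂ)⁻¹ ^ 2 * z ^ 2).re := by
        rw [← Complex.conj_re]
        congr 1
        simp only [map_mul, map_neg, map_inv₀, Complex.conj_conj]
        rw [hzr]
        field_simp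
      have e4 : ((-z⁻¹ + b * z) * (starRingEnd ℂ) (z ^ 2 * q z)).re =
          (-(r:ℂ)⁻¹ ^ 2 * z ^ 3 * q z + (starRingEnd ℂ) b * r ^ 2 * z * q z).re := by
        rw [← Complex.conj_re]
        congr 1
        simp only [map_mul, map_neg, map_add, map_inv₀, Complex.conj_conj]
        rw [hzr]
        field_simp
      rw [e1, e2, e3, e4, Complex.normSq_eq_norm_sq]
      have e5 : (Ψ z).re = 2 * (-b * (r:ℂ)⁻¹ ^ 2 * z ^ 2).re +
          2 * (-(r:ℂ)⁻¹ ^ 2 * z ^ 3 * q z + (starRingEnd ℂ) b * r ^ 2 * z * q z).re := by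
        have h2 : ∀ w : ℂ, 2 * w.re = (2 * w).re := by intro w; simp
        rw [h2, h2, ← Complex.add_re]
        congr 1
        simp only [hΨ]; ring
      rw [e5]; ring
    rw [hexp]
    have : 0 ≤ ‖z ^ 2 * q z‖ ^ 2 := by positivity
    linarith

open Set Metric Complex in
theorem integral_exp_sum {ρ : ℝ} (hρ : 0 < ρ) (B : ℝ) :
    ∫ s in Real.log ρ..0, 2 * Real.pi * (Real.exp (-2 * s) + B * Real.exp (2 * s)) =
      Real.pi * (ρ⁻¹ ^ 2 - 1 + B * (1 - ρ ^ 2)) := by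
  have hd : ∀ s ∈ uIcc (Real.log ρ) 0, HasDerivAt
      (fun s => Real.pi * (-Real.exp (-2 * s) + B * Real.exp (2 * s)))
      (2 * Real.pi * (Real.exp (-2 * s) + B * Real.exp (2 * s))) s := by
    intro s _
    have h1 : HasDerivAt (fun s : ℝ => Real.exp (-2 * s)) (Real.exp (-2 * s) * (-2 * 1)) s :=
      ((hasDerivAt_id s).const_mul (-2)).exp
    have h2 : HasDerivAt (fun s : ℝ => Real.exp (2 * s)) (Real.exp (2 * s) * (2 * 1)) s :=
      ((hasDerivAt_id s).const_mul 2).exp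
    refine ((h1.neg.add (h2.const_mul B)).const_mul Real.pi).congr_deriv ?_
    ring
  rw [intervalIntegral.integral_eq_sub_of_hasDerivAt hd
    (Continuous.intervalIntegrable (by fun_prop) _ _)]
  have e1 : Real.exp (-2 * Real.log ρ) = ρ⁻¹ ^ 2 := by
    rw [show -2 * Real.log ρ = ((2:ℕ):ℝ) * Real.log ρ⁻¹ by rw [Real.log_inv]; push_cast; ring,
      Real.exp_nat_mul, Real.exp_log (by positivity)]
  have e2 : Real.exp (2 * Real.log ρ) = ρ ^ 2 := by
    rw [show 2 * Real.log ρ = ((2:ℕ):ℝ) * Real.log ρ by push_cast; ring,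
      Real.exp_nat_mul, Real.exp_log (by positivity)]
  rw [e1, e2]; simp; ring

open Set Metric Complex in
/-- If `|F| ≥ ε` on the circle of radius `ρ`, then the image of the disk contains the `ε`-disk. -/
theorem ball_subset_image_ball {F : ℂ → ℂ} (hF : DifferentiableOn ℂ F (ball 0 1))
    (hi : InjOn F (ball 0 1)) (h0 : F 0 = 0) {ρ ε : ℝ} (hρ : 0 < ρ) (hρ1 : ρ < 1) (hε : 0 < ε)
    (hs : ∀ z, ‖z‖ = ρ → ε ≤ ‖F z‖) : ball 0 ε ⊆ F '' ball 0 ρ := by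
  have hsub : ball (0:ℂ) ρ ⊆ ball 0 1 := ball_subset_ball hρ1.le
  have hsubc : closedBall (0:ℂ) ρ ⊆ ball 0 1 := closedBall_subset_ball hρ1
  have hopen : IsOpen (F '' ball 0 ρ) := by
    have han : AnalyticOnNhd ℂ F (ball 0 ρ) := (hF.mono hsub).analyticOnNhd isOpen_ball
    rcases han.is_constant_or_isOpen (convex_ball 0 ρ).isPreconnected with ⟨w, hw⟩ | h
    · exfalso
      have h1 : ((ρ / 2 : ℝ) : ℂ) ∈ ball (0:ℂ) ρ := by simp [abs_of_pos hρ]; linarith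
      have h2 : (0:ℂ) ∈ ball (0:ℂ) ρ := mem_ball_self hρ
      have := hi (hsub h1) (hsub h2) ((hw _ h1).trans (hw _ h2).symm)
      rw [Complex.ofReal_eq_zero] at this; linarith
    · exact h _ subset_rfl isOpen_ball
  have hcl : IsClosed (F '' closedBall 0 ρ) :=
    ((isCompact_closedBall 0 ρ).image_of_continuousOn (hF.continuousOn.mono hsubc)).isClosed
  have hconn : IsPreconnected (ball (0:ℂ) ε) := (convex_ball 0 ε).isPreconnected
  intro y hy
  by_contra hyn
  have hy2 : y ∈ (F '' closedBall 0 ρ)ᶜ := by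
    rintro ⟨z, hz, rfl⟩
    rcases (mem_closedBall_zero_iff.1 hz).lt_or_eq with h | h
    · exact hyn ⟨z, mem_ball_zero_iff.2 h, rfl⟩
    · exact absurd (mem_ball_zero_iff.1 hy) (not_lt.2 (hs z h))
  -- The image of the boundary circle misses the `ε`-disk, so these two disjoint open sets cover it;
  -- connectedness leaves only the first.
  have := hconn (F '' ball 0 ρ) (F '' closedBall 0 ρ)ᶜ hopen hcl.isOpen_compl ?_
    ⟨0, mem_ball_self hε, 0, mem_ball_self hρ, h0⟩ ⟨y, hy, hy2⟩
  · obtain ⟨x, _, hx1, hx2⟩ := this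
    exact hx2 (image_mono ball_subset_closedBall hx1)
  · intro x hx
    by_cases hxc : x ∈ F '' closedBall 0 ρ
    · left
      obtain ⟨z, hz, rfl⟩ := hxc
      rcases (mem_closedBall_zero_iff.1 hz).lt_or_eq with h | h
      · exact ⟨z, mem_ball_zero_iff.2 h, rfl⟩
      · exact absurd (mem_ball_zero_iff.1 hx) (not_lt.2 (hs z h))
    · exact Or.inr hxc

open Set Metric Complex in
/-- A weak form of the area theorem: the first coefficient of `1 / F` is bounded. -/
theorem norm_coeff_le_of_univalent {F n : ℂ → ℂ} {b : ℂ} (hF : DifferentiableOn ℂ F (ball 0 1))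
    (hi : InjOn F (ball 0 1)) (h0 : F 0 = 0) (hn : DifferentiableOn ℂ n (ball 0 1))
    (hFn : ∀ z ∈ ball (0:ℂ) 1, z ≠ 0 → F z * (z⁻¹ + b * z + z ^ 2 * n z) = 1) : ‖b‖ ≤ 3 := by
  obtain ⟨K, hK⟩ := (isCompact_closedBall (0:ℂ) (1/2)).exists_bound_of_continuousOn
    (hn.continuousOn.mono (closedBall_subset_ball (by norm_num)))
  have hK0 : 0 ≤ K := (norm_nonneg _).trans (hK 0 (by simp))
  have hpi := Real.pi_pos
  have hmain : ∀ ρ : ℝ, 0 < ρ → ρ < 1/2 →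
      -1 + ‖b‖ ^ 2 * (1 - ρ ^ 2) ≤ 2 * ‖b‖ + (‖b‖ * ρ + K * ρ ^ 2) ^ 2 + 2 * K * ρ := by
    intro ρ hρ hρ2
    set M := ρ⁻¹ + ‖b‖ * ρ + K * ρ ^ 2 with hM
    have hM0 : 0 < M := by positivity
    -- This is `1 / F` in logarithmic polar coordinates; annuli become the rectangle `S`, and areas
    -- become iterated integrals.
    set G : ℂ → ℂ := fun ζ => (exp ζ)⁻¹ + b * exp ζ + exp ζ ^ 2 * n (exp ζ) with hG
    set q : ℂ → ℂ := fun z => 2 * n z + z * deriv n z with hq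
    set S : Set ℂ := Ioo (Real.log ρ) 0 ×ℂ Ioo 0 (2 * Real.pi) with hS
    have hSm : MeasurableSet S :=
      (measurableSet_Ioo.preimage measurable_re).inter (measurableSet_Ioo.preimage measurable_im)
    have hSz : ∀ ζ : ℂ, ζ.re < 0 → exp ζ ∈ ball (0:ℂ) 1 := by
      intro ζ hζ
      rw [mem_ball_zero_iff, Complex.norm_exp]; simpa using hζ
    have hGd : ∀ ζ : ℂ, ζ.re < 0 → HasDerivAt G
        (-(exp ζ)⁻¹ + b * exp ζ + exp ζ ^ 2 * q (exp ζ)) ζ := by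
      intro ζ hζ
      have hnd : HasDerivAt n (deriv n (exp ζ)) (exp ζ) :=
        (hn.differentiableAt (isOpen_ball.mem_nhds (hSz ζ hζ))).hasDerivAt
      have he := Complex.hasDerivAt_exp ζ
      have h1 := he.inv (exp_ne_zero ζ)
      have h2 := he.const_mul b
      have h3 := (he.pow 2).mul (hnd.comp ζ he)
      have h4 := (h1.add h2).add h3
      refine h4.congr_deriv ?_
      simp only [hq, Function.comp, Pi.pow_apply]
      field_simp [exp_ne_zero ζ]
      push_cast
      ring
    have hFG : ∀ ζ : ℂ, ζ.re < 0 → F (exp ζ) * G ζ = 1 := fun ζ hζ =>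
      hFn _ (hSz ζ hζ) (exp_ne_zero ζ)
    have hGi : InjOn G S := by
      intro x hx y hy hxy
      have hx1 := hFG x hx.1.2
      have hy1 := hFG y hy.1.2
      have hFe : F (exp x) = F (exp y) := by
        rw [hxy] at hx1
        have hne : G y ≠ 0 := right_ne_zero_of_mul_eq_one hy1
        exact mul_right_cancel₀ hne (hx1.trans hy1.symm)
      have he := hi (hSz x hx.1.2) (hSz y hy.1.2) hFe
      rw [Complex.exp_eq_exp_iff_exists_int] at he
      obtain ⟨k, hk⟩ := he
      have him := congrArg Complex.im hk
      simp at him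
      have a1 := hx.2.1; have a2 := hx.2.2; have a3 := hy.2.1; have a4 := hy.2.2
      have hk0 : k = 0 := by
        have l1 : (k : ℝ) < 1 := by
          by_contra h
          push Not at h
          nlinarith
        have l2 : (-1 : ℝ) < k := by
          by_contra h
          push Not at h
          nlinarith
        have l1' : k < 1 := by exact_mod_cast l1
        have l2' : -1 < k := by exact_mod_cast l2
        omega
      simpa [hk0] using hk
    -- `F` already covers this disk inside radius `ρ`, so by injectivity `1 / F` has modulus at most
    -- `M` on the remaining annulus. This bounds the area from above.
    have hball : ball 0 M⁻¹ ⊆ F '' ball 0 ρ := by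
      refine ball_subset_image_ball hF hi h0 hρ (by linarith) (by positivity) ?_
      intro z hz
      have hz0 : z ≠ 0 := by rw [← norm_pos_iff, hz]; exact hρ
      have h1 := hFn z (by rw [mem_ball_zero_iff, hz]; linarith) hz0
      have h2 : ‖z⁻¹ + b * z + z ^ 2 * n z‖ ≤ M := by
        refine (norm_add_le _ _).trans (add_le_add ((norm_add_le _ _).trans (add_le_add ?_ ?_)) ?_)
        · rw [norm_inv, hz]
        · rw [norm_mul, hz]
        · rw [norm_mul, norm_pow, hz, mul_comm]
          gcongr
          exact hK z (by rw [mem_closedBall_zero_iff, hz]; exact hρ2.le)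
      have h3 : ‖F z‖ * ‖z⁻¹ + b * z + z ^ 2 * n z‖ = 1 := by rw [← norm_mul, h1, norm_one]
      rw [inv_le_iff_one_le_mul₀ hM0, ← h3]
      gcongr
    have himg : G '' S ⊆ closedBall 0 M := by
      rintro _ ⟨ζ, hζ, rfl⟩
      rw [mem_closedBall_zero_iff]
      by_contra hlt
      push Not at hlt
      have h1 := hFG ζ hζ.1.2
      have h2 : ‖F (exp ζ)‖ * ‖G ζ‖ = 1 := by rw [← norm_mul, h1, norm_one]
      have h3 : F (exp ζ) ∈ ball (0:ℂ) M⁻¹ := by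
        rw [mem_ball_zero_iff, lt_inv_comm₀ (norm_pos_iff.2 (left_ne_zero_of_mul_eq_one h1)) hM0]
        rwa [← eq_inv_of_mul_eq_one_right h2]
      obtain ⟨w, hw, hwe⟩ := hball h3
      have h4 := hi (ball_subset_ball (by linarith) hw) (hSz ζ hζ.1.2) hwe
      rw [h4, mem_ball_zero_iff, Complex.norm_exp, ← Real.lt_log_iff_exp_lt hρ] at hw
      exact absurd hζ.1.1 (not_lt.2 hw.le)
    have harea := lintegral_norm_deriv_sq_eq_volume_image hSm
      (fun ζ hζ => (hGd ζ hζ.1.2).differentiableAt) hGi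
    have hvol : volume (G '' S) ≤ ENNReal.ofReal (Real.pi * M ^ 2) := by
      refine (measure_mono himg).trans_eq ?_
      rw [Complex.volume_closedBall, ← ENNReal.ofReal_pow hM0.le, mul_comm,
        ENNReal.ofReal_mul hpi.le]
      congr 1
      rw [← NNReal.coe_real_pi, ENNReal.ofReal_coe_nnreal]
    have hqd : DifferentiableOn ℂ q (ball 0 1) := by
      have : DifferentiableOn ℂ (deriv n) (ball 0 1) := hn.deriv isOpen_ball
      simp only [hq]; fun_prop
    have hlower : ENNReal.ofReal (Real.pi * (ρ⁻¹ ^ 2 - 1 + ‖b‖ ^ 2 * (1 - ρ ^ 2))) ≤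
        ∫⁻ z in S, ENNReal.ofReal (‖deriv G z‖ ^ 2) := by
      rw [hS, setLIntegral_reProdIm _ _ _ (by fun_prop), ← integral_exp_sum hρ,
        intervalIntegral.integral_of_le (Real.log_nonpos hρ.le (by linarith)),
        integral_Ioc_eq_integral_Ioo,
        ofReal_integral_eq_lintegral_ofReal]
      · refine setLIntegral_mono' measurableSet_Ioo fun s hs => ?_
        have hb := integral_norm_sq_laurent_ge hqd b hs.2
        refine (ENNReal.ofReal_le_ofReal hb).trans ?_
        rw [intervalIntegral.integral_of_le (by positivity), integral_Ioc_eq_integral_Ioo]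
        rw [ofReal_integral_eq_lintegral_ofReal]
        rotate_left
        · have hce : Continuous fun θ : ℝ => exp ((s : ℂ) + θ * I) := by fun_prop
          have hqc : Continuous fun θ : ℝ => q (exp ((s : ℂ) + θ * I)) :=
            hqd.continuousOn.comp_continuous hce (fun θ => hSz _ (by simpa using hs.2))
          have hc : Continuous fun θ : ℝ => ‖-(exp ((s : ℂ) + θ * I))⁻¹ + b * exp (s + θ * I) +
              exp (s + θ * I) ^ 2 * q (exp (s + θ * I))‖ ^ 2 :=
            (((hce.inv₀ fun θ => exp_ne_zero _).neg.add (continuous_const.mul hce)).add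
              ((hce.pow 2).mul hqc)).norm.pow 2
          exact ((hc.intervalIntegrable (μ := volume) 0 (2 * Real.pi)).1).mono_set Ioo_subset_Ioc_self
        · exact Eventually.of_forall fun s => by positivity
        refine setLIntegral_mono' measurableSet_Ioo fun θ hθ => ?_
        rw [(hGd (s + θ * I) (by simpa using hs.2)).deriv]
      · exact ((Continuous.intervalIntegrable (by fun_prop) (Real.log ρ) 0).1).mono_set Ioo_subset_Ioc_self
      · exact Eventually.of_forall fun s => by positivity
    have hfin := hlower.trans (harea.le.trans hvol)
    rw [ENNReal.ofReal_le_ofReal_iff (by positivity)] at hfin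
    have hfin2 := le_of_mul_le_mul_left hfin hpi
    have hMM : M ^ 2 = ρ⁻¹ ^ 2 + 2 * ‖b‖ + (‖b‖ * ρ + K * ρ ^ 2) ^ 2 + 2 * K * ρ := by
      rw [hM]; field_simp; ring
    rw [hMM] at hfin2
    linarith
  -- The singular terms `ρ⁻²` of the two area bounds have cancelled. As `ρ → 0` there remains `‖b‖²
  -- - 1 ≤ 2 ‖b‖`, that is `‖b‖ ≤ 1 + √2`.
  have hlim : -1 + ‖b‖ ^ 2 * (1 - (0:ℝ) ^ 2) ≤
      2 * ‖b‖ + (‖b‖ * 0 + K * 0 ^ 2) ^ 2 + 2 * K * 0 := by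
    refine le_of_tendsto_of_tendsto (b := 𝓝[>] (0:ℝ))
      (f := fun ρ => -1 + ‖b‖ ^ 2 * (1 - ρ ^ 2))
      (g := fun ρ => 2 * ‖b‖ + (‖b‖ * ρ + K * ρ ^ 2) ^ 2 + 2 * K * ρ) ?_ ?_ ?_
    · exact tendsto_nhdsWithin_of_tendsto_nhds
        (Continuous.tendsto (by fun_prop) 0)
    · exact tendsto_nhdsWithin_of_tendsto_nhds
        (Continuous.tendsto (by fun_prop) 0)
    · filter_upwards [Ioo_mem_nhdsGT (show (0:ℝ) < 1/2 by norm_num)] with ρ hρ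
      exact hmain ρ hρ.1 hρ.2
  by_contra h
  push Not at h
  nlinarith

open Set Metric Complex in
/-- A weak form of Bieberbach's inequality on the second coefficient of a univalent function. -/
theorem norm_deriv_deriv_le_of_normalized {f : ℂ → ℂ} (hf : DifferentiableOn ℂ f (ball 0 1))
    (hi : InjOn f (ball 0 1)) (h0 : f 0 = 0) (h1 : deriv f 0 = 1) : ‖deriv (deriv f) 0‖ ≤ 12 := by
  have hnhds : ball (0:ℂ) 1 ∈ 𝓝 (0:ℂ) := ball_mem_nhds 0 one_pos
  have hmem0 : (0:ℂ) ∈ ball (0:ℂ) 1 := mem_ball_self one_pos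
  set k := dslope f 0 with hk
  have hkd : DifferentiableOn ℂ k (ball 0 1) := (Complex.differentiableOn_dslope hnhds).2 hf
  have hfk : ∀ z, f z = z * k z := by
    intro z
    have := sub_smul_dslope f 0 z
    simp only [sub_zero, smul_eq_mul, h0] at this
    exact this.symm
  have hk0 : k 0 = 1 := by rw [hk, dslope_same, h1]
  have hkne : ∀ z ∈ ball (0:ℂ) 1, k z ≠ 0 := by
    intro z hz hkz
    by_cases hz0 : z = 0
    · rw [hz0, hk0] at hkz; exact one_ne_zero hkz
    · exact hz0 (hi hz hmem0 (by rw [hfk z, hkz, h0, mul_zero]))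
  have hkd' : DifferentiableOn ℂ (deriv k) (ball 0 1) := hkd.deriv isOpen_ball
  have hprim : DifferentiableOn ℂ (fun z => deriv k z / (2 * k z)) (ball 0 1) :=
    hkd'.div (hkd.const_mul 2) (fun z hz => mul_ne_zero two_ne_zero (hkne z hz))
  obtain ⟨l, hl0, hl⟩ := hprim.isExactOn_ball.with_val_at 0 0
  have hld : DifferentiableOn ℂ l (ball 0 1) :=
    fun z hz => (hl z hz).differentiableAt.differentiableWithinAt
  have hkl : ∀ z ∈ ball (0:ℂ) 1, k z = exp (2 * l z) := by
    have hc : ∀ z ∈ ball (0:ℂ) 1, HasDerivAt (fun z => k z * exp (-(2 * l z))) 0 z := by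
      intro z hz
      have hkz := (hkd.differentiableAt (isOpen_ball.mem_nhds hz)).hasDerivAt
      have he := (((hl z hz).const_mul 2).neg).cexp
      refine (hkz.mul he).congr_deriv ?_
      field_simp [hkne z hz]
      ring
    intro z hz
    have hconst := (convex_ball (0:ℂ) 1).is_const_of_fderivWithin_eq_zero (𝕜 := ℂ)
      (f := fun z => k z * exp (-(2 * l z)))
      (fun z hz => (hc z hz).differentiableAt.differentiableWithinAt)
      (fun z hz => by
        rw [fderivWithin_of_isOpen isOpen_ball hz]
        have := (hc z hz).hasFDerivAt.fderiv
        rw [this]; ext; simp) hz hmem0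
    simp only [hl0, hk0, mul_zero, neg_zero, exp_zero, mul_one] at hconst
    rw [Complex.exp_neg, mul_inv_eq_one₀ (exp_ne_zero _)] at hconst
    exact hconst
  have hsq : ∀ z ∈ ball (0:ℂ) 1, z ^ 2 ∈ ball (0:ℂ) 1 := by
    intro z hz
    rw [mem_ball_zero_iff] at hz ⊢
    rw [norm_pow]
    exact pow_lt_one₀ (norm_nonneg z) hz two_ne_zero
  -- The square root transform `F z ^ 2 = f (z ^ 2)`. The linear coefficient of `1 / F` is `-f''(0)
  -- / 4`, so the bound `3` becomes `12`.
  set F : ℂ → ℂ := fun z => z * exp (l (z ^ 2)) with hF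
  have hFd : DifferentiableOn ℂ F (ball 0 1) :=
    differentiableOn_id.mul ((hld.comp (differentiableOn_id.pow 2) hsq).cexp)
  have hF2 : ∀ z ∈ ball (0:ℂ) 1, F z ^ 2 = f (z ^ 2) := by
    intro z hz
    rw [hfk, hkl _ (hsq z hz), hF]
    simp only [mul_pow, ← Complex.exp_nat_mul]
    norm_num
  have hFi : InjOn F (ball 0 1) := by
    intro z hz w hw hzw
    have h2 : z ^ 2 = w ^ 2 := hi (hsq z hz) (hsq w hw) (by rw [← hF2 z hz, ← hF2 w hw, hzw])
    have h3 : exp (l (z ^ 2)) ≠ 0 := exp_ne_zero _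
    simp only [hF] at hzw
    rw [← h2] at hzw
    exact mul_right_cancel₀ h3 hzw
  set Mf : ℂ → ℂ := fun u => exp (-l u) with hMf
  have hMd : DifferentiableOn ℂ Mf (ball 0 1) := hld.neg.cexp
  set m1 := dslope Mf 0 with hm1
  have hm1d : DifferentiableOn ℂ m1 (ball 0 1) := (Complex.differentiableOn_dslope hnhds).2 hMd
  set m2 := dslope m1 0 with hm2
  have hm2d : DifferentiableOn ℂ m2 (ball 0 1) := (Complex.differentiableOn_dslope hnhds).2 hm1d
  have hexp : ∀ u, Mf u = 1 + u * (m1 0 + u * m2 u) := by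
    intro u
    have e1 := sub_smul_dslope Mf 0 u
    have e2 := sub_smul_dslope m1 0 u
    simp only [sub_zero, smul_eq_mul] at e1 e2
    have e3 : Mf 0 = 1 := by simp [hMf, hl0]
    rw [← hm1, e3] at e1
    rw [← hm2] at e2
    rw [e2, add_sub_cancel, e1]; ring
  have hb := norm_coeff_le_of_univalent (n := fun z => z * m2 (z ^ 2)) (b := m1 0) hFd hFi
    (by simp [hF]) (differentiableOn_id.mul (hm2d.comp (differentiableOn_id.pow 2) hsq)) ?_
  · have hm10 : m1 0 = -(deriv k 0 / 2) := by
      rw [hm1, dslope_same]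
      have := ((hl 0 hmem0).neg.cexp).deriv
      rw [hMf]
      simp only [hl0, hk0, mul_one, neg_zero, exp_zero, one_mul, Pi.neg_apply] at this
      exact this
    have hf2 : deriv (deriv f) 0 = 2 * deriv k 0 := by
      have e1 : deriv f =ᶠ[𝓝 0] fun z => k z + z * deriv k z := by
        filter_upwards [hnhds] with z hz
        have hkz := (hkd.differentiableAt (isOpen_ball.mem_nhds hz)).hasDerivAt
        have : HasDerivAt f (1 * k z + z * deriv k z) z := by
          rw [show f = fun z => z * k z from funext hfk]
          exact (hasDerivAt_id z).mul hkz
        rw [this.deriv, one_mul]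
      rw [e1.deriv_eq]
      have hk1 := (hkd.differentiableAt hnhds).hasDerivAt
      have hk2 := (hkd'.differentiableAt hnhds).hasDerivAt
      have : HasDerivAt (fun z => k z + z * deriv k z)
          (deriv k 0 + (1 * deriv k 0 + 0 * deriv (deriv k) 0)) 0 :=
        hk1.add ((hasDerivAt_id (0:ℂ)).mul hk2)
      rw [this.deriv]; ring
    rw [hm10, norm_neg, norm_div] at hb
    rw [hf2, norm_mul]
    simp only [Complex.norm_ofNat] at hb ⊢
    linarith
  · intro z hz hz0
    have e := hexp (z ^ 2)
    have : z⁻¹ + m1 0 * z + z ^ 2 * (z * m2 (z ^ 2)) = z⁻¹ * Mf (z ^ 2) := by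
      rw [e]; field_simp; ring
    simp only [this, hF, hMf, Complex.exp_neg]
    field_simp

-- Affine normalization of `g` on the disk reduces this to the unit disk; division by `deriv g c`
-- makes it a bound for the logarithmic derivative of `deriv g`.
open Set Metric Complex in
theorem norm_deriv_deriv_le_of_injOn {g : ℂ → ℂ} {c : ℂ} {R : ℝ} (hR : 0 < R)
    (hg : DifferentiableOn ℂ g (ball c R)) (hi : InjOn g (ball c R)) :
    ‖deriv (deriv g) c‖ * R ≤ 12 * ‖deriv g c‖ := by
  have hRC : (R : ℂ) ≠ 0 := by exact_mod_cast hR.ne'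
  have hd0 : deriv g c ≠ 0 := deriv_ne_zero_of_injOn isOpen_ball hg hi (mem_ball_self hR)
  have hmaps : ∀ z ∈ ball (0:ℂ) 1, c + R * z ∈ ball c R := by
    intro z hz
    rw [mem_ball_zero_iff] at hz
    rw [mem_ball, dist_eq_norm, add_sub_cancel_left, norm_mul, norm_real, Real.norm_of_nonneg hR.le]
    nlinarith
  set f : ℂ → ℂ := fun z => (g (c + R * z) - g c) / (R * deriv g c) with hf
  have hfd' : ∀ z ∈ ball (0:ℂ) 1, HasDerivAt f (deriv g (c + R * z) / deriv g c) z := by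
    intro z hz
    have h1 := (hg.differentiableAt (isOpen_ball.mem_nhds (hmaps z hz))).hasDerivAt
    have h2 : HasDerivAt (fun z : ℂ => c + R * z) (R * 1) z :=
      ((hasDerivAt_id z).const_mul (R:ℂ)).const_add c
    refine (((h1.comp z h2).sub_const (g c)).div_const _).congr_deriv ?_
    field_simp
  have hfd : DifferentiableOn ℂ f (ball 0 1) :=
    fun z hz => (hfd' z hz).differentiableAt.differentiableWithinAt
  have hfi : InjOn f (ball 0 1) := by
    intro z hz w hw hzw
    simp only [hf] at hzw
    rw [div_left_inj' (mul_ne_zero hRC hd0), sub_left_inj] at hzw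
    have := hi (hmaps z hz) (hmaps w hw) hzw
    exact mul_left_cancel₀ hRC (add_left_cancel this)
  have hm0 : (0:ℂ) ∈ ball (0:ℂ) 1 := mem_ball_self one_pos
  have h := norm_deriv_deriv_le_of_normalized hfd hfi (by simp [hf])
    (by rw [(hfd' 0 hm0).deriv]; simp [hd0])
  have hdd : deriv (deriv f) 0 = R * deriv (deriv g) c / deriv g c := by
    have e1 : deriv f =ᶠ[𝓝 0] fun z => deriv g (c + R * z) / deriv g c := by
      filter_upwards [isOpen_ball.mem_nhds hm0] with z hz using (hfd' z hz).deriv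
    rw [e1.deriv_eq]
    have h1 : HasDerivAt (deriv g) (deriv (deriv g) c) (c + R * 0) := by
      rw [mul_zero, add_zero]
      exact ((hg.deriv isOpen_ball).differentiableAt (ball_mem_nhds c hR)).hasDerivAt
    have h2 : HasDerivAt (fun z : ℂ => c + R * z) (R * 1) 0 :=
      ((hasDerivAt_id (0:ℂ)).const_mul (R:ℂ)).const_add c
    have := ((h1.comp 0 h2).div_const (deriv g c)).deriv
    simp only [Function.comp_def] at this
    rw [this]; ring
  rw [hdd, norm_div, norm_mul, norm_real, Real.norm_of_nonneg hR.le,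
    div_le_iff₀ (norm_pos_iff.2 hd0)] at h
  linarith

open Set Metric Complex in
/-- A weak form of the Koebe one-quarter theorem. -/
theorem norm_deriv_mul_le_of_notMem_image {g : ℂ → ℂ} {c p : ℂ} {R : ℝ} (hR : 0 < R)
    (hg : DifferentiableOn ℂ g (ball c R)) (hi : InjOn g (ball c R)) (hp : p ∉ g '' ball c R) :
    ‖deriv g c‖ * R ≤ 12 * ‖g c - p‖ := by
  have hne : ∀ z ∈ ball c R, g z - p ≠ 0 := fun z hz h => hp ⟨z, hz, sub_eq_zero.1 h⟩
  have hc : c ∈ ball c R := mem_ball_self hR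
  have hgp := hne c hc
  have hd0 : deriv g c ≠ 0 := deriv_ne_zero_of_injOn isOpen_ball hg hi hc
  -- The inversion at the omitted value is univalent too. Its second derivative carries the extra
  -- term `2 g'² / (g - p)³`; the coefficient bounds for `g` and `k` together control that term.
  set k : ℂ → ℂ := fun z => (g z - p)⁻¹ with hk
  have hkd' : ∀ z ∈ ball c R, HasDerivAt k (-deriv g z / (g z - p) ^ 2) z := fun z hz =>
    (((hg.differentiableAt (isOpen_ball.mem_nhds hz)).hasDerivAt).sub_const p).inv (hne z hz)
  have hkd : DifferentiableOn ℂ k (ball c R) :=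
    fun z hz => (hkd' z hz).differentiableAt.differentiableWithinAt
  have hki : InjOn k (ball c R) := by
    intro z hz w hw hzw
    exact hi hz hw (sub_left_injective (inv_injective hzw))
  have h1 := norm_deriv_deriv_le_of_injOn hR hg hi
  have h2 := norm_deriv_deriv_le_of_injOn hR hkd hki
  have hkdd : deriv (deriv k) c =
      -deriv (deriv g) c / (g c - p) ^ 2 + 2 * deriv g c ^ 2 / (g c - p) ^ 3 := by
    have e1 : deriv k =ᶠ[𝓝 c] fun z => -deriv g z / (g z - p) ^ 2 := by
      filter_upwards [isOpen_ball.mem_nhds hc] with z hz using (hkd' z hz).deriv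
    rw [e1.deriv_eq]
    have a1 := ((hg.deriv isOpen_ball).differentiableAt (ball_mem_nhds c hR)).hasDerivAt
    have a2 := (((hg.differentiableAt (isOpen_ball.mem_nhds hc)).hasDerivAt).sub_const p).pow 2
    have := (a1.neg.div a2 (pow_ne_zero 2 hgp)).deriv
    refine this.trans ?_
    simp only [Pi.neg_apply, Pi.pow_apply]
    field_simp
    push_cast
    ring
  rw [hkdd, (hkd' c hc).deriv, norm_div, norm_neg, norm_pow] at h2
  set D := ‖deriv g c‖ with hD
  set P := ‖g c - p‖ with hP
  have hP0 : 0 < P := norm_pos_iff.2 hgp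
  have hD0 : 0 < D := norm_pos_iff.2 hd0
  have h3 : 2 * D ^ 2 / P ^ 3 - ‖deriv (deriv g) c‖ / P ^ 2 ≤
      ‖-deriv (deriv g) c / (g c - p) ^ 2 + 2 * deriv g c ^ 2 / (g c - p) ^ 3‖ := by
    have e1 : ‖2 * deriv g c ^ 2 / (g c - p) ^ 3‖ = 2 * D ^ 2 / P ^ 3 := by
      simp [hD, hP]
    have e2 : ‖-deriv (deriv g) c / (g c - p) ^ 2‖ = ‖deriv (deriv g) c‖ / P ^ 2 := by
      simp [hP]
    rw [← e1, ← e2, add_comm]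
    have := norm_sub_le_norm_add (2 * deriv g c ^ 2 / (g c - p) ^ 3) (-deriv (deriv g) c / (g c - p) ^ 2)
    exact this
  have h4 : (2 * D ^ 2 / P ^ 3 - ‖deriv (deriv g) c‖ / P ^ 2) * R ≤ 12 * (D / P ^ 2) :=
    (mul_le_mul_of_nonneg_right h3 hR.le).trans h2
  have h5 : ‖deriv (deriv g) c‖ / P ^ 2 * R ≤ 12 * D / P ^ 2 := by
    rw [div_mul_eq_mul_div]; gcongr
  have h6 : 2 * D ^ 2 / P ^ 3 * R ≤ 24 * D / P ^ 2 := by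
    have : 12 * D / P ^ 2 = 12 * (D / P ^ 2) := by ring
    have : 24 * D / P ^ 2 = 24 * (D / P ^ 2) := by ring
    rw [sub_mul] at h4; linarith
  have h7 : 2 * D ^ 2 / P ^ 3 * R * (P ^ 3 / (2 * D)) ≤ 24 * D / P ^ 2 * (P ^ 3 / (2 * D)) := by
    gcongr
  have e1 : 2 * D ^ 2 / P ^ 3 * R * (P ^ 3 / (2 * D)) = D * R := by field_simp
  have e2 : 24 * D / P ^ 2 * (P ^ 3 / (2 * D)) = 12 * P := by field_simp; norm_num
  linarith

open Set Metric Complex in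
/-- A weak form of the Koebe distortion theorem. -/
theorem norm_deriv_le_exp_mul_of_injOn {g : ℂ → ℂ} {c z w : ℂ} {R : ℝ}
    (hg : DifferentiableOn ℂ g (ball c R)) (hi : InjOn g (ball c R))
    (hz : z ∈ closedBall c (R / 2)) (hw : w ∈ closedBall c (R / 2)) (hR : 0 < R) :
    ‖deriv g w‖ ≤ Real.exp (24 * (‖w - z‖ / R)) * ‖deriv g z‖ := by
  have hsub : ∀ x ∈ closedBall c (R / 2), ball x (R / 2) ⊆ ball c R := by
    intro x hx
    refine ball_subset_ball' ?_
    rw [mem_closedBall] at hx; linarith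
  have hbound : ∀ x ∈ closedBall c (R / 2), ‖deriv (deriv g) x‖ ≤ 24 / R * ‖deriv g x‖ := by
    intro x hx
    have := norm_deriv_deriv_le_of_injOn (half_pos hR) (hg.mono (hsub x hx)) (hi.mono (hsub x hx))
    rw [div_mul_eq_mul_div, le_div_iff₀ hR]; linarith
  have hin : ∀ t ∈ Icc (0:ℝ) 1, z + t * (w - z) ∈ closedBall c (R / 2) := by
    intro t ht
    have := (convex_closedBall c (R / 2)).add_smul_sub_mem hz hw ht
    simpa [Complex.real_smul] using this
  have hcb : closedBall c (R / 2) ⊆ ball c R := closedBall_subset_ball (by linarith)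
  have hder : ∀ t ∈ Icc (0:ℝ) 1, HasDerivAt (fun t : ℝ => deriv g (z + t * (w - z)))
      (deriv (deriv g) (z + t * (w - z)) * (w - z)) t := by
    intro t ht
    have h1 := ((hg.deriv isOpen_ball).differentiableAt
      (isOpen_ball.mem_nhds (hcb (hin t ht)))).hasDerivAt
    have h2 : HasDerivAt (fun t : ℂ => z + t * (w - z)) (1 * (w - z)) (t : ℂ) :=
      ((hasDerivAt_id (t : ℂ)).mul_const (w - z)).const_add z
    have h3 := (HasDerivAt.comp (t : ℂ) h1 h2).comp_ofReal
    simpa [Function.comp_def] using h3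
  -- Each point of the half-size disk is the centre of a disk of radius `R / 2`, so `|g''| ≤ (24 /
  -- R) |g'|` there; Grönwall along the segment integrates this.
  have := norm_le_gronwallBound_of_norm_deriv_right_le (K := 24 / R * ‖w - z‖) (ε := 0)
    (a := 0) (b := 1) (δ := ‖deriv g z‖)
    (fun t ht => (hder t ht).continuousAt.continuousWithinAt)
    (fun t ht => (hder t ⟨ht.1, ht.2.le⟩).hasDerivWithinAt) (by simp) (fun t ht => by
      rw [norm_mul, add_zero]
      calc _ ≤ 24 / R * ‖deriv g (z + t * (w - z))‖ * ‖w - z‖ := by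
            gcongr; exact hbound _ (hin t ⟨ht.1, ht.2.le⟩)
        _ = _ := by ring) 1 ⟨zero_le_one, le_rfl⟩
  rw [gronwallBound_ε0] at this
  simp only [ofReal_one, one_mul, add_sub_cancel, sub_zero, mul_one] at this
  rw [mul_comm]
  convert this using 3
  ring

open Set Metric Complex in
/-- The Schwarz lemma for maps of a disk into the right half-plane. -/
theorem mul_norm_deriv_le_two_mul_re {t : ℂ → ℂ} {c : ℂ} {d : ℝ} (hd : 0 < d)
    (ht : DifferentiableOn ℂ t (ball c d)) (hpos : ∀ z ∈ ball c d, 0 < (t z).re) :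
    d * ‖deriv t c‖ ≤ 2 * (t c).re := by
  have hc : c ∈ ball c d := mem_ball_self hd
  have hden : ∀ z ∈ ball c d, t z + (starRingEnd ℂ) (t c) ≠ 0 := by
    intro z hz h
    have := congrArg Complex.re h
    simp at this
    linarith [hpos z hz, hpos c hc]
  -- The Cayley map of the half-plane centred at `t c`, which reduces the estimate to the Schwarz
  -- lemma of the disk.
  set k : ℂ → ℂ := fun z => (t z - t c) / (t z + (starRingEnd ℂ) (t c)) with hk
  have hkd : DifferentiableOn ℂ k (ball c d) :=
    (ht.sub_const _).div (ht.add_const _) hden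
  have hkc : k c = 0 := by simp [hk]
  have hmaps : MapsTo k (ball c d) (closedBall (k c) 1) := by
    intro z hz
    rw [hkc, mem_closedBall_zero_iff]
    simp only [hk]
    rw [norm_div, div_le_one (norm_pos_iff.2 (hden z hz))]
    rw [← sq_le_sq₀ (norm_nonneg _) (norm_nonneg _), ← Complex.normSq_eq_norm_sq,
      ← Complex.normSq_eq_norm_sq, Complex.normSq_apply, Complex.normSq_apply]
    simp
    nlinarith [mul_pos (hpos z hz) (hpos c hc)]
  have h := norm_deriv_le_div_of_mapsTo_ball hkd hmaps hd
  have htc := (ht.differentiableAt (isOpen_ball.mem_nhds hc)).hasDerivAt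
  have hkder : deriv k c = deriv t c / (2 * (t c).re : ℝ) := by
    have := ((htc.sub_const (t c)).div (htc.add_const ((starRingEnd ℂ) (t c))) (hden c hc)).deriv
    refine this.trans ?_
    have hn := hden c hc
    rw [Complex.add_conj] at hn ⊢
    simp only [sub_self, zero_mul, sub_zero]
    field_simp
  rw [hkder, norm_div, norm_real, Real.norm_of_nonneg (by linarith [hpos c hc]),
    div_le_div_iff₀ (by linarith [hpos c hc]) hd] at h
  linarith

/-! ### Biholomorphic maps and tract models -/

/-- `t` maps the open set `U` biholomorphically onto the open set `V`, with inverse `p`. -/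
structure IsBiholo (t p : ℂ → ℂ) (U V : Set ℂ) : Prop where
  isOpen_source : IsOpen U
  isOpen_target : IsOpen V
  diff : DifferentiableOn ℂ t U
  diff_inv : DifferentiableOn ℂ p V
  mapsTo : ∀ z ∈ U, t z ∈ V
  mapsTo_inv : ∀ w ∈ V, p w ∈ U
  left_inv : ∀ z ∈ U, p (t z) = z
  right_inv : ∀ w ∈ V, t (p w) = w

theorem isOpen_rightHalfPlane : IsOpen rightHalfPlane := Complex.isOpen_re_gt 0

open Set in
theorem IsBiholo.injOn {t p : ℂ → ℂ} {U V : Set ℂ} (h : IsBiholo t p U V) : InjOn t U := by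
  intro x hx y hy hxy
  rw [← h.left_inv x hx, ← h.left_inv y hy, hxy]

theorem IsBiholo.symm {t p : ℂ → ℂ} {U V : Set ℂ} (h : IsBiholo t p U V) : IsBiholo p t V U :=
  ⟨h.isOpen_target, h.isOpen_source, h.diff_inv, h.diff, h.mapsTo_inv, h.mapsTo, h.right_inv,
    h.left_inv⟩

theorem IsBiholo.trans {t p s q : ℂ → ℂ} {U V W : Set ℂ} (h : IsBiholo t p U V)
    (h' : IsBiholo s q V W) : IsBiholo (fun z => s (t z)) (fun w => p (q w)) U W where
  isOpen_source := h.isOpen_source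
  isOpen_target := h'.isOpen_target
  diff := h'.diff.comp h.diff h.mapsTo
  diff_inv := h.diff_inv.comp h'.diff_inv h'.mapsTo_inv
  mapsTo z hz := h'.mapsTo _ (h.mapsTo z hz)
  mapsTo_inv w hw := h.mapsTo_inv _ (h'.mapsTo_inv w hw)
  left_inv z hz := by rw [h'.left_inv _ (h.mapsTo z hz), h.left_inv z hz]
  right_inv w hw := by rw [h.right_inv _ (h'.mapsTo_inv w hw), h'.right_inv w hw]

open Set in
/-- The inverse of an injective holomorphic map is holomorphic. -/
theorem differentiableOn_of_leftInverse {t p : ℂ → ℂ} {U V : Set ℂ} (hU : IsOpen U)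
    (ht : DifferentiableOn ℂ t U) (hp : ∀ w ∈ V, p w ∈ U) (hl : ∀ z ∈ U, p (t z) = z)
    (hr : ∀ w ∈ V, t (p w) = w) : DifferentiableOn ℂ p V := by
  have hi : InjOn t U := fun x hx y hy hxy => by rw [← hl x hx, ← hl y hy, hxy]
  intro w hw
  have hz := hp w hw
  have hne := deriv_ne_zero_of_injOn hU ht hi hz
  have hst : HasStrictDerivAt t (deriv t (p w)) (p w) :=
    (ht.analyticAt (hU.mem_nhds hz)).hasStrictDerivAt
  -- The nonzero derivative makes `t` open at `p w`; this supplies the continuity of `p` that the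
  -- inverse function rule requires.
  have hmap := hst.map_nhds_eq hne
  rw [hr w hw] at hmap
  have hcont : ContinuousAt p w := by
    rw [ContinuousAt, tendsto_def]
    intro N hN
    rw [← hmap]
    have : N ∩ U ∈ 𝓝 (p w) := inter_mem hN (hU.mem_nhds hz)
    filter_upwards [image_mem_map this] with y hy
    obtain ⟨x, hx, rfl⟩ := hy
    rw [mem_preimage, hl x hx.2]; exact hx.1
  have hd : HasDerivAt p (deriv t (p w))⁻¹ w := by
    refine HasDerivAt.of_local_left_inverse hcont hst.hasDerivAt hne ?_
    rw [← hmap, eventually_map]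
    filter_upwards [hU.mem_nhds hz] with x hx
    rw [hl x hx]
  exact hd.differentiableAt.differentiableWithinAt

open Set in
theorem IsTractModel.isBiholo {τ : ℂ → ℂ} {Ω : Set ℂ} (h : IsTractModel τ Ω) :
    IsBiholo τ (Function.invFunOn τ Ω) Ω rightHalfPlane := by
  have hp : ∀ w ∈ rightHalfPlane, Function.invFunOn τ Ω w ∈ Ω := fun w hw =>
    Function.invFunOn_mem (h.bijOn.surjOn hw)
  have hr : ∀ w ∈ rightHalfPlane, τ (Function.invFunOn τ Ω w) = w := fun w hw =>
    Function.invFunOn_eq (h.bijOn.surjOn hw)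
  have hl : ∀ z ∈ Ω, Function.invFunOn τ Ω (τ z) = z := fun z hz =>
    h.bijOn.injOn.leftInvOn_invFunOn hz
  exact ⟨h.isOpen, isOpen_rightHalfPlane, h.differentiableOn,
    differentiableOn_of_leftInverse h.isOpen h.differentiableOn hp hl hr, h.bijOn.mapsTo, hp, hl, hr⟩

/-! ### Length-area estimates: infinity as a single boundary point of a dyadic domain -/

open Set in
/-- A curve joining two points at distance `≥ D` has a piece of length `≥ D` that stays within
distance `D` of one of its ends. -/
theorem exists_subarc {γ : ℝ → ℂ} {α β D : ℝ} (hαβ : α ≤ β) (hγ : ContinuousOn γ (Icc α β))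
    (hD : D ≤ ‖γ β - γ α‖) {B : ℂ} (hB : B = γ α ∨ B = γ β) :
    ∃ l r, α ≤ l ∧ l ≤ r ∧ r ≤ β ∧ D ≤ ‖γ r - γ l‖ ∧ ∀ θ ∈ Ioo l r, ‖γ θ - B‖ < D := by
  set T : Set ℝ := Icc α β ∩ (fun θ => ‖γ θ - B‖) ⁻¹' Ici D with hT
  have hTc : IsCompact T :=
    isCompact_Icc.of_isClosed_subset
      ((hγ.sub continuousOn_const).norm.preimage_isClosed_of_isClosed isClosed_Icc isClosed_Ici)
      inter_subset_left
  rcases hB with hB | hB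
  · have hne : T.Nonempty := ⟨β, ⟨hαβ, le_rfl⟩, by simpa [hB] using hD⟩
    obtain ⟨θ, hθ, hmin⟩ := hTc.exists_isLeast hne
    refine ⟨α, θ, le_rfl, hθ.1.1, hθ.1.2, by simpa [hB] using hθ.2, fun x hx => ?_⟩
    by_contra hlt
    push Not at hlt
    exact absurd (hmin ⟨⟨hx.1.le, hx.2.le.trans hθ.1.2⟩, hlt⟩) (not_le.2 hx.2)
  · have hne : T.Nonempty := ⟨α, ⟨le_rfl, hαβ⟩, by simpa [hB, norm_sub_rev] using hD⟩
    obtain ⟨θ, hθ, hmax⟩ := hTc.exists_isGreatest hne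
    refine ⟨θ, β, hθ.1.1, hθ.1.2, le_rfl, by simpa [hB, norm_sub_rev] using hθ.2, fun x hx => ?_⟩
    by_contra hlt
    push Not at hlt
    exact absurd (hmax ⟨⟨hθ.1.1.trans hx.1.le, hx.2.le⟩, hlt⟩) (not_le.2 hx.1)

-- The inequality `(‖γ'‖ - 1)² ≥ 0` takes the place of Cauchy–Schwarz in the length-area method.
-- With `D = L = π` it still leaves the lower bound `π`.
open Set in
theorem ofReal_le_lintegral_norm_sq {γ γ' : ℝ → ℂ} {l r D L : ℝ} (hlr : l ≤ r)
    (hd : ∀ θ ∈ Icc l r, HasDerivAt γ (γ' θ) θ) (hc : ContinuousOn γ' (Icc l r))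
    (hD : D ≤ ‖γ r - γ l‖) (hL : r - l ≤ L) :
    ENNReal.ofReal (2 * D - L) ≤ ∫⁻ θ in Ioo l r, ENNReal.ofReal (‖γ' θ‖ ^ 2) := by
  have hci : IntervalIntegrable γ' volume l r := (hc.mono (by rw [uIcc_of_le hlr])).intervalIntegrable
  have h1 := intervalIntegral.integral_eq_sub_of_hasDerivAt (by rwa [uIcc_of_le hlr]) hci
  have h2 := intervalIntegral.norm_integral_le_integral_norm (f := γ') (μ := volume) hlr
  rw [h1] at h2
  have hi2 : IntervalIntegrable (fun θ => ‖γ' θ‖ ^ 2) volume l r :=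
    ((hc.norm.pow 2).mono (by rw [uIcc_of_le hlr])).intervalIntegrable
  have h3 : ∫ θ in l..r, (2 * ‖γ' θ‖ - 1) ≤ ∫ θ in l..r, ‖γ' θ‖ ^ 2 := by
    refine intervalIntegral.integral_mono_on hlr
      ((hci.norm.const_mul 2).sub intervalIntegrable_const) hi2 fun θ _ => ?_
    nlinarith [sq_nonneg (‖γ' θ‖ - 1)]
  rw [intervalIntegral.integral_sub (hci.norm.const_mul 2) intervalIntegrable_const,
    intervalIntegral.integral_const_mul, intervalIntegral.integral_const, smul_eq_mul, mul_one] at h3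
  have h4 : 2 * D - L ≤ ∫ θ in l..r, ‖γ' θ‖ ^ 2 := by linarith
  refine (ENNReal.ofReal_le_ofReal h4).trans ?_
  rw [intervalIntegral.integral_of_le hlr, integral_Ioc_eq_integral_Ioo,
    ofReal_integral_eq_lintegral_ofReal (hi2.1.mono_set Ioo_subset_Ioc_self)
      (Eventually.of_forall fun s => by positivity)]

open Set Metric Complex in
/-- The length-area estimate for semicircles in the right half-plane. -/
theorem log_div_le_of_semicircles {p : ℂ → ℂ} (hp : DifferentiableOn ℂ p rightHalfPlane)
    (hi : InjOn p rightHalfPlane) {R ε c : ℝ} (hR : 0 ≤ R) (hε : 0 < ε) (hεc : ε < c)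
    (h : ∀ r, ε < r → r < c → ∃ w₁ ∈ rightHalfPlane, ∃ w₂ ∈ rightHalfPlane, ‖w₁‖ = r ∧ ‖w₂‖ = r ∧
      ‖p w₂‖ ≤ R ∧ Real.pi ≤ ‖p w₁ - p w₂‖) :
    Real.log c - Real.log ε ≤ (R + 4) ^ 2 := by
  have hpi := Real.pi_pos
  set S : Set ℂ := Ioo (Real.log ε) (Real.log c) ×ℂ Ioo (-(Real.pi / 2)) (Real.pi / 2) with hS
  have hSo : IsOpen S := isOpen_Ioo.reProdIm isOpen_Ioo
  have hexp : ∀ ζ : ℂ, ζ.im ∈ Ioo (-(Real.pi / 2)) (Real.pi / 2) → exp ζ ∈ rightHalfPlane := by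
    intro ζ hζ
    change 0 < (exp ζ).re
    rw [Complex.exp_re]
    exact mul_pos (Real.exp_pos _) (Real.cos_pos_of_mem_Ioo hζ)
  -- In logarithmic polar coordinates the semicircles are vertical segments of length `π`.
  set G : ℂ → ℂ := fun ζ => p (exp ζ) with hG
  have hstrip : IsOpen {ζ : ℂ | ζ.im ∈ Ioo (-(Real.pi / 2)) (Real.pi / 2)} :=
    isOpen_Ioo.preimage continuous_im
  have hGd : DifferentiableOn ℂ G {ζ : ℂ | ζ.im ∈ Ioo (-(Real.pi / 2)) (Real.pi / 2)} :=
    hp.comp Complex.differentiable_exp.differentiableOn hexp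
  have hGat : ∀ ζ : ℂ, ζ.im ∈ Ioo (-(Real.pi / 2)) (Real.pi / 2) → DifferentiableAt ℂ G ζ :=
    fun ζ hζ => hGd.differentiableAt (hstrip.mem_nhds hζ)
  have hGc' : ContinuousOn (deriv G) {ζ : ℂ | ζ.im ∈ Ioo (-(Real.pi / 2)) (Real.pi / 2)} :=
    (hGd.deriv hstrip).continuousOn
  have hGi : InjOn G S := by
    intro x hx y hy hxy
    have he := hi (hexp x hx.2) (hexp y hy.2) hxy
    have hx2 := hx.2; have hy2 := hy.2
    simp only [mem_preimage, mem_Ioo] at hx2 hy2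
    exact Complex.exp_inj_of_neg_pi_lt_of_le_pi (by linarith) (by linarith) (by linarith)
      (by linarith) he
  -- Only the part with bounded image is counted, which keeps the image area at most `π (R + 4)²`.
  set S' : Set ℂ := S ∩ G ⁻¹' ball 0 (R + Real.pi) with hS'
  have hS'o : IsOpen S' :=
    (hGd.continuousOn.mono fun ζ hζ => hζ.2).isOpen_inter_preimage hSo isOpen_ball
  have harea := lintegral_norm_deriv_sq_eq_volume_image hS'o.measurableSet
    (fun ζ hζ => hGat ζ hζ.1.2) (hGi.mono inter_subset_left)
  have hvol : volume (G '' S') ≤ ENNReal.ofReal (Real.pi * (R + 4) ^ 2) := by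
    have hsub : G '' S' ⊆ closedBall 0 (R + 4) := by
      rintro _ ⟨ζ, hζ, rfl⟩
      have := mem_ball_zero_iff.1 hζ.2
      rw [mem_closedBall_zero_iff]
      linarith [Real.pi_lt_four]
    refine (measure_mono hsub).trans_eq ?_
    rw [Complex.volume_closedBall, ← ENNReal.ofReal_pow (by linarith), mul_comm,
      ENNReal.ofReal_mul hpi.le]
    congr 1
    rw [← NNReal.coe_real_pi, ENNReal.ofReal_coe_nnreal]
  set Fn : ℂ → ℝ≥0∞ := S'.indicator fun ζ => ENNReal.ofReal (‖deriv G ζ‖ ^ 2) with hFn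
  have hFm : Measurable Fn := Measurable.indicator (by fun_prop) hS'o.measurableSet
  have hinner : ∀ s ∈ Ioo (Real.log ε) (Real.log c), ENNReal.ofReal Real.pi ≤
      ∫⁻ θ in Ioo (-(Real.pi / 2)) (Real.pi / 2), Fn (s + θ * I) := by
    intro s hs
    obtain ⟨w₁, hw₁, w₂, hw₂, h1, h2, h3, h4⟩ := h (Real.exp s)
      ((Real.log_lt_iff_lt_exp hε).1 hs.1) ((Real.lt_log_iff_exp_lt (hε.trans hεc)).1 hs.2)
    have harg : ∀ w ∈ rightHalfPlane, w.arg ∈ Ioo (-(Real.pi / 2)) (Real.pi / 2) := by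
      intro w hw
      have := (Complex.abs_arg_lt_pi_div_two_iff (z := w)).2 (Or.inl hw)
      exact abs_lt.1 this
    have hpol : ∀ w ∈ rightHalfPlane, ‖w‖ = Real.exp s → G (s + w.arg * I) = p w := by
      intro w hw hn
      have hw0 : w ≠ 0 := by rw [← norm_pos_iff, hn]; exact Real.exp_pos s
      simp only [hG]
      congr 1
      rw [← Complex.exp_log hw0]
      congr 1
      apply Complex.ext <;> simp [Complex.log_re, Complex.log_im, hn, Complex.exp_log hw0]
    set γ : ℝ → ℂ := fun θ => G (s + θ * I) with hγ
    set γ' : ℝ → ℂ := fun θ => deriv G (s + θ * I) * I with hγ'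
    have him : ∀ θ ∈ Ioo (-(Real.pi / 2)) (Real.pi / 2),
        ((s : ℂ) + θ * I).im ∈ Ioo (-(Real.pi / 2)) (Real.pi / 2) := by
      intro θ hθ; simpa using hθ
    have hγd : ∀ θ ∈ Ioo (-(Real.pi / 2)) (Real.pi / 2), HasDerivAt γ (γ' θ) θ := by
      intro θ hθ
      have e1 := (hGat _ (him θ hθ)).hasDerivAt
      have e2 : HasDerivAt (fun θ : ℂ => (s : ℂ) + θ * I) (1 * I) (θ : ℂ) :=
        ((hasDerivAt_id (θ : ℂ)).mul_const I).const_add _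
      have e3 := (HasDerivAt.comp (θ : ℂ) e1 e2).comp_ofReal
      simpa [Function.comp_def] using e3
    have hγ'c : ContinuousOn γ' (Ioo (-(Real.pi / 2)) (Real.pi / 2)) := by
      refine ContinuousOn.mul ?_ continuousOn_const
      exact hGc'.comp (by fun_prop) him
    -- The piece of the image curve that stays within `π` of `p w₂` remains in `S'`, and it is long
    -- enough for the lower bound.
    obtain ⟨l, r, hl, hlr, hr, hdist, hball⟩ : ∃ l r, -(Real.pi / 2) < l ∧ l ≤ r ∧ r < Real.pi / 2 ∧
        Real.pi ≤ ‖γ r - γ l‖ ∧ ∀ θ ∈ Ioo l r, ‖γ θ - p w₂‖ < Real.pi := by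
      have hcont : ∀ α β, -(Real.pi / 2) < α → β < Real.pi / 2 → ContinuousOn γ (Icc α β) :=
        fun α β hα hβ θ hθ =>
          (hγd θ ⟨hα.trans_le hθ.1, hθ.2.trans_lt hβ⟩).continuousAt.continuousWithinAt
      have a1 := harg w₁ hw₁
      have a2 := harg w₂ hw₂
      have g1 : γ w₁.arg = p w₁ := hpol w₁ hw₁ h1
      have g2 : γ w₂.arg = p w₂ := hpol w₂ hw₂ h2
      rcases le_total w₁.arg w₂.arg with hle | hle
      · obtain ⟨l, r, q1, q2, q3, q4, q5⟩ := exists_subarc (D := Real.pi) hle (hcont _ _ a1.1 a2.2)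
          (by rw [g1, g2, norm_sub_rev]; exact h4) (Or.inr g2.symm)
        exact ⟨l, r, a1.1.trans_le q1, q2, q3.trans_lt a2.2, q4, q5⟩
      · obtain ⟨l, r, q1, q2, q3, q4, q5⟩ := exists_subarc (D := Real.pi) hle (hcont _ _ a2.1 a1.2)
          (by rw [g1, g2]; exact h4) (Or.inl g2.symm)
        exact ⟨l, r, a2.1.trans_le q1, q2, q3.trans_lt a1.2, q4, q5⟩
    have hIcc : Icc l r ⊆ Ioo (-(Real.pi / 2)) (Real.pi / 2) :=
      fun θ hθ => ⟨hl.trans_le hθ.1, hθ.2.trans_lt hr⟩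
    have hlen := ofReal_le_lintegral_norm_sq (L := Real.pi) hlr (fun θ hθ => hγd θ (hIcc hθ))
      (hγ'c.mono hIcc) hdist (by linarith)
    rw [show 2 * Real.pi - Real.pi = Real.pi by ring] at hlen
    refine hlen.trans ?_
    refine (setLIntegral_mono' measurableSet_Ioo fun θ hθ => ?_).trans
      (lintegral_mono_set (Ioo_subset_Icc_self.trans hIcc))
    have hmem : (s : ℂ) + θ * I ∈ S' := by
      refine ⟨⟨by simpa using hs, him θ (hIcc (Ioo_subset_Icc_self hθ))⟩, ?_⟩
      rw [mem_preimage, mem_ball_zero_iff]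
      calc ‖G (s + θ * I)‖ = ‖(γ θ - p w₂) + p w₂‖ := by rw [sub_add_cancel]
        _ ≤ ‖γ θ - p w₂‖ + ‖p w₂‖ := norm_add_le _ _
        _ < R + Real.pi := by linarith [hball θ hθ]
    rw [hFn, indicator_of_mem hmem]
    simp [hγ']
  have hfub := setLIntegral_reProdIm (Ioo (Real.log ε) (Real.log c))
    (Ioo (-(Real.pi / 2)) (Real.pi / 2)) Fn hFm
  have hlow : ENNReal.ofReal (Real.pi * (Real.log c - Real.log ε)) ≤ ∫⁻ z in S, Fn z := by
    rw [hS, hfub]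
    refine le_trans ?_ (setLIntegral_mono' measurableSet_Ioo hinner)
    rw [setLIntegral_const, Real.volume_Ioo, ENNReal.ofReal_mul hpi.le]
  have hup : ∫⁻ z in S, Fn z ≤ ∫⁻ z in S', ENNReal.ofReal (‖deriv G z‖ ^ 2) := by
    rw [hFn, ← lintegral_indicator hS'o.measurableSet]
    exact setLIntegral_le_lintegral _ _
  have hfin := hlow.trans (hup.trans (harea.le.trans hvol))
  rw [ENNReal.ofReal_le_ofReal_iff (by positivity)] at hfin
  exact le_of_mul_le_mul_left hfin hpi

/-- The geometric properties of a domain invariant under `z ↦ 2z` that force the point at infinity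
to be a single boundary point. -/
structure IsDyadicDomain (Ω : Set ℂ) : Prop where
  isPreconnected : IsPreconnected Ω
  zero_notMem : (0 : ℂ) ∉ Ω
  two_mul_mem_iff : ∀ z : ℂ, 2 * z ∈ Ω ↔ z ∈ Ω
  ray : ∃ e : ℝ, |e| = 1 ∧ ∀ t : ℝ, 0 < t → (e * t : ℂ) ∈ Ω
  lines : ∀ s d : ℝ, |s| = 1 → |d| = 1 →
    (∀ x : ℝ, 0 < x → (d * x + s * Real.pi * Complex.I : ℂ) ∈ Ω) ∨
    (∀ x : ℝ, 0 < x → (d * x + s * Real.pi * Complex.I : ℂ) ∉ Ω)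
  vertex : ∀ s : ℝ, |s| = 1 → (s * Real.pi * Complex.I : ℂ) ∉ Ω
  cone : ∃ C : ℝ, 0 < C ∧ IsCompact {z ∈ Ω | 1 ≤ ‖z‖ ∧ ‖z‖ ≤ 2 ∧ C * |z.im| ≤ |z.re|}

theorem IsDyadicDomain.zpow_mul_mem {Ω : Set ℂ} (hΩ : IsDyadicDomain Ω) (n : ℤ) {z : ℂ}
    (hz : z ∈ Ω) : (2 : ℂ) ^ n * z ∈ Ω := by
  induction n using Int.induction_on with
  | zero => simpa using hz
  | succ n ih =>
    rw [zpow_add_one₀ two_ne_zero, mul_comm ((2:ℂ) ^ (n:ℤ)), mul_assoc]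
    exact (hΩ.two_mul_mem_iff _).2 ih
  | pred n ih =>
    rw [← hΩ.two_mul_mem_iff, ← mul_assoc, ← zpow_one_add₀ two_ne_zero]
    simpa using ih

theorem IsDyadicDomain.map_zpow_mul {Ω : Set ℂ} (hΩ : IsDyadicDomain Ω) {t : ℂ → ℂ} {a : ℝ}
    (ha : 0 < a) (ht : ∀ z ∈ Ω, t (2 * z) = a * t z) (n : ℤ) {z : ℂ} (hz : z ∈ Ω) :
    t ((2 : ℂ) ^ n * z) = (a : ℂ) ^ n * t z := by
  have haC : (a : ℂ) ≠ 0 := by exact_mod_cast ha.ne'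
  induction n using Int.induction_on with
  | zero => simp
  | succ n ih =>
    rw [zpow_add_one₀ two_ne_zero, mul_comm ((2:ℂ) ^ (n:ℤ)), mul_assoc,
      ht _ (hΩ.zpow_mul_mem _ hz), ih, zpow_add_one₀ haC]
    ring
  | pred n ih =>
    have h := ht _ (hΩ.zpow_mul_mem (-n - 1) hz)
    rw [← mul_assoc, ← zpow_one_add₀ two_ne_zero, add_sub_cancel, ih] at h
    rw [zpow_sub_one₀ haC, mul_right_comm, h]
    field_simp

theorem exists_dyadic_scale {z : ℂ} (hz : z ≠ 0) :
    ∃ n : ℤ, ∃ ζ : ℂ, z = (2 : ℂ) ^ n * ζ ∧ 1 ≤ ‖ζ‖ ∧ ‖ζ‖ < 2 ∧ (2 : ℝ) ^ n ≤ ‖z‖ ∧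
      ‖z‖ < (2 : ℝ) ^ (n + 1) := by
  obtain ⟨n, h1, h2⟩ := exists_mem_Ico_zpow (norm_pos_iff.2 hz) (one_lt_two (α := ℝ))
  have h2n : (0:ℝ) < 2 ^ n := by positivity
  refine ⟨n, (2 : ℂ) ^ (-n) * z, ?_, ?_, ?_, h1, h2⟩
  · rw [← mul_assoc, ← zpow_add₀ two_ne_zero]; simp
  · rw [norm_mul, norm_zpow, Complex.norm_ofNat, zpow_neg, inv_mul_eq_div, le_div_iff₀ h2n]
    simpa using h1
  · rw [norm_mul, norm_zpow, Complex.norm_ofNat, zpow_neg, inv_mul_eq_div, div_lt_iff₀ h2n]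
    rwa [zpow_add_one₀ two_ne_zero, mul_comm] at h2

-- Along the ray `|t|` scales by `a` under doubling, so it takes every positive value; where it is
-- below `c` the point cannot be far out. These points are the inner ends of the crosscuts in the
-- length-area argument.
open Set Metric Complex in
theorem IsDyadicDomain.exists_norm_eq_on_ray {Ω : Set ℂ} (hΩ : IsDyadicDomain Ω) {t : ℂ → ℂ} {a : ℝ}
    (ha : 1 < a) (htc : ContinuousOn t Ω) (ht0 : ∀ z ∈ Ω, t z ≠ 0)
    (ht : ∀ z ∈ Ω, t (2 * z) = a * t z) (c : ℝ) :
    ∃ R : ℝ, 0 ≤ R ∧ ∀ r, 0 < r → r < c → ∃ B ∈ Ω, B.im = 0 ∧ ‖t B‖ = r ∧ ‖B‖ ≤ R := by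
  obtain ⟨e, he, hray⟩ := hΩ.ray
  have ha0 : 0 < a := by linarith
  set N : ℝ → ℝ := fun x => ‖t (e * x)‖ with hN
  have hNc : ContinuousOn N (Ioi 0) := by
    refine (htc.comp (f := fun x : ℝ => (e * x : ℂ)) (by fun_prop) fun x hx => hray x hx).norm
  have hNs : ∀ n : ℤ, ∀ x : ℝ, 0 < x → N (2 ^ n * x) = a ^ n * N x := by
    intro n x hx
    simp only [hN]
    have := hΩ.map_zpow_mul ha0 ht n (hray x hx)
    rw [show ((e : ℂ) * ((2 ^ n * x : ℝ) : ℂ)) = (2:ℂ) ^ n * (e * x) by push_cast; ring, this,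
      norm_mul, norm_zpow, norm_real, Real.norm_of_nonneg ha0.le]
  have hNpos : ∀ x, 0 < x → 0 < N x := fun x hx => norm_pos_iff.2 (ht0 _ (hray x hx))
  obtain ⟨x0, hx0, hmin⟩ := (isCompact_Icc (a := (1:ℝ)) (b := 2)).exists_isMinOn
    ⟨1, by norm_num⟩ (hNc.mono fun x hx => lt_of_lt_of_le one_pos hx.1)
  have hm0 : 0 < N x0 := hNpos x0 (lt_of_lt_of_le one_pos hx0.1)
  obtain ⟨k, hk⟩ := pow_unbounded_of_one_lt (c / N x0) ha
  rw [div_lt_iff₀ hm0] at hk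
  refine ⟨2 ^ k, by positivity, fun r hr hrc => ?_⟩
  obtain ⟨n1, hn1⟩ := pow_unbounded_of_one_lt (r / N 1) ha
  obtain ⟨n2, hn2⟩ := pow_unbounded_of_one_lt (N 1 / r) ha
  have hN1 := hNpos 1 one_pos
  rw [div_lt_iff₀ hN1] at hn1
  rw [div_lt_iff₀ hr] at hn2
  have h1 : N (2 ^ (n1 : ℤ) * 1) = a ^ (n1 : ℤ) * N 1 := hNs n1 1 one_pos
  have h2 : N (2 ^ (-n2 : ℤ) * 1) = a ^ (-n2 : ℤ) * N 1 := hNs (-n2) 1 one_pos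
  have h2' : a ^ (-n2 : ℤ) * N 1 < r := by
    rw [zpow_neg, zpow_natCast, inv_mul_lt_iff₀ (by positivity)]; exact hn2
  have hivt := isPreconnected_Ioi.intermediate_value
    (show (2:ℝ) ^ (-n2 : ℤ) * 1 ∈ Ioi (0:ℝ) by rw [mem_Ioi]; positivity)
    (show (2:ℝ) ^ (n1 : ℤ) * 1 ∈ Ioi (0:ℝ) by rw [mem_Ioi]; positivity) hNc
  obtain ⟨x, hx, hxr⟩ := hivt (show r ∈ Icc _ _ from ⟨by rw [h2]; exact h2'.le, by
    rw [h1, zpow_natCast]; exact hn1.le⟩)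
  have hx' : 0 < x := hx
  refine ⟨e * x, hray x hx, by simp, hxr, ?_⟩
  rw [norm_mul, norm_real, norm_real, Real.norm_eq_abs, he, one_mul, Real.norm_of_nonneg hx'.le]
  by_contra hlt
  push Not at hlt
  obtain ⟨n, hn, hn'⟩ := exists_mem_Ico_zpow hx' (one_lt_two (α := ℝ))
  have hkn : (k : ℤ) ≤ n := by
    have : (2:ℝ) ^ (k : ℤ) < 2 ^ (n + 1) := by rw [zpow_natCast]; exact hlt.trans hn'
    have := (zpow_lt_zpow_iff_right₀ (one_lt_two (α := ℝ))).1 this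
    omega
  have h2n : (0:ℝ) < 2 ^ n := by positivity
  have hy : x / 2 ^ n ∈ Icc (1:ℝ) 2 := by
    constructor
    · rwa [le_div_iff₀ h2n, one_mul]
    · rw [div_le_iff₀ h2n, mul_comm]; rw [zpow_add_one₀ two_ne_zero] at hn'; exact hn'.le
  have h3 := hNs n (x / 2 ^ n) (by positivity)
  rw [mul_div_cancel₀ _ h2n.ne'] at h3
  have h4 : N x0 ≤ N (x / 2 ^ n) := hmin hy
  have h5 : a ^ k ≤ a ^ n := by
    rw [← zpow_natCast]; exact zpow_le_zpow_right₀ ha.le hkn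
  have h6 : a ^ k * N x0 ≤ N x := by rw [h3]; gcongr
  rw [hxr] at h6
  linarith

-- The horizontal line through the vertex splits, off the vertex, into half-lines that lie inside or
-- outside `Ω`. On those inside, `|t|` is at least `c` at one point, so if the value `r` were never
-- taken on or above the line then `|t| > r` all along it. This would separate `z` from the ray,
-- against the connectedness of `Ω`.
open Set Metric Complex in
theorem IsDyadicDomain.exists_norm_eq_above {Ω : Set ℂ} (hΩ : IsDyadicDomain Ω) {t : ℂ → ℂ}
    (hΩo : IsOpen Ω) (htc : ContinuousOn t Ω) {s c r : ℝ} (hs : |s| = 1)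
    (hc : ∀ d : ℝ, |d| = 1 → (d + s * Real.pi * I : ℂ) ∈ Ω → c ≤ ‖t (d + s * Real.pi * I)‖)
    (hrc : r < c) {z : ℂ} (hz : z ∈ Ω) (hzs : Real.pi ≤ s * z.im) (hzr : ‖t z‖ < r) :
    ∃ A ∈ Ω, Real.pi ≤ s * A.im ∧ ‖t A‖ = r := by
  by_contra hno
  push Not at hno
  have hss : s * s = 1 := by rw [← sq, ← sq_abs, hs, one_pow]
  have hpi := Real.pi_pos
  have hline : ∀ A ∈ Ω, s * A.im = Real.pi → r < ‖t A‖ := by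
    intro A hA hAs
    have him : A.im = s * Real.pi := by rw [← hAs, ← mul_assoc, hss, one_mul]
    have hre0 : A.re ≠ 0 := by
      intro h0
      refine hΩ.vertex s hs ?_
      have : A = (s * Real.pi * I : ℂ) := by apply Complex.ext <;> simp [h0, him]
      rwa [← this]
    obtain ⟨d, hd, x, hx, hAx⟩ : ∃ d : ℝ, |d| = 1 ∧ ∃ x : ℝ, 0 < x ∧ A.re = d * x := by
      rcases lt_or_gt_of_ne hre0 with h | h
      · exact ⟨-1, by simp, -A.re, by linarith, by ring⟩
      · exact ⟨1, by simp, A.re, h, by ring⟩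
    have hAe : A = (d * x + s * Real.pi * I : ℂ) := by apply Complex.ext <;> simp [hAx, him]
    rcases hΩ.lines s d hs hd with hl | hl
    · by_contra hle
      push Not at hle
      have hcont : ContinuousOn (fun x : ℝ => ‖t (d * x + s * Real.pi * I)‖) (Ioi 0) :=
        (htc.comp (f := fun x : ℝ => (d * x + s * Real.pi * I : ℂ)) (by fun_prop)
          fun x hx => hl x hx).norm
      have hivt := isPreconnected_Ioi.intermediate_value (show x ∈ Ioi (0:ℝ) from hx)
        (show (1:ℝ) ∈ Ioi (0:ℝ) from one_pos (α := ℝ)) hcont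
      have h1 := hc d hd (by simpa using hl 1 one_pos)
      obtain ⟨y, hy, hyr⟩ := hivt (show r ∈ Icc _ _ from ⟨by rw [← hAe]; exact hle, by
        simp only [ofReal_one, mul_one]; linarith⟩)
      refine hno _ (hl y hy) ?_ hyr
      simp [← mul_assoc, hss]
    · rw [hAe] at hA
      exact absurd hA (hl x hx)
  have hnc : ContinuousOn (fun z => ‖t z‖) Ω := htc.norm
  have hO1 : IsOpen (Ω ∩ (fun z => ‖t z‖) ⁻¹' Iio r) := hnc.isOpen_inter_preimage hΩo isOpen_Iio
  have hO2 : IsOpen (Ω ∩ (fun z => ‖t z‖) ⁻¹' Ioi r) := hnc.isOpen_inter_preimage hΩo isOpen_Ioi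
  have hI1 : IsOpen {z : ℂ | Real.pi < s * z.im} := isOpen_lt continuous_const (by fun_prop)
  have hI2 : IsOpen {z : ℂ | s * z.im < Real.pi} := isOpen_lt (by fun_prop) continuous_const
  obtain ⟨e, he, hray⟩ := hΩ.ray
  obtain ⟨x, hx, hx1, hx2⟩ := hΩ.isPreconnected _ _ (hO1.inter hI1)
    (hO2.union hI2) (by
      intro A hA
      rcases lt_trichotomy (s * A.im) Real.pi with h | h | h
      · exact Or.inr (Or.inr h)
      · exact Or.inr (Or.inl ⟨hA, hline A hA h⟩)
      · rcases lt_or_gt_of_ne (hno A hA h.le) with h' | h'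
        · exact Or.inl ⟨⟨hA, h'⟩, h⟩
        · exact Or.inr (Or.inl ⟨hA, h'⟩))
    ⟨z, hz, ⟨hz, hzr⟩, lt_of_le_of_ne hzs fun h => absurd (hline z hz h.symm) (not_lt.2 hzr.le)⟩
    ⟨e * (1:ℝ), hray 1 one_pos, Or.inr (by simpa using hpi)⟩
  have q1 : ‖t x‖ < r := hx1.1.2
  have q2 : Real.pi < s * x.im := hx1.2
  rcases hx2 with h | h
  · exact absurd h.2 (not_lt.2 q1.le)
  · exact absurd h (not_lt.2 q2.le)

open Set Metric Complex in
/-- In a dyadic domain, a uniformizing map that conjugates `z ↦ 2z` to a dilation stays away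
from zero near infinity. -/
theorem IsDyadicDomain.exists_norm_ge {Ω : Set ℂ} (hΩ : IsDyadicDomain Ω) {t p : ℂ → ℂ} {a : ℝ}
    (htp : IsBiholo t p Ω rightHalfPlane) (ha : 1 < a) (ht : ∀ z ∈ Ω, t (2 * z) = a * t z) :
    ∃ c : ℝ, 0 < c ∧ ∃ R : ℝ, ∀ z ∈ Ω, R ≤ ‖z‖ → c ≤ ‖t z‖ := by
  have htc := htp.diff.continuousOn
  have ha0 : 0 < a := by linarith
  have ht0 : ∀ z ∈ Ω, t z ≠ 0 := by
    intro z hz h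
    have h1 : 0 < (t z).re := htp.mapsTo z hz
    rw [h] at h1; simp at h1
  have hside : ∀ s : ℝ, |s| = 1 → ∃ c : ℝ, 0 < c ∧ ∀ z ∈ Ω, Real.pi ≤ s * z.im → c ≤ ‖t z‖ := by
    intro s hs
    obtain ⟨c, hc0, hc⟩ : ∃ c : ℝ, 0 < c ∧ ∀ d : ℝ, |d| = 1 → (d + s * Real.pi * I : ℂ) ∈ Ω →
        c ≤ ‖t (d + s * Real.pi * I)‖ := by
      have hone : ∀ d : ℝ, ∃ c : ℝ, 0 < c ∧ ((d + s * Real.pi * I : ℂ) ∈ Ω →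
          c ≤ ‖t (d + s * Real.pi * I)‖) := by
        intro d
        by_cases h : (d + s * Real.pi * I : ℂ) ∈ Ω
        · exact ⟨_, norm_pos_iff.2 (ht0 _ h), fun _ => le_rfl⟩
        · exact ⟨1, one_pos, fun h' => absurd h' h⟩
      obtain ⟨c1, h1, h1'⟩ := hone 1
      obtain ⟨c2, h2, h2'⟩ := hone (-1)
      refine ⟨min c1 c2, lt_min h1 h2, fun d hd h => ?_⟩
      rcases eq_or_eq_neg_of_abs_eq hd with rfl | rfl
      · exact (min_le_left _ _).trans (h1' h)
      · exact (min_le_right _ _).trans (h2' h)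
    obtain ⟨R, hR, hB⟩ := hΩ.exists_norm_eq_on_ray ha htc ht0 ht c
    refine ⟨Real.exp (Real.log c - (R + 4) ^ 2), Real.exp_pos _, fun z hz hzs => ?_⟩
    have hz0 : 0 < ‖t z‖ := norm_pos_iff.2 (ht0 z hz)
    rw [← Real.le_log_iff_exp_le hz0]
    rcases le_or_gt c ‖t z‖ with h | h
    · have := Real.log_le_log hc0 h
      nlinarith [sq_nonneg (R + 4)]
    -- Each semicircle of radius between `|t z|` and `c` contains the image of a point beyond height
    -- `π` and the image of a real point of modulus at most `R`; the preimages are at least `π`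
    -- apart.
    · have := log_div_le_of_semicircles htp.diff_inv htp.symm.injOn hR hz0 h fun r hr hrc => by
        obtain ⟨A, hA, hAs, hAr⟩ := hΩ.exists_norm_eq_above htp.isOpen_source htc hs hc hrc hz hzs hr
        obtain ⟨B, hBΩ, hB0, hBr, hBR⟩ := hB r (hz0.trans hr) hrc
        refine ⟨t A, htp.mapsTo A hA, t B, htp.mapsTo B hBΩ, hAr, hBr, ?_, ?_⟩
        · rw [htp.left_inv B hBΩ]; exact hBR
        · rw [htp.left_inv B hBΩ, htp.left_inv A hA]
          calc Real.pi ≤ s * A.im := hAs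
            _ ≤ |s * A.im| := le_abs_self _
            _ = |(A - B).im| := by rw [abs_mul, hs, one_mul, sub_im, hB0, sub_zero]
            _ ≤ ‖A - B‖ := abs_im_le_norm _
      linarith
  obtain ⟨c1, hc1, h1⟩ := hside 1 (by simp)
  obtain ⟨c2, hc2, h2⟩ := hside (-1) (by simp)
  -- Distant points with `|Im| < π` lie in the cone around the real axis, where scaling reduces to a
  -- compact fundamental piece.
  obtain ⟨C, hC, hcpt⟩ := hΩ.cone
  obtain ⟨c3, hc3, h3⟩ : ∃ c : ℝ, 0 < c ∧
      ∀ z ∈ {z ∈ Ω | 1 ≤ ‖z‖ ∧ ‖z‖ ≤ 2 ∧ C * |z.im| ≤ |z.re|}, c ≤ ‖t z‖ := by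
    rcases eq_empty_or_nonempty {z ∈ Ω | 1 ≤ ‖z‖ ∧ ‖z‖ ≤ 2 ∧ C * |z.im| ≤ |z.re|} with h | h
    · exact ⟨1, one_pos, fun z hz => by rw [h] at hz; exact hz.elim⟩
    · obtain ⟨x, hx, hmin⟩ := hcpt.exists_isMinOn h (htc.norm.mono fun z hz => hz.1)
      exact ⟨_, norm_pos_iff.2 (ht0 x hx.1), fun z hz => hmin hz⟩
  refine ⟨min c1 (min c2 c3), by positivity, Real.pi * (C + 1) + 1, fun z hz hzR => ?_⟩
  have hpi := Real.pi_pos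
  rcases le_or_gt Real.pi z.im with h | h
  · exact (min_le_left _ _).trans (h1 z hz (by simpa using h))
  rcases le_or_gt Real.pi (-z.im) with h' | h'
  · exact (min_le_right _ _).trans ((min_le_left _ _).trans (h2 z hz (by simpa using h')))
  refine (min_le_right _ _).trans ((min_le_right _ _).trans ?_)
  have hz0 : z ≠ 0 := by
    rintro rfl; simp at hzR; nlinarith
  have him : |z.im| ≤ Real.pi := abs_le.2 ⟨by linarith, h.le⟩
  have hre : C * |z.im| ≤ |z.re| := by
    have := Complex.norm_le_abs_re_add_abs_im z
    nlinarith
  obtain ⟨n, ζ, hzn, hζ1, hζ2, hn1, hn2⟩ := exists_dyadic_scale hz0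
  have hn0 : 0 ≤ n := by
    have : (2:ℝ) ^ (0:ℤ) < 2 ^ (n + 1) := by
      refine lt_of_le_of_lt ?_ hn2
      rw [zpow_zero]; nlinarith
    have := (zpow_lt_zpow_iff_right₀ (one_lt_two (α := ℝ))).1 this
    omega
  have hζΩ : ζ ∈ Ω := by
    have := hΩ.zpow_mul_mem (-n) hz
    rw [hzn, ← mul_assoc, ← zpow_add₀ two_ne_zero] at this
    simpa using this
  have h2n : (0:ℝ) < 2 ^ n := by positivity
  have hcast : ((2:ℂ) ^ n) = ((2 ^ n : ℝ) : ℂ) := by push_cast; rfl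
  have hζc : C * |ζ.im| ≤ |ζ.re| := by
    rw [hzn, hcast, re_ofReal_mul, im_ofReal_mul, abs_mul, abs_mul, abs_of_pos h2n] at hre
    have : 2 ^ n * (C * |ζ.im|) ≤ 2 ^ n * |ζ.re| := by linarith
    exact le_of_mul_le_mul_left this h2n
  have h4 := h3 ζ ⟨hζΩ, hζ1, hζ2.le, hζc⟩
  rw [hzn, hΩ.map_zpow_mul ha0 ht n hζΩ, norm_mul, norm_zpow, norm_real, Real.norm_of_nonneg ha0.le]
  have : 1 ≤ a ^ n := one_le_zpow₀ ha.le hn0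
  nlinarith

-- Rescaling by `2 ^ n` multiplies `t` by `a ^ n`, so the fixed lower bound near infinity can be
-- made arbitrarily large.
open Set Metric Complex in
theorem IsDyadicDomain.norm_tendsto {Ω : Set ℂ} (hΩ : IsDyadicDomain Ω) {t p : ℂ → ℂ} {a : ℝ}
    (htp : IsBiholo t p Ω rightHalfPlane) (ha : 1 < a) (ht : ∀ z ∈ Ω, t (2 * z) = a * t z) (M : ℝ) :
    ∃ R : ℝ, ∀ z ∈ Ω, R ≤ ‖z‖ → M ≤ ‖t z‖ := by
  have ha0 : 0 < a := by linarith
  obtain ⟨c, hc, R, hR⟩ := hΩ.exists_norm_ge htp ha ht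
  obtain ⟨n, hn⟩ := pow_unbounded_of_one_lt (M / c) ha
  rw [div_lt_iff₀ hc] at hn
  refine ⟨2 ^ n * R, fun z hz hzR => ?_⟩
  have hw := hΩ.zpow_mul_mem (-n) hz
  have h1 := hΩ.map_zpow_mul ha0 ht n hw
  rw [← mul_assoc, ← zpow_add₀ two_ne_zero] at h1
  simp only [add_neg_cancel, zpow_zero, one_mul] at h1
  have h2 := hR _ hw (by
    rw [norm_mul, norm_zpow, Complex.norm_ofNat, zpow_neg, zpow_natCast, inv_mul_eq_div,
      le_div_iff₀ (by positivity)]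
    linarith)
  rw [h1, norm_mul, norm_zpow, norm_real, Real.norm_of_nonneg ha0.le, zpow_natCast]
  have : (0:ℝ) < a ^ n := by positivity
  nlinarith

/-! ### Linearizing `z ↦ 2z`: automorphisms of the half-plane -/

open Set Metric Complex in
theorem norm_image_sub_le_of_injOn {g : ℂ → ℂ} {c w : ℂ} {R r : ℝ}
    (hg : DifferentiableOn ℂ g (ball c R)) (hi : InjOn g (ball c R)) (hR : 0 < R)
    (hr : r ≤ R / 2) (hw : ‖w - c‖ ≤ r) :
    ‖g w - g c‖ ≤ Real.exp (24 * (r / R)) * ‖deriv g c‖ * ‖w - c‖ := by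
  have hr0 : 0 ≤ r := (norm_nonneg _).trans hw
  refine (convex_closedBall c r).norm_image_sub_le_of_norm_deriv_le
    (fun x hx => hg.differentiableAt (isOpen_ball.mem_nhds
      (closedBall_subset_ball (by linarith) hx))) (fun x hx => ?_)
    (mem_closedBall_self hr0) (by rwa [mem_closedBall, dist_eq_norm])
  have hx' : ‖x - c‖ ≤ r := by rwa [mem_closedBall, dist_eq_norm] at hx
  refine (norm_deriv_le_exp_mul_of_injOn hg hi (mem_closedBall_self (by linarith))
    (closedBall_subset_closedBall hr hx) hR).trans ?_
  gcongr

/-- The Cayley transform of the right half-plane. -/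
noncomputable def cayley (w : ℂ) : ℂ := (w - 1) / (w + 1)

/-- The inverse of the Cayley transform. -/
noncomputable def cayleyInv (x : ℂ) : ℂ := (1 + x) / (1 - x)

open Set Metric Complex in
theorem isBiholo_cayley : IsBiholo cayley cayleyInv rightHalfPlane (ball 0 1) := by
  have h1 : ∀ w ∈ rightHalfPlane, w + 1 ≠ 0 := by
    intro w hw h
    have hw' : 0 < w.re := hw
    have := congrArg Complex.re h
    simp at this; linarith
  have h2 : ∀ x ∈ ball (0:ℂ) 1, 1 - x ≠ 0 := by
    intro x hx h
    rw [sub_eq_zero] at h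
    rw [← h] at hx; simp at hx
  refine ⟨isOpen_rightHalfPlane, isOpen_ball, ?_, ?_, ?_, ?_, ?_, ?_⟩
  · exact (differentiableOn_id.sub_const 1).div (differentiableOn_id.add_const 1) h1
  · exact (differentiableOn_id.const_add 1).div (differentiableOn_id.const_sub 1) h2
  · intro w hw
    have hw' : 0 < w.re := hw
    rw [mem_ball_zero_iff, cayley, norm_div, div_lt_one (norm_pos_iff.2 (h1 w hw)),
      ← sq_lt_sq₀ (norm_nonneg _) (norm_nonneg _), ← Complex.normSq_eq_norm_sq,
      ← Complex.normSq_eq_norm_sq, Complex.normSq_apply, Complex.normSq_apply]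
    simp; nlinarith
  · intro x hx
    have hx' := mem_ball_zero_iff.1 hx
    change 0 < (cayleyInv x).re
    have hn : 0 < normSq (1 - x) := Complex.normSq_pos.2 (h2 x hx)
    rw [cayleyInv, Complex.div_re, ← add_div]
    refine div_pos ?_ hn
    have h3 : normSq x < 1 := by
      rw [Complex.normSq_eq_norm_sq]; nlinarith [norm_nonneg x]
    rw [Complex.normSq_apply] at h3
    simp; nlinarith
  · intro w hw
    have := h1 w hw
    rw [cayley, cayleyInv]
    field_simp
    ring
  · intro x hx
    have := h2 x hx
    rw [cayley, cayleyInv]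
    field_simp
    ring

open Set Metric Complex in
/-- A holomorphic automorphism of the disk that fixes the center is a rotation. -/
theorem exists_rotation_of_biholo {k k' : ℂ → ℂ} (h : IsBiholo k k' (ball 0 1) (ball 0 1))
    (h0 : k 0 = 0) : ∃ l : ℂ, ‖l‖ = 1 ∧ ∀ x ∈ ball (0:ℂ) 1, k x = l * x := by
  have hm0 : (0:ℂ) ∈ ball (0:ℂ) 1 := mem_ball_self one_pos
  have h0' : k' 0 = 0 := by have := h.left_inv 0 hm0; rwa [h0] at this
  have hhalf : (1/2 : ℂ) ∈ ball (0:ℂ) 1 := by simp; norm_num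
  -- The Schwarz lemma for `k` and for its inverse forces equality at `1/2`, and the equality case
  -- gives a rotation.
  have e1 : ‖k (1/2)‖ ≤ ‖(1/2:ℂ)‖ := norm_le_norm_of_mapsTo_ball h.diff
    (fun x hx => ball_subset_closedBall (h.mapsTo x hx)) h0 (by simpa using hhalf)
  have e2 : ‖k' (k (1/2))‖ ≤ ‖k (1/2)‖ := norm_le_norm_of_mapsTo_ball h.diff_inv
    (fun x hx => ball_subset_closedBall (h.mapsTo_inv x hx)) h0' (by simpa using h.mapsTo _ hhalf)
  rw [h.left_inv _ hhalf] at e2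
  have e3 : ‖k (1/2)‖ = 1/2 := by rw [le_antisymm e1 e2]; simp
  have hds : dslope k 0 (1/2) = 2 * k (1/2) := by
    rw [dslope_of_ne _ (by norm_num), slope_def_field, h0]; simp; ring
  have hnorm : ‖dslope k 0 (1/2)‖ = 1 := by
    rw [hds, norm_mul, e3]; simp
  have := affine_of_mapsTo_ball_of_norm_dslope_eq_div (R₂ := 1) h.diff
    (fun x hx => by rw [h0]; exact ball_subset_closedBall (h.mapsTo x hx)) hhalf (by rw [hnorm]; simp)
  refine ⟨_, hnorm, fun x hx => ?_⟩
  have hx2 := this hx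
  simp only [h0, sub_zero, zero_add, smul_eq_mul] at hx2
  rw [hx2, mul_comm]

open Set Metric Complex in
/-- Holomorphic automorphisms of the right half-plane are real Möbius transformations in the
coordinate `iw`. -/
theorem exists_moebius_of_biholo {ψ ψ' : ℂ → ℂ} (h : IsBiholo ψ ψ' rightHalfPlane rightHalfPlane) :
    ∃ A B C D : ℝ, 0 < A * D - B * C ∧
      ∀ w ∈ rightHalfPlane, I * ψ w * (C * (I * w) + D) = A * (I * w) + B := by
  have hone : (1:ℂ) ∈ rightHalfPlane := by change (0:ℝ) < (1:ℂ).re; simp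
  set u := (ψ 1).re with hu
  set v := (ψ 1).im with hv
  have hu0 : 0 < u := h.mapsTo 1 hone
  have huC : (u : ℂ) ≠ 0 := by exact_mod_cast hu0.ne'
  have haff : IsBiholo (fun w => (w - v * I) / u) (fun w => u * w + v * I)
      rightHalfPlane rightHalfPlane := by
    refine ⟨isOpen_rightHalfPlane, isOpen_rightHalfPlane, by fun_prop, by fun_prop, ?_, ?_, ?_, ?_⟩
    · intro w hw
      have hw' : 0 < w.re := hw
      change 0 < ((w - v * I) / u).re
      rw [Complex.div_ofReal_re]; simp; positivity
    · intro w hw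
      have hw' : 0 < w.re := hw
      change 0 < (u * w + v * I).re
      simp; positivity
    · intro w _
      field_simp; ring
    · intro w _
      field_simp; ring
  have hk := (isBiholo_cayley.symm.trans h).trans (haff.trans isBiholo_cayley)
  obtain ⟨l, hl, hkl⟩ := exists_rotation_of_biholo hk (by
    have : cayleyInv 0 = 1 := by simp [cayleyInv]
    simp only [this]
    have : (ψ 1 - v * I) / u = 1 := by
      rw [div_eq_one_iff_eq huC]; apply Complex.ext <;> simp [hu, hv]
    rw [this]; simp [cayley])
  -- Dividing the matrix of the rotation by `q`, whose inverse is its conjugate, makes the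
  -- coefficients real.
  obtain ⟨q, hq⟩ : ∃ q : ℂ, q ^ 2 = l := ⟨l ^ (1/2 : ℂ), by
    rw [one_div]; exact_mod_cast Complex.cpow_nat_inv_pow l two_ne_zero⟩
  have hqn : ‖q‖ = 1 := by
    rw [← hq, norm_pow] at hl
    exact (pow_eq_one_iff_of_nonneg (norm_nonneg q) two_ne_zero).1 hl
  have hqq : q.re ^ 2 + q.im ^ 2 = 1 := by
    have := Complex.normSq_eq_norm_sq q
    rw [hqn, Complex.normSq_apply] at this; nlinarith
  refine ⟨u * q.re + v * q.im, -(v * q.re - u * q.im), -q.im, q.re, ?_, fun w hw => ?_⟩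
  · have : (u * q.re + v * q.im) * q.re - -(v * q.re - u * q.im) * -q.im =
      u * (q.re ^ 2 + q.im ^ 2) := by ring
    rw [this, hqq]; linarith
  · have hw' : 0 < w.re := hw
    have hcw := isBiholo_cayley.mapsTo w hw
    have e1 := hkl _ hcw
    simp only [isBiholo_cayley.left_inv w hw] at e1
    set y := (ψ w - v * I) / u with hy
    have hyH : y ∈ rightHalfPlane := haff.mapsTo _ (h.mapsTo w hw)
    have hy1 : y + 1 ≠ 0 := by
      intro h0
      have hy' : 0 < y.re := hyH
      have := congrArg Complex.re h0
      simp at this; linarith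
    have hw1 : w + 1 ≠ 0 := by
      intro h0
      have := congrArg Complex.re h0
      simp at this; linarith
    have e2 : (y - 1) * (w + 1) = q ^ 2 * (w - 1) * (y + 1) := by
      rw [cayley, cayley, ← hq] at e1
      field_simp at e1
      linear_combination e1
    have hψ : ψ w = u * y + v * I := by rw [hy]; field_simp; ring
    have hqc : q = q.re + q.im * I := (Complex.re_add_im q).symm
    set α := (q.re : ℂ) with hα
    set β := (q.im : ℂ) with hβ
    have hqq' : α ^ 2 + β ^ 2 = 1 := by rw [hα, hβ]; exact_mod_cast hqq
    have hconj : (α - β * I) * q = 1 := by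
      rw [hqc]; linear_combination hqq' - β ^ 2 * I_sq
    have e3 : y * (α - β * I * w) = α * w - β * I := by
      have e4 : (α - β * I) * ((y - 1) * (w + 1)) = q * (w - 1) * (y + 1) := by
        rw [e2]; linear_combination (q * (w - 1) * (y + 1)) * hconj
      rw [hqc] at e4
      linear_combination (1/2) * e4
    rw [hψ]
    push_cast
    rw [← hα, ← hβ]
    linear_combination (u * I) * e3 + (-I * v * β * w - u * β + v * α) * I_sq

open Set Metric Complex in
theorem isBiholo_mul_neg_I : IsBiholo (fun w => -I * w) (fun w => I * w) {ζ : ℂ | 0 < ζ.im}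
    rightHalfPlane := by
  refine ⟨Complex.isOpen_im_gt 0, isOpen_rightHalfPlane, by fun_prop, by fun_prop, ?_, ?_, ?_, ?_⟩
  · intro w hw
    change 0 < (-I * w).re
    have : 0 < w.im := hw
    simpa using this
  · intro w hw
    change 0 < (I * w).im
    have : 0 < w.re := hw
    simpa using this
  · intro w _; ring_nf; simp
  · intro w _; ring_nf; simp

open Set Metric Complex in
theorem isBiholo_neg_inv_sub (x : ℝ) : IsBiholo (fun w => -(w - x)⁻¹) (fun w => x - w⁻¹)
    {ζ : ℂ | 0 < ζ.im} {ζ : ℂ | 0 < ζ.im} := by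
  have hne : ∀ w ∈ {ζ : ℂ | 0 < ζ.im}, w - x ≠ 0 := by
    intro w hw h
    have hw' : 0 < w.im := hw
    have := congrArg Complex.im h
    simp at this; linarith
  have hne0 : ∀ w ∈ {ζ : ℂ | 0 < ζ.im}, w ≠ 0 := by
    rintro w hw rfl
    simp at hw
  refine ⟨Complex.isOpen_im_gt 0, Complex.isOpen_im_gt 0,
    ((differentiableOn_id.sub_const _).inv hne).neg,
    (differentiableOn_id.inv hne0).const_sub _, ?_, ?_, ?_, ?_⟩
  · intro w hw
    have hw' : 0 < w.im := hw
    have := Complex.normSq_pos.2 (hne w hw)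
    simp only [mem_ofPred_eq, neg_im, inv_im, sub_im, ofReal_im, sub_zero, neg_div, neg_neg]
    positivity
  · intro w hw
    have hw' : 0 < w.im := hw
    have := Complex.normSq_pos.2 (hne0 w hw)
    simp only [mem_ofPred_eq, sub_im, ofReal_im, inv_im, neg_div, zero_sub, neg_neg]
    positivity
  · intro w _
    simp
  · intro w _
    simp

open Set Metric Complex in
/-- The map `z ↦ 2z` of a dyadic domain is not conjugate to a translation of the half-plane. -/
theorem IsDyadicDomain.not_translation {Ω : Set ℂ} (hΩ : IsDyadicDomain Ω) {t p : ℂ → ℂ} {b : ℝ}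
    (htp : IsBiholo t p Ω rightHalfPlane) (ht : ∀ z ∈ Ω, t (2 * z) = t z + b * I) : False := by
  -- `y` and `y + bi` are hyperbolically close for large `y`, yet `p` doubles from one to the other.
  -- Since `p` omits `0`, Koebe's bound and distortion give `y ≤ 12 exp(12) |b|`, which this `y`
  -- violates.
  set y : ℝ := 12 * (Real.exp 12 * (|b| + 1)) * 2 + 2 * |b| + 1 with hy
  have hy0 : 0 < y := by positivity
  have hby : |b| ≤ y / 2 := by
    have : 0 ≤ 12 * (Real.exp 12 * (|b| + 1)) * 2 := by positivity
    linarith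
  have hyH : (y : ℂ) ∈ rightHalfPlane := by simpa [rightHalfPlane] using hy0
  have hball : ball (y : ℂ) y ⊆ rightHalfPlane := by
    intro w hw
    rw [mem_ball, dist_eq_norm] at hw
    have := (abs_le.1 (Complex.abs_re_le_norm (w - y))).1
    change 0 < w.re
    simp at this; linarith
  have hpd := htp.diff_inv.mono hball
  have hpi := htp.symm.injOn.mono hball
  have h1 := norm_deriv_mul_le_of_notMem_image (p := 0) hy0 hpd hpi (by
    rintro ⟨w, hw, hw0⟩
    exact hΩ.zero_notMem (hw0 ▸ htp.mapsTo_inv w (hball hw)))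
  have h2 := norm_image_sub_le_of_injOn (w := y + b * I) (r := |b|) hpd hpi hy0 hby (by simp)
  have hpz := htp.mapsTo_inv _ hyH
  have h3 : p (y + b * I) = 2 * p y := by
    rw [← htp.right_inv _ hyH, ← ht _ hpz, htp.left_inv _ ((hΩ.two_mul_mem_iff _).2 hpz),
      htp.left_inv _ hpz]
  rw [h3, show 2 * p y - p y = p y by ring] at h2
  simp only [add_sub_cancel_left, norm_mul, norm_real, norm_I, mul_one, Real.norm_eq_abs, sub_zero] at h1 h2
  have hp0 : 0 < ‖p y‖ := norm_pos_iff.2 fun h => hΩ.zero_notMem (h ▸ hpz)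
  have h4 : Real.exp (24 * (|b| / y)) ≤ Real.exp 12 := by
    rw [Real.exp_le_exp]
    have : |b| / y ≤ 1 / 2 := by rw [div_le_iff₀ hy0]; linarith
    linarith
  have h5 : ‖p y‖ ≤ Real.exp 12 * ‖deriv p y‖ * |b| := h2.trans (by gcongr)
  have h6 : ‖p y‖ * y ≤ 12 * (Real.exp 12 * |b|) * ‖p y‖ := by
    calc ‖p y‖ * y ≤ Real.exp 12 * ‖deriv p y‖ * |b| * y := by gcongr
      _ = Real.exp 12 * |b| * (‖deriv p y‖ * y) := by ring
      _ ≤ Real.exp 12 * |b| * (12 * ‖p y‖) := by gcongr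
      _ = _ := by ring
  have h7 : y ≤ 12 * (Real.exp 12 * |b|) := by
    refine le_of_mul_le_mul_right ?_ hp0
    linarith
  have : 0 < Real.exp 12 := Real.exp_pos 12
  nlinarith [abs_nonneg b, mul_nonneg this.le (abs_nonneg b)]

/-- At a fixed point `A - Cx` and `Cx + D` are the two eigenvalues `(A + D ± s) / 2`, whose product
is positive. The sign of the trace tells which root has the larger eigenvalue in the numerator; in
the coordinate `-1 / (ζ - x)` the map then has factor at least `1`. -/
theorem exists_real_fixedPoint {A B C D : ℝ} (hdet : 0 < A * D - B * C) (hC : C ≠ 0)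
    (hdisc : 0 ≤ (A - D) ^ 2 + 4 * B * C) :
    ∃ x : ℝ, x * (C * x + D) = A * x + B ∧ A - C * x ≠ 0 ∧ 1 ≤ (C * x + D) / (A - C * x) := by
  set s := Real.sqrt ((A - D) ^ 2 + 4 * B * C) with hs
  have hs0 : 0 ≤ s := Real.sqrt_nonneg _
  have hss : s ^ 2 = (A - D) ^ 2 + 4 * B * C := Real.sq_sqrt hdisc
  have hT : (A + D - s) * (A + D + s) > 0 := by nlinarith
  rcases le_or_gt 0 (A + D) with h | h
  · have h1 : 0 < A + D + s := by
      by_contra h'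
      have : A + D + s = 0 := by linarith
      rw [this] at hT; simp at hT
    have h2 : 0 < A + D - s := by
      by_contra h'
      push Not at h'
      nlinarith
    refine ⟨((A - D) + s) / (2 * C), ?_, ?_, ?_⟩
    · field_simp; linear_combination hss
    · have : A - C * (((A - D) + s) / (2 * C)) = (A + D - s) / 2 := by field_simp; ring
      rw [this]; positivity
    · have e1 : A - C * (((A - D) + s) / (2 * C)) = (A + D - s) / 2 := by field_simp; ring
      have e2 : C * (((A - D) + s) / (2 * C)) + D = (A + D + s) / 2 := by field_simp; ring
      rw [e1, e2, one_le_div (by positivity)]; linarith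
  · have h1 : A + D - s < 0 := by linarith
    have h2 : A + D + s < 0 := by
      by_contra h'
      push Not at h'
      nlinarith
    refine ⟨((A - D) - s) / (2 * C), ?_, ?_, ?_⟩
    · field_simp; linear_combination hss
    · have : A - C * (((A - D) - s) / (2 * C)) = (A + D + s) / 2 := by field_simp; ring
      rw [this]; exact ne_of_lt (by linarith)
    · have e1 : A - C * (((A - D) - s) / (2 * C)) = (A + D + s) / 2 := by field_simp; ring
      have e2 : C * (((A - D) - s) / (2 * C)) + D = (A + D - s) / 2 := by field_simp; ring
      rw [e1, e2, one_le_div_of_neg (by linarith)]; linarith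

open Set Metric Complex in
theorem IsTractModel.norm_invFunOn_ge {τ : ℂ → ℂ} {Ω : Set ℂ} (h : IsTractModel τ Ω) (R : ℝ) :
    ∃ M : ℝ, ∀ w ∈ rightHalfPlane, M ≤ ‖w‖ → R ≤ ‖Function.invFunOn τ Ω w‖ := by
  have h1 := h.tendsto_infinity
  have h2 := (tendsto_norm_cobounded_atTop.comp h1).eventually_ge_atTop R
  rw [eventually_inf_principal] at h2
  obtain ⟨M, _, hM⟩ := (hasBasis_cobounded_norm (E := ℂ)).eventually_iff.1 h2
  exact ⟨M, fun w hw hMw => hM (by simpa using hMw) hw⟩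

open Set Metric Complex in
theorem IsTractModel.norm_lt_of_norm_lt {τ : ℂ → ℂ} {Ω : Set ℂ} (h : IsTractModel τ Ω) (R : ℝ) :
    ∃ M : ℝ, ∀ z ∈ Ω, ‖z‖ < R → ‖τ z‖ < M := by
  obtain ⟨M, hM⟩ := h.norm_invFunOn_ge R
  refine ⟨M, fun z hz hzR => ?_⟩
  by_contra hlt
  push Not at hlt
  have := hM _ (h.isBiholo.mapsTo z hz) hlt
  rw [h.isBiholo.left_inv z hz] at this
  linarith

open Set Metric Complex in
theorem IsDyadicDomain.isBiholo_two_mul {Ω : Set ℂ} (hΩ : IsDyadicDomain Ω) (ho : IsOpen Ω) :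
    IsBiholo (fun z => 2 * z) (fun z => 2⁻¹ * z) Ω Ω := by
  refine ⟨ho, ho, by fun_prop, by fun_prop, fun z hz => (hΩ.two_mul_mem_iff z).2 hz,
    fun z hz => (hΩ.two_mul_mem_iff _).1 (by simpa using hz), fun z _ => by simp, fun z _ => by simp⟩

-- `C ≠ 0` means that the automorphism moves infinity. If it is elliptic, its fixed point in the
-- half-plane would give `2z = z` with `z ≠ 0`. Otherwise a real fixed point `x` is sent to infinity
-- by `-1 / (ζ - x)`: the parabolic case is a translation, and in the hyperbolic case the new
-- coordinate tends to infinity as `z → ∞` in `Ω`, whereas it tends to `0` where `τ → ∞`.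
open Set Metric Complex in
theorem IsTractModel.not_moebius {Ω : Set ℂ} (hΩ : IsDyadicDomain Ω) {τ : ℂ → ℂ}
    (hτ : IsTractModel τ Ω) {A B C D : ℝ} (hdet : 0 < A * D - B * C) (hC : C ≠ 0)
    (hAB : ∀ z ∈ Ω, I * τ (2 * z) * (C * (I * τ z) + D) = A * (I * τ z) + B) : False := by
  have hB := hτ.isBiholo
  set φ := Function.invFunOn τ Ω with hφ
  have hCC : (C : ℂ) ≠ 0 := by exact_mod_cast hC
  have hden : ∀ ζ : ℂ, 0 < ζ.im → C * ζ + D ≠ 0 := by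
    intro ζ hζ h
    have := congrArg Complex.im h
    simp [hC, hζ.ne'] at this
  have him : ∀ z ∈ Ω, 0 < (I * τ z).im := by
    intro z hz
    have : 0 < (τ z).re := hB.mapsTo z hz
    simpa using this
  rcases lt_or_ge ((A - D) ^ 2 + 4 * B * C) 0 with hdisc | hdisc
  · -- an interior fixed point
    obtain ⟨ζ, hζ, hfix⟩ : ∃ ζ : ℂ, 0 < ζ.im ∧ ζ * (C * ζ + D) = A * ζ + B := by
      set s := Real.sqrt (-((A - D) ^ 2 + 4 * B * C)) with hs
      have hs0 : 0 < s := Real.sqrt_pos.2 (by linarith)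
      have hss : (s : ℂ) ^ 2 = -((A - D) ^ 2 + 4 * B * C) := by
        have : s ^ 2 = -((A - D) ^ 2 + 4 * B * C) := Real.sq_sqrt (by linarith)
        exact_mod_cast this
      refine ⟨((A - D) / (2 * C) : ℝ) + (s / (2 * |C|) : ℝ) * I, ?_, ?_⟩
      · have hCpos : 0 < |C| := abs_pos.2 hC
        rw [add_im, ofReal_im, zero_add, im_ofReal_mul, I_im, mul_one]
        positivity
      · rcases lt_or_gt_of_ne hC with h | h
        · rw [abs_of_neg h]; push_cast; field_simp
          linear_combination s ^ 2 * I_sq - hss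
        · rw [abs_of_pos h]; push_cast; field_simp
          linear_combination s ^ 2 * I_sq - hss
    have hwH : -I * ζ ∈ rightHalfPlane := isBiholo_mul_neg_I.mapsTo ζ hζ
    have hz := hB.mapsTo_inv _ hwH
    have h1 := hAB _ hz
    rw [hB.right_inv _ hwH] at h1
    rw [show I * (-I * ζ) = ζ by ring_nf; simp, ← hfix] at h1
    have h2 := mul_right_cancel₀ (hden ζ hζ) h1
    have h3 : τ (2 * φ (-I * ζ)) = -I * ζ := by
      linear_combination (-I) * h2 + τ (2 * φ (-I * ζ)) * I_sq
    have h4 : 2 * φ (-I * ζ) = φ (-I * ζ) := by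
      rw [← hB.left_inv _ ((hΩ.two_mul_mem_iff _).2 hz), h3]
    have h5 : φ (-I * ζ) = 0 := by linear_combination h4
    exact hΩ.zero_notMem (h5 ▸ hz)
  · obtain ⟨x, hx, hxne, hα⟩ := exists_real_fixedPoint hdet hC hdisc
    set α := (C * x + D) / (A - C * x) with hαdef
    set β := -C / (A - C * x) with hβ
    have hxneC : ((A : ℂ) - C * x) ≠ 0 := by exact_mod_cast hxne
    have hxC : (x : ℂ) * (C * x + D) = A * x + B := by exact_mod_cast hx
    have hW := hB.trans (isBiholo_mul_neg_I.symm.trans (isBiholo_neg_inv_sub x))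
    set W : ℂ → ℂ := fun z => -(I * τ z - x)⁻¹ with hWdef
    have hsubne : ∀ z ∈ Ω, I * τ z - x ≠ 0 := by
      intro z hz h
      have h1 := congrArg Complex.im h
      have h2 := him z hz
      rw [sub_im, ofReal_im, sub_zero, zero_im] at h1
      linarith
    have hWrec : ∀ z ∈ Ω, W (2 * z) = α * W z + β := by
      intro z hz
      have h1 := hAB z hz
      have h2 := hden _ (him z hz)
      have h3 := hsubne z hz
      have h4 := hsubne _ ((hΩ.two_mul_mem_iff z).2 hz)
      have h5 : (I * τ (2 * z) - x) * (C * (I * τ z) + D) = (I * τ z - x) * (A - C * x) := by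
        linear_combination h1 - hxC
      have h6 : (I * τ (2 * z) - x) = (I * τ z - x) * (A - C * x) / (C * (I * τ z) + D) := by
        rw [eq_div_iff h2, h5]
      simp only [hWdef, hαdef, hβ]
      rw [h6]
      push_cast
      field_simp
      ring
    rcases hα.eq_or_lt with hα1 | hα1
    · refine hΩ.not_translation (b := -β) (hW.trans isBiholo_mul_neg_I) fun z hz => ?_
      have h1 := hWrec z hz
      change -I * W (2 * z) = -I * W z + _
      rw [h1, ← hα1]; push_cast; ring
    -- The finite fixed point of `W ↦ αW + β`; subtracting it turns the affine recursion into a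
    -- dilation.
    · set x0 := -β / (α - 1) with hx0
      have hshift : IsBiholo (fun w => w - x0) (fun w => w + x0) {ζ : ℂ | 0 < ζ.im} {ζ : ℂ | 0 < ζ.im} := by
        refine ⟨Complex.isOpen_im_gt 0, Complex.isOpen_im_gt 0, by fun_prop, by fun_prop, ?_, ?_, ?_, ?_⟩
        · intro w hw; simpa using hw
        · intro w hw; simpa using hw
        · intro w _; ring
        · intro w _; ring
      have hT := (hW.trans hshift).trans isBiholo_mul_neg_I
      have hα1C : (α : ℂ) - 1 ≠ 0 := by
        have : α - 1 ≠ 0 := by linarith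
        exact_mod_cast this
      obtain ⟨R, hR⟩ := hΩ.norm_tendsto hT hα1 (fun z hz => by
        have h1 := hWrec z hz
        change -I * (W (2 * z) - x0) = α * (-I * (W z - x0))
        rw [h1, hx0]; push_cast; field_simp; ring) (|x0| + 2)
      obtain ⟨M, hM⟩ := hτ.norm_invFunOn_ge R
      -- Large enough that `φ y` has modulus at least `R`, while `|iy - x| ≥ 1` bounds the new
      -- coordinate by `1 + |x0|`.
      set y := max M 0 + |x| + 1 with hy
      have hM0 : 0 ≤ max M 0 := le_max_right _ _
      have hy0 : 0 < y := by positivity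
      have hyH : (y : ℂ) ∈ rightHalfPlane := by simpa [rightHalfPlane] using hy0
      have h1 := hM y hyH (by
        rw [norm_real, Real.norm_of_nonneg hy0.le]
        linarith [le_max_left M 0, abs_nonneg x])
      have hz := hB.mapsTo_inv _ hyH
      have h2 := hR _ hz h1
      simp only [hWdef] at h2
      rw [hB.right_inv _ hyH] at h2
      have h3 : 1 ≤ ‖I * (y : ℂ) - x‖ := by
        have := Complex.abs_im_le_norm (I * (y : ℂ) - x)
        simp at this
        rw [abs_of_pos hy0] at this
        linarith [abs_nonneg x]
      have h4 : ‖-I * (-(I * (y : ℂ) - x)⁻¹ - x0)‖ ≤ 1 + |x0| := by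
        rw [norm_mul, norm_neg, norm_I, one_mul]
        refine (norm_sub_le _ _).trans ?_
        rw [norm_neg, norm_inv, norm_real, Real.norm_eq_abs]
        gcongr
        exact inv_le_one_of_one_le₀ h3
      linarith

open Set Metric Complex in
/-- The uniformizing map of a dyadic domain that sends infinity to infinity conjugates `z ↦ 2z` to an
expanding affine map. -/
theorem IsTractModel.exists_affine {Ω : Set ℂ} (hΩ : IsDyadicDomain Ω) {τ : ℂ → ℂ}
    (hτ : IsTractModel τ Ω) :
    ∃ a b : ℝ, 1 < a ∧ ∀ z ∈ Ω, τ (2 * z) = a * τ z + b * I := by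
  have hB := hτ.isBiholo
  obtain ⟨A, B, C, D, hdet, hmoeb⟩ := exists_moebius_of_biholo
    ((hB.symm.trans (hΩ.isBiholo_two_mul hτ.isOpen)).trans hB)
  have hAB : ∀ z ∈ Ω, I * τ (2 * z) * (C * (I * τ z) + D) = A * (I * τ z) + B := by
    intro z hz
    have := hmoeb _ (hB.mapsTo z hz)
    simpa only [hB.left_inv z hz] using this
  rcases eq_or_ne C 0 with hC | hC
  swap
  · exact (hτ.not_moebius hΩ hdet hC hAB).elim
  subst hC
  have hAD : 0 < A * D := by simpa using hdet
  have hD : D ≠ 0 := right_ne_zero_of_mul hAD.ne'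
  have hDC : (D : ℂ) ≠ 0 := by exact_mod_cast hD
  set α := A / D with hα
  set b := -B / D with hb
  have hα0 : 0 < α := by
    have : A / D = A * D / D ^ 2 := by field_simp
    rw [hα, this]; positivity
  have hrec : ∀ z ∈ Ω, τ (2 * z) = α * τ z + b * I := by
    intro z hz
    have h1 := hAB z hz
    simp only [ofReal_zero, zero_mul, zero_add] at h1
    have h2 : τ (2 * z) * D = A * τ z - B * I := by
      linear_combination (-I) * h1 + (τ (2 * z) * D - A * τ z) * I_sq
    rw [hα, hb]; push_cast
    field_simp
    linear_combination h2
  refine ⟨α, b, ?_, hrec⟩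
  by_contra hle
  push Not at hle
  rcases hle.eq_or_lt with h1 | h1
  · exact hΩ.not_translation hB fun z hz => by rw [hrec z hz, h1]; push_cast; ring
  -- If `α < 1`, then `τ` would blow up along `2 ^ (-n) z`, a bounded sequence, against
  -- `norm_lt_of_norm_lt`.
  · have hα1C : (1 : ℂ) - α ≠ 0 := by
      have : 1 - α ≠ 0 := by linarith
      exact_mod_cast this
    set y := b / (1 - α) with hy
    set t : ℂ → ℂ := fun z => τ z - y * I with ht
    have htrec : ∀ z ∈ Ω, t (2 * z) = α * t z := by
      intro z hz
      simp only [ht]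
      rw [hrec z hz, hy]; push_cast; field_simp; ring
    obtain ⟨e, he, hray⟩ := hΩ.ray
    have hz := hray 1 one_pos
    set z : ℂ := e * (1:ℝ) with hzdef
    have hz1 : ‖z‖ = 1 := by simp [hzdef, he]
    obtain ⟨M, hM⟩ := hτ.norm_lt_of_norm_lt 2
    have ht0 : 0 < ‖t z‖ := by
      rw [norm_pos_iff]
      intro h
      have h2 : 0 < (τ z).re := hB.mapsTo z hz
      have := congrArg Complex.re h
      simp [ht] at this; linarith
    obtain ⟨n, hn⟩ := pow_unbounded_of_one_lt ((M + |y|) / ‖t z‖) (one_lt_inv_iff₀.2 ⟨hα0, h1⟩)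
    rw [div_lt_iff₀ ht0] at hn
    have h2 := hΩ.map_zpow_mul hα0 htrec (-n) hz
    have h3 := hM _ (hΩ.zpow_mul_mem (-n) hz) (by
      rw [norm_mul, hz1, mul_one, norm_zpow, Complex.norm_ofNat, zpow_neg, zpow_natCast]
      have : ((2:ℝ) ^ n)⁻¹ ≤ 1 := inv_le_one_of_one_le₀ (one_le_pow₀ one_le_two)
      linarith)
    have h4 : ‖t ((2:ℂ) ^ (-n : ℤ) * z)‖ ≤ M + |y| := by
      simp only [ht]
      refine (norm_sub_le _ _).trans ?_
      simp only [norm_mul, norm_real, norm_I, mul_one, Real.norm_eq_abs] at h3 ⊢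
      linarith
    rw [h2, norm_mul, norm_zpow, norm_real, Real.norm_of_nonneg hα0.le, zpow_neg, zpow_natCast,
      ← inv_pow] at h4
    linarith

/-! ### The two sides of the generating curve -/

/-- The complementary domains of the Jordan curve `h(S¹)`: the exterior one for `e = 1` and the
interior one for `e = -1`. -/
def curveSide (h : ℂ ≃ₜ ℂ) (e : ℝ) : Set ℂ := h '' {z | 0 < e * (‖z‖ - 1)}

open Set Metric Complex in
theorem isOpen_curveSide (h : ℂ ≃ₜ ℂ) (e : ℝ) : IsOpen (curveSide h e) :=
  h.isOpenMap _ (isOpen_lt continuous_const (by fun_prop))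

open Set Metric Complex in
theorem isPreconnected_one_lt_norm : IsPreconnected {z : ℂ | 1 < ‖z‖} := by
  have : {z : ℂ | 1 < ‖z‖} = Complex.exp '' {z | 0 < z.re} := by
    ext z
    constructor
    · intro hz
      have hz0 : z ≠ 0 := by
        rintro rfl
        norm_num at hz
      refine ⟨Complex.log z, ?_, Complex.exp_log hz0⟩
      simpa [Complex.log_re] using Real.log_pos hz
    · rintro ⟨w, hw, rfl⟩
      simpa [Complex.norm_exp] using hw
  rw [this]
  exact (convex_halfSpace_re_gt 0).isPreconnected.image _ Complex.continuous_exp.continuousOn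

open Set Metric Complex in
theorem isPreconnected_curveSide (h : ℂ ≃ₜ ℂ) {e : ℝ} (he : |e| = 1) :
    IsPreconnected (curveSide h e) := by
  refine IsPreconnected.image ?_ _ h.continuous.continuousOn
  rcases (abs_eq zero_le_one).1 he with rfl | rfl
  · simpa using isPreconnected_one_lt_norm
  · have : {z : ℂ | 0 < (-1 : ℝ) * (‖z‖ - 1)} = ball 0 1 := by
      ext z; simp
    rw [this]
    exact (convex_ball 0 1).isPreconnected

open Set Metric Complex in
theorem notMem_of_mem_curveSide {h : ℂ ≃ₜ ℂ} {e : ℝ} {z : ℂ} (hz : z ∈ curveSide h e) :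
    z ∉ h '' sphere 0 1 := by
  obtain ⟨w, hw, rfl⟩ := hz
  rintro ⟨v, hv, hvw⟩
  rw [h.injective hvw] at hv
  rw [mem_sphere_zero_iff_norm] at hv
  simp [hv] at hw

open Set Metric Complex in
theorem exists_mem_curveSide {h : ℂ ≃ₜ ℂ} {z : ℂ} (hz : z ∉ h '' sphere 0 1) :
    ∃ e : ℝ, |e| = 1 ∧ z ∈ curveSide h e := by
  have h1 : ‖h.symm z‖ ≠ 1 := fun h1 => hz ⟨h.symm z, by simpa using h1, by simp⟩
  rcases lt_or_gt_of_ne h1 with h2 | h2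
  · exact ⟨-1, by simp, h.symm z, by simpa using h2, by simp⟩
  · exact ⟨1, by simp, h.symm z, by simpa using h2, by simp⟩

open Set Metric Complex in
theorem disjoint_curveSide (h : ℂ ≃ₜ ℂ) : Disjoint (curveSide h 1) (curveSide h (-1)) := by
  rw [Set.disjoint_left]
  rintro _ ⟨w, hw, rfl⟩ ⟨v, hv, hvw⟩
  rw [h.injective hvw] at hv
  simp only [mem_ofPred_eq] at hv hw
  linarith

open Set Metric Complex in
/-- A preconnected set off the curve that meets one side lies in it. -/
theorem subset_curveSide {h : ℂ ≃ₜ ℂ} {e : ℝ} (he : |e| = 1) {S : Set ℂ} (hS : IsPreconnected S)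
    (hd : ∀ z ∈ S, z ∉ h '' sphere 0 1) {z : ℂ} (hz : z ∈ S) (hze : z ∈ curveSide h e) :
    S ⊆ curveSide h e := by
  have hU : S ⊆ curveSide h 1 ∪ curveSide h (-1) := by
    intro w hw
    obtain ⟨e', he', hw'⟩ := exists_mem_curveSide (hd w hw)
    rcases (abs_eq zero_le_one).1 he' with rfl | rfl
    · exact Or.inl hw'
    · exact Or.inr hw'
  rcases (abs_eq zero_le_one).1 he with rfl | rfl
  · exact hS.subset_left_of_subset_union (isOpen_curveSide _ _) (isOpen_curveSide _ _)
      (disjoint_curveSide h) hU ⟨z, hz, hze⟩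
  · exact hS.subset_right_of_subset_union (isOpen_curveSide _ _) (isOpen_curveSide _ _)
      (disjoint_curveSide h) hU ⟨z, hz, hze⟩

open Set Metric Complex in
theorem not_isBounded_curveSide_one (h : ℂ ≃ₜ ℂ) : ¬ IsBounded (curveSide h 1) := by
  intro hb
  have h1 : IsBounded (h '' closedBall 0 1) :=
    ((isCompact_closedBall 0 1).image h.continuous).isBounded
  have h2 : (univ : Set ℂ) ⊆ curveSide h 1 ∪ h '' closedBall 0 1 := by
    intro z _
    rcases lt_or_ge 1 ‖h.symm z‖ with h3 | h3
    · exact Or.inl ⟨h.symm z, by simpa using h3, by simp⟩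
    · exact Or.inr ⟨h.symm z, by simpa using h3, by simp⟩
  exact NormedSpace.unbounded_univ ℝ ℂ ((hb.union h1).subset h2)

open Set Metric Complex in
theorem isBounded_curveSide_neg_one (h : ℂ ≃ₜ ℂ) : IsBounded (curveSide h (-1)) := by
  refine ((isCompact_closedBall (0:ℂ) 1).image h.continuous).isBounded.subset (image_mono ?_)
  intro z hz
  simp at hz ⊢
  linarith

section GeneratingCurve

variable {h : ℂ ≃ₜ ℂ}

open Set Metric Complex in
theorem IsGeneratingCurve.eq_one (hσ : IsGeneratingCurve (h '' sphere 0 1)) {t : ℝ} (ht : 0 ≤ t)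
    (hmem : (t : ℂ) ∈ h '' sphere 0 1) : t = 1 := by
  have : (t : ℂ) ∈ h '' sphere 0 1 ∩ closedPositiveRay := ⟨hmem, by simp, by simpa using ht⟩
  rw [hσ.inter_ray, mem_singleton_iff] at this
  exact_mod_cast this

open Set Metric Complex in
theorem IsGeneratingCurve.one_mem (hσ : IsGeneratingCurve (h '' sphere 0 1)) :
    (1 : ℂ) ∈ h '' sphere 0 1 := by
  have : (1 : ℂ) ∈ h '' sphere 0 1 ∩ closedPositiveRay := by rw [hσ.inter_ray]; rfl
  exact this.1

-- The exterior is connected and unbounded; if it contained `0`, it would lie in the bounded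
-- component of `0`.
open Set Metric Complex in
theorem IsGeneratingCurve.zero_mem_side (hσ : IsGeneratingCurve (h '' sphere 0 1)) :
    (0 : ℂ) ∈ curveSide h (-1) := by
  have h0 : (0 : ℂ) ∉ h '' sphere 0 1 := fun h0 => by
    have := hσ.eq_one le_rfl (t := 0) (by simpa using h0)
    norm_num at this
  obtain ⟨e, he, h1⟩ := exists_mem_curveSide h0
  rcases (abs_eq zero_le_one).1 he with rfl | rfl
  · exact (not_isBounded_curveSide_one h (hσ.zero_inside.subset
      ((isPreconnected_curveSide h he).subset_connectedComponentIn h1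
        fun z hz => notMem_of_mem_curveSide hz))).elim
  · exact h1

-- The intervals `(1, ∞)` and `[0, 1)` miss the curve, so each lies on one side: the first on the
-- exterior side because it is unbounded, the second on the side of `0`.
open Set Metric Complex in
theorem IsGeneratingCurve.exp_mem_side (hσ : IsGeneratingCurve (h '' sphere 0 1)) {e : ℝ}
    (he : |e| = 1) {t : ℝ} (ht : 0 < t) : ((Real.exp (e * t) : ℝ) : ℂ) ∈ curveSide h e := by
  rcases (abs_eq zero_le_one).1 he with rfl | rfl
  · set S : Set ℂ := (fun x : ℝ => (x : ℂ)) '' Ioi 1 with hSdef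
    have hS : IsPreconnected S := isPreconnected_Ioi.image _ Complex.continuous_ofReal.continuousOn
    have hd : ∀ z ∈ S, z ∉ h '' sphere 0 1 := by
      rintro _ ⟨x, hx, rfl⟩ hxσ
      have hx1 : (1:ℝ) < x := hx
      exact hx1.ne' (hσ.eq_one (by linarith) hxσ)
    obtain ⟨e', he', h1⟩ := exists_mem_curveSide (hd 2 ⟨2, by norm_num, by simp⟩)
    have hsub := subset_curveSide he' hS hd ⟨2, by norm_num, by simp⟩ h1
    have he1 : e' = 1 := by
      rcases (abs_eq zero_le_one).1 he' with rfl | rfl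
      · rfl
      · exfalso
        obtain ⟨R, hR⟩ := (isBounded_curveSide_neg_one h).exists_norm_le
        have := hR _ (hsub ⟨max 2 (R + 1), by simp, rfl⟩)
        rw [norm_real, Real.norm_eq_abs] at this
        linarith [le_abs_self (max 2 (R+1)), le_max_right 2 (R+1)]
    subst he1
    exact hsub ⟨_, by simpa using ht, rfl⟩
  · set S : Set ℂ := (fun x : ℝ => (x : ℂ)) '' Ico 0 1 with hSdef
    have hS : IsPreconnected S := isPreconnected_Ico.image _ Complex.continuous_ofReal.continuousOn
    have hd : ∀ z ∈ S, z ∉ h '' sphere 0 1 := by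
      rintro _ ⟨x, hx, rfl⟩ hxσ
      exact hx.2.ne (hσ.eq_one hx.1 hxσ)
    refine subset_curveSide he hS hd ⟨0, by simp, by simp⟩ hσ.zero_mem_side ?_
    exact ⟨_, ⟨(Real.exp_pos _).le, by simpa using ht⟩, rfl⟩

open Set Metric Complex in
/-- Control on the real part of the lifts of the curve and of its two sides. -/
theorem IsGeneratingCurve.exists_re_bound (hσ : IsGeneratingCurve (h '' sphere 0 1)) :
    ∃ C : ℝ, 0 < C ∧ (∀ z, exp z ∈ h '' sphere 0 1 → |z.re| ≤ C) ∧
      ∀ e : ℝ, |e| = 1 → ∀ z, exp z ∈ curveSide h e → -C ≤ e * z.re := by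
  obtain ⟨δ, hδ, hball⟩ := Metric.isOpen_iff.1 (isOpen_curveSide h (-1)) 0 hσ.zero_mem_side
  obtain ⟨R, hR⟩ := ((isCompact_closedBall (0:ℂ) 1).image h.continuous).isBounded.exists_norm_le
  have hlow : ∀ z, exp z ∉ curveSide h (-1) → Real.log δ ≤ z.re := by
    intro z hz
    have : δ ≤ ‖exp z‖ := by
      by_contra hlt
      exact hz (hball (by simpa using hlt))
    rwa [norm_exp, ← Real.log_le_iff_le_exp hδ] at this
  have hR0 : 0 < R := by
    have := hR (h 1) ⟨1, by simp, rfl⟩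
    have h2 := hR 1 (by
      obtain ⟨x, hx, hx1⟩ := hσ.one_mem
      exact ⟨x, sphere_subset_closedBall hx, hx1⟩)
    norm_num at h2; linarith
  have hupp : ∀ z, exp z ∈ h '' closedBall 0 1 → z.re ≤ Real.log R := by
    intro z hz
    have := hR _ hz
    rw [norm_exp] at this
    rwa [Real.le_log_iff_exp_le hR0]
  refine ⟨|Real.log δ| + |Real.log R| + 1, by positivity, fun z hz => ?_, fun e he z hz => ?_⟩
  · have h1 := hlow z (fun h1 => notMem_of_mem_curveSide h1 hz)
    have h2 := hupp z (image_mono sphere_subset_closedBall hz)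
    rw [abs_le]
    constructor <;> linarith [neg_abs_le (Real.log δ), le_abs_self (Real.log R),
      abs_nonneg (Real.log δ), abs_nonneg (Real.log R)]
  · rcases (abs_eq zero_le_one).1 he with rfl | rfl
    · have h1 := hlow z (fun h1 => Set.disjoint_left.1 (disjoint_curveSide h) hz h1)
      linarith [neg_abs_le (Real.log δ), abs_nonneg (Real.log R)]
    · have h2 := hupp z (by
        refine image_mono ?_ hz
        intro w hw
        simp at hw ⊢
        linarith)
      linarith [le_abs_self (Real.log R), abs_nonneg (Real.log δ)]

end GeneratingCurve

/-! ### The self-similar curve and its complementary components -/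

open Set Metric Complex in
theorem mem_selfSimilarCurve {σ : Set ℂ} {z : ℂ} : z ∈ selfSimilarCurve σ ↔
    z = 0 ∨ ∃ k : ℤ, (2:ℂ) ^ k * z ∈ liftedArc σ ∨ (2:ℂ) ^ k * (-z) ∈ liftedArc σ := by
  have hup : ∀ w, w ∈ upperCurve σ ↔ ∃ k : ℤ, (2:ℂ) ^ k * w ∈ liftedArc σ := by
    intro w
    simp only [upperCurve, mem_iUnion, mem_image]
    constructor
    · rintro ⟨k, v, hv, rfl⟩
      refine ⟨-(k - 1), ?_⟩
      rwa [← mul_assoc, ← zpow_add₀ two_ne_zero, neg_add_cancel, zpow_zero, one_mul]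
    · rintro ⟨k, hk⟩
      refine ⟨-k + 1, _, hk, ?_⟩
      rw [← mul_assoc, ← zpow_add₀ two_ne_zero]
      simp
  have hneg : z ∈ (fun w : ℂ => -w) '' upperCurve σ ↔ -z ∈ upperCurve σ := by
    constructor
    · rintro ⟨w, hw, rfl⟩; simpa using hw
    · intro hw; exact ⟨-z, hw, by simp⟩
  rw [selfSimilarCurve, mem_union, mem_union, hneg, hup, hup, mem_singleton_iff]
  constructor
  · rintro ((⟨k, hk⟩ | h) | ⟨k, hk⟩)
    · exact Or.inr ⟨k, Or.inr hk⟩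
    · exact Or.inl h
    · exact Or.inr ⟨k, Or.inl hk⟩
  · rintro (h | ⟨k, hk | hk⟩)
    · exact Or.inl (Or.inr h)
    · exact Or.inr ⟨k, hk⟩
    · exact Or.inl (Or.inl ⟨k, hk⟩)

open Set Metric Complex in
theorem zero_mem_selfSimilarCurve (σ : Set ℂ) : (0 : ℂ) ∈ selfSimilarCurve σ :=
  mem_selfSimilarCurve.2 (Or.inl rfl)

open Set Metric Complex in
theorem neg_mem_selfSimilarCurve {σ : Set ℂ} {z : ℂ} :
    -z ∈ selfSimilarCurve σ ↔ z ∈ selfSimilarCurve σ := by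
  rw [mem_selfSimilarCurve, mem_selfSimilarCurve, neg_eq_zero, neg_neg]
  simp only [or_comm]

open Set Metric Complex in
theorem zpow_mul_mem_selfSimilarCurve {σ : Set ℂ} (n : ℤ) {z : ℂ} :
    (2:ℂ) ^ n * z ∈ selfSimilarCurve σ ↔ z ∈ selfSimilarCurve σ := by
  have key : ∀ (n : ℤ) (z : ℂ), z ∈ selfSimilarCurve σ → (2:ℂ) ^ n * z ∈ selfSimilarCurve σ := by
    intro n z hz
    rw [mem_selfSimilarCurve] at hz ⊢
    rcases hz with rfl | ⟨k, hk⟩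
    · simp
    · refine Or.inr ⟨k - n, ?_⟩
      rw [mul_neg] at hk ⊢
      rw [← mul_assoc, ← zpow_add₀ two_ne_zero, sub_add_cancel]
      exact hk
  refine ⟨fun hz => ?_, key n z⟩
  have := key (-n) _ hz
  rwa [← mul_assoc, ← zpow_add₀ two_ne_zero, neg_add_cancel, zpow_zero, one_mul] at this

open Set Metric Complex in
theorem exp_eq_ofReal_of_im {z : ℂ} {n : ℤ} (hz : z.im = n * (2 * Real.pi)) :
    exp z = (Real.exp z.re : ℝ) := by
  have : z = (z.re : ℂ) + n * (2 * Real.pi * I) := by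
    apply Complex.ext <;> simp [hz]
  rw [this, (exp_periodic.int_mul n) _]
  simp

section GeneratingCurve

variable {h : ℂ ≃ₜ ℂ}

open Set Metric Complex in
theorem IsGeneratingCurve.re_eq_zero (hσ : IsGeneratingCurve (h '' sphere 0 1)) {z : ℂ} {n : ℤ}
    (hz : z.im = n * (2 * Real.pi)) (hmem : exp z ∈ h '' sphere 0 1) : z.re = 0 := by
  rw [exp_eq_ofReal_of_im hz] at hmem
  exact Real.exp_eq_one_iff _ |>.1 (hσ.eq_one (Real.exp_pos _).le hmem)

open Set Metric Complex in
/-- In the closed strip between its endpoints the curve is the lift of the generating curve. -/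
theorem IsGeneratingCurve.mem_iff_of_strip (hσ : IsGeneratingCurve (h '' sphere 0 1)) {z : ℂ}
    (h1 : 2 * Real.pi ≤ z.im) (h2 : z.im ≤ 4 * Real.pi) :
    z ∈ selfSimilarCurve (h '' sphere 0 1) ↔ exp z ∈ h '' sphere 0 1 := by
  have hpi := Real.pi_pos
  constructor
  swap
  · intro hz
    exact mem_selfSimilarCurve.2 (Or.inr ⟨0, Or.inl (by simpa using ⟨hz, h1, h2⟩)⟩)
  intro hz
  rw [mem_selfSimilarCurve] at hz
  have him : ∀ (k : ℤ) (w : ℂ), ((2:ℂ) ^ k * w).im = (2:ℝ) ^ k * w.im := by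
    intro k w
    have : ((2:ℂ) ^ k) = (((2:ℝ) ^ k : ℝ) : ℂ) := by push_cast; rfl
    rw [this, im_ofReal_mul]
  have hre : ∀ (k : ℤ) (w : ℂ), ((2:ℂ) ^ k * w).re = (2:ℝ) ^ k * w.re := by
    intro k w
    have : ((2:ℂ) ^ k) = (((2:ℝ) ^ k : ℝ) : ℂ) := by push_cast; rfl
    rw [this, re_ofReal_mul]
  rcases hz with rfl | ⟨k, hk | hk⟩
  · simp at h1; linarith
  · obtain ⟨hk1, hk2, hk3⟩ := hk
    have hpos : (0:ℝ) < 2 ^ k := by positivity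
    have fin : ∀ n m : ℤ, ((2:ℂ) ^ k * z).im = n * (2 * Real.pi) → z.im = m * (2 * Real.pi) →
        exp z ∈ h '' sphere 0 1 := by
      intro n m hn hm
      have h3 := hσ.re_eq_zero hn hk1
      rw [hre] at h3
      have h4 : z.re = 0 := by
        rcases mul_eq_zero.1 h3 with h5 | h5
        · exact absurd h5 hpos.ne'
        · exact h5
      rw [exp_eq_ofReal_of_im hm, h4]
      simpa using hσ.one_mem
    rw [him] at hk2 hk3 fin
    rcases lt_trichotomy k 0 with hk0 | rfl | hk0
    · have h5 : (2:ℝ) ^ k ≤ 2 ^ (-1 : ℤ) := zpow_le_zpow_right₀ one_le_two (by omega)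
      rw [zpow_neg_one] at h5
      have h6 : z.im = 4 * Real.pi := by nlinarith
      refine fin 1 2 ?_ ?_ <;> push_cast
      · rw [h6] at hk2 ⊢; nlinarith
      · rw [h6]; ring
    · simpa using hk1
    · have h5 : (2:ℝ) ^ (1:ℤ) ≤ 2 ^ k := zpow_le_zpow_right₀ one_le_two (by omega)
      rw [zpow_one] at h5
      have h6 : z.im = 2 * Real.pi := by nlinarith
      refine fin 2 1 ?_ ?_ <;> push_cast
      · rw [h6] at hk3 ⊢; nlinarith
      · rw [h6]; ring
  · obtain ⟨_, hk2, _⟩ := hk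
    rw [him, neg_im] at hk2
    have hpos : (0:ℝ) < 2 ^ k := by positivity
    nlinarith

open Set Metric Complex in
/-- The curve is contained in a double cone around the imaginary axis. -/
theorem IsGeneratingCurve.exists_cone (hσ : IsGeneratingCurve (h '' sphere 0 1)) :
    ∃ C : ℝ, 0 < C ∧ ∀ z ∈ selfSimilarCurve (h '' sphere 0 1), z ≠ 0 → |z.re| < C * |z.im| := by
  obtain ⟨C, hC, hC1, -⟩ := hσ.exists_re_bound
  have key : ∀ (k : ℤ) (w : ℂ), (2:ℂ) ^ k * w ∈ liftedArc (h '' sphere 0 1) →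
      |w.re| < C * |w.im| := by
    rintro k w ⟨h1, h2, -⟩
    have h3 := hC1 _ h1
    have : ((2:ℂ) ^ k) = (((2:ℝ) ^ k : ℝ) : ℂ) := by push_cast; rfl
    rw [this, re_ofReal_mul] at h3
    rw [this, im_ofReal_mul] at h2
    have hpos : (0:ℝ) < 2 ^ k := by positivity
    rw [abs_mul, abs_of_pos hpos] at h3
    have h4 : 1 < 2 ^ k * |w.im| := by
      have := mul_le_mul_of_nonneg_left (le_abs_self w.im) hpos.le
      linarith [Real.pi_gt_three]
    have h5 : 2 ^ k * |w.re| < 2 ^ k * (C * |w.im|) := by nlinarith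
    exact lt_of_mul_lt_mul_left h5 hpos.le
  refine ⟨C, hC, fun z hz hz0 => ?_⟩
  rcases mem_selfSimilarCurve.1 hz with h1 | ⟨k, h1 | h1⟩
  · exact absurd h1 hz0
  · exact key k z h1
  · simpa using key k (-z) h1

-- Doubling moves the line `Im = π` to `Im = 2π`, on which the curve has only the vertex `2πi`.
open Set Metric Complex in
theorem IsGeneratingCurve.line_notMem (hσ : IsGeneratingCurve (h '' sphere 0 1)) {s d x : ℝ}
    (hs : |s| = 1) (hd : |d| = 1) (hx : 0 < x) :
    (d * x + s * Real.pi * I : ℂ) ∉ selfSimilarCurve (h '' sphere 0 1) := by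
  have key : ∀ y : ℝ, y ≠ 0 → (y + Real.pi * I : ℂ) ∉ selfSimilarCurve (h '' sphere 0 1) := by
    intro y hy hmem
    rw [← zpow_mul_mem_selfSimilarCurve 1] at hmem
    have him : ((2:ℂ) ^ (1:ℤ) * (y + Real.pi * I)).im = 2 * Real.pi := by simp
    have hre : ((2:ℂ) ^ (1:ℤ) * (y + Real.pi * I)).re = 2 * y := by simp
    rw [hσ.mem_iff_of_strip him.ge (by rw [him]; linarith [Real.pi_pos])] at hmem
    have := hσ.re_eq_zero (n := 1) (by rw [him]; simp) hmem
    rw [hre] at this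
    exact hy (by linarith)
  have hd0 : d ≠ 0 := by rintro rfl; simp at hd
  rcases (abs_eq zero_le_one).1 hs with rfl | rfl
  · simpa using key (d * x) (mul_ne_zero hd0 hx.ne')
  · rw [← neg_mem_selfSimilarCurve]
    have := key (-(d * x)) (neg_ne_zero.2 (mul_ne_zero hd0 hx.ne'))
    have e : -((d:ℂ) * x + ((-1:ℝ):ℂ) * Real.pi * I) = ((-(d * x) : ℝ) : ℂ) + Real.pi * I := by
      push_cast; ring
    rwa [e]

open Set Metric Complex in
theorem IsGeneratingCurve.vertex_mem (hσ : IsGeneratingCurve (h '' sphere 0 1)) {s : ℝ}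
    (hs : |s| = 1) : (s * Real.pi * I : ℂ) ∈ selfSimilarCurve (h '' sphere 0 1) := by
  have key : (Real.pi * I : ℂ) ∈ selfSimilarCurve (h '' sphere 0 1) := by
    rw [← zpow_mul_mem_selfSimilarCurve 1]
    have him : ((2:ℂ) ^ (1:ℤ) * (Real.pi * I)).im = 2 * Real.pi := by simp
    rw [hσ.mem_iff_of_strip him.ge (by rw [him]; linarith [Real.pi_pos])]
    rw [zpow_one, ← mul_assoc, exp_two_pi_mul_I]
    exact hσ.one_mem
  rcases (abs_eq zero_le_one).1 hs with rfl | rfl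
  · simpa using key
  · rw [← neg_mem_selfSimilarCurve]; simpa using key

end GeneratingCurve

open Set Metric Complex in
/-- A preconnected set that meets a component and avoids the removed set lies in the component. -/
theorem subset_component {Γ S : Set ℂ} {z w : ℂ} (hS : IsPreconnected S) (hd : ∀ x ∈ S, x ∉ Γ)
    (hw : w ∈ S) (hwz : w ∈ connectedComponentIn Γᶜ z) : S ⊆ connectedComponentIn Γᶜ z := by
  rw [connectedComponentIn_eq hwz]
  exact hS.subset_connectedComponentIn hw hd

section GeneratingCurve

variable {h : ℂ ≃ₜ ℂ}

-- The curve avoids a closed cone around the real axis, and the segment from `z` to `e` stays in one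
-- half of that cone.
open Set Metric Complex in
theorem cone_subset_component {σ : Set ℂ} {e C : ℝ}
    (he : |e| = 1)
    (hC : ∀ z ∈ selfSimilarCurve σ, z ≠ 0 → |z.re| < C * |z.im|) {z : ℂ}
    (hz : C * |z.im| ≤ e * z.re) (hre : 0 < e * z.re) :
    z ∈ connectedComponentIn (selfSimilarCurve σ)ᶜ e := by
  have hee : e * e = 1 := by
    rcases (abs_eq zero_le_one).1 he with rfl | rfl <;> norm_num
  have hcone : ∀ x : ℂ, C * |x.im| ≤ e * x.re → 0 < e * x.re →
      x ∉ selfSimilarCurve σ := by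
    intro x hx hx0 hmem
    have h1 := hC x hmem (by rintro rfl; simp at hx0)
    have h2 : e * x.re ≤ |x.re| := by
      have := le_abs_self (e * x.re)
      rwa [abs_mul, he, one_mul] at this
    linarith
  have hC0 : 0 < C ∨ C ≤ 0 := lt_or_ge _ _
  have hseg : segment ℝ z (e:ℂ) ⊆ (selfSimilarCurve σ)ᶜ := by
    rintro x ⟨a, b, ha, hb, hab, rfl⟩
    have hx1 : (a • z + b • (e:ℂ)).re = a * z.re + b * e := by simp
    have hx2 : (a • z + b • (e:ℂ)).im = a * z.im := by simp
    have h3 : e * (a * z.re + b * e) = a * (e * z.re) + b := by linear_combination b * hee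
    refine hcone _ ?_ ?_
    · rw [hx1, hx2, h3, abs_mul, abs_of_nonneg ha]
      nlinarith
    · rw [hx1, h3]
      rcases ha.eq_or_lt with rfl | ha0
      · linarith
      · have := mul_pos ha0 hre
        linarith
  exact (convex_segment z (e:ℂ)).isPreconnected.subset_connectedComponentIn
    (right_mem_segment _ _ _) hseg (left_mem_segment _ _ _)

open Set Metric Complex in
/-- The lifts of the side `e` of the generating curve to the closed strip lie in the component of
`e`. -/
theorem IsGeneratingCurve.mem_component_of_exp (hσ : IsGeneratingCurve (h '' sphere 0 1)) {e : ℝ}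
    (he : |e| = 1) {w : ℂ} (h1 : 2 * Real.pi ≤ w.im) (h2 : w.im ≤ 4 * Real.pi)
    (hw : exp w ∈ curveSide h e) :
    w ∈ connectedComponentIn (selfSimilarCurve (h '' sphere 0 1))ᶜ e := by
  set Γ := selfSimilarCurve (h '' sphere 0 1) with hΓ
  have hpi := Real.pi_pos
  have hee : e * e = 1 := by
    rcases (abs_eq zero_le_one).1 he with rfl | rfl <;> norm_num
  obtain ⟨C, hC, hcone⟩ := hσ.exists_cone
  obtain ⟨C', hC', -, hside⟩ := hσ.exists_re_bound
  by_contra hwn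
  -- The set of counterexamples is bounded. It turns out to be open, and closed relative to the
  -- lifts of the side, so `exp '' O` is open and relatively closed in the connected side.
  set O : Set ℂ := {z | (2 * Real.pi ≤ z.im ∧ z.im ≤ 4 * Real.pi) ∧ exp z ∈ curveSide h e ∧
    z ∉ connectedComponentIn Γᶜ (e:ℂ)} with hO
  have hbound : ∀ z ∈ O, |z.re| ≤ C * (4 * Real.pi) + C' := by
    rintro z ⟨⟨hz1, hz2⟩, hz3, hz4⟩
    have h3 := hside e he z hz3
    have h4 : e * z.re ≤ C * (4 * Real.pi) := by
      by_contra hlt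
      push Not at hlt
      refine hz4 (cone_subset_component he hcone ?_ ?_)
      · rw [abs_of_nonneg (by linarith)]; nlinarith
      · exact lt_trans (by positivity) hlt
    have h5 : |z.re| = |e * z.re| := by rw [abs_mul, he, one_mul]
    rw [h5, abs_le]
    constructor <;> nlinarith
  have hOb : IsBounded O := by
    rw [isBounded_iff_forall_norm_le]
    refine ⟨C * (4 * Real.pi) + C' + 4 * Real.pi, fun z hz => ?_⟩
    refine (norm_le_abs_re_add_abs_im z).trans (add_le_add (hbound z hz) ?_)
    rw [abs_of_nonneg (by linarith [hz.1.1])]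
    exact hz.1.2
  -- On the two boundary lines the half-line from `z` in direction `e` avoids the curve and ends in
  -- the cone; hence `O` lies in the open strip.
  have hline : ∀ z : ℂ, (z.im = 2 * Real.pi ∨ z.im = 4 * Real.pi) → exp z ∈ curveSide h e →
      z ∈ connectedComponentIn Γᶜ (e:ℂ) := by
    intro z hz hze
    have hn : ∃ n : ℤ, z.im = n * (2 * Real.pi) := by
      rcases hz with hz | hz
      · exact ⟨1, by rw [hz]; simp⟩
      · exact ⟨2, by rw [hz]; push_cast; ring⟩
    obtain ⟨n, hn⟩ := hn
    have hrez : 0 < e * z.re := by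
      by_contra hle
      push Not at hle
      rw [exp_eq_ofReal_of_im hn] at hze
      rcases hle.eq_or_lt with h3 | h3
      · have : z.re = 0 := by
          have : e * (e * z.re) = 0 := by rw [h3, mul_zero]
          rwa [← mul_assoc, hee, one_mul] at this
        rw [this] at hze
        exact notMem_of_mem_curveSide hze (by simpa using hσ.one_mem)
      · have h4 := hσ.exp_mem_side (e := -e) (by rwa [abs_neg]) (t := -(e * z.re)) (by linarith)
        rw [show -e * -(e * z.re) = z.re by linear_combination z.re * hee] at h4
        rcases (abs_eq zero_le_one).1 he with rfl | rfl
        · exact Set.disjoint_left.1 (disjoint_curveSide h) hze h4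
        · rw [neg_neg] at h4
          exact Set.disjoint_left.1 (disjoint_curveSide h) h4 hze
    -- the half-line through `z` reaches the cone
    set S : Set ℂ := (fun t : ℝ => (z + e * t : ℂ)) '' Ici 0 with hS
    have hSc : IsPreconnected S := isPreconnected_Ici.image _ (by fun_prop)
    have hSim : ∀ t : ℝ, (z + e * t : ℂ).im = z.im := by intro t; simp
    have hSre : ∀ t : ℝ, e * (z + e * t : ℂ).re = e * z.re + t := by
      intro t; simp; linear_combination t * hee
    have hSd : ∀ x ∈ S, x ∉ Γ := by
      rintro _ ⟨t, ht, rfl⟩ hmem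
      have ht0 : 0 ≤ t := ht
      rw [hσ.mem_iff_of_strip (by rw [hSim]; rcases hz with hz | hz <;> linarith)
        (by rw [hSim]; rcases hz with hz | hz <;> linarith)] at hmem
      have h5 := hσ.re_eq_zero (n := n) (by rw [hSim]; exact hn) hmem
      have := hSre t
      rw [h5] at this
      linarith
    have hz0 : 0 ≤ z.im := by rcases hz with hz | hz <;> linarith
    refine subset_component hSc hSd (w := z + e * (C * z.im : ℝ)) ⟨C * z.im, by
      have := mul_nonneg hC.le hz0; simpa using this, rfl⟩ ?_ ⟨0, by simp, by simp⟩
    refine cone_subset_component he hcone ?_ ?_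
    · rw [hSre, hSim, abs_of_nonneg hz0]; linarith
    · rw [hSre]; have := mul_nonneg hC.le hz0; linarith
  have hlocal : ∀ z : ℂ, exp z ∈ curveSide h e → ∃ ε > 0, ∀ x ∈ ball z ε,
      exp x ∈ curveSide h e := by
    intro z hz
    exact Metric.isOpen_iff.1 ((isOpen_curveSide h e).preimage Complex.continuous_exp) z hz
  have hOopen : IsOpen O := by
    rw [Metric.isOpen_iff]
    rintro z ⟨⟨hz1, hz2⟩, hz3, hz4⟩
    have hz1' : 2 * Real.pi < z.im := lt_of_le_of_ne hz1 fun h3 => hz4 (hline z (Or.inl h3.symm) hz3)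
    have hz2' : z.im < 4 * Real.pi := lt_of_le_of_ne hz2 fun h3 => hz4 (hline z (Or.inr h3) hz3)
    obtain ⟨ε, hε, hball⟩ := hlocal z hz3
    set r := min ε (min (z.im - 2 * Real.pi) (4 * Real.pi - z.im)) with hr
    have hr0 : 0 < r := lt_min hε (lt_min (by linarith) (by linarith))
    have him : ∀ x ∈ ball z r, 2 * Real.pi ≤ x.im ∧ x.im ≤ 4 * Real.pi := by
      intro x hx
      rw [mem_ball, dist_eq_norm] at hx
      have h5 := (abs_im_le_norm (x - z)).trans hx.le
      rw [sub_im, abs_le] at h5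
      have h6 : r ≤ z.im - 2 * Real.pi := (min_le_right _ _).trans (min_le_left _ _)
      have h7 : r ≤ 4 * Real.pi - z.im := (min_le_right _ _).trans (min_le_right _ _)
      constructor <;> linarith
    have hexp : ∀ x ∈ ball z r, exp x ∈ curveSide h e := fun x hx =>
      hball x (ball_subset_ball (min_le_left _ _) hx)
    refine ⟨r, hr0, fun x hx => ⟨him x hx, hexp x hx, fun hxΩ => hz4 ?_⟩⟩
    refine subset_component (convex_ball z r).isPreconnected (fun y hy hyΓ => ?_) hx hxΩ
      (mem_ball_self hr0)
    rw [hσ.mem_iff_of_strip (him y hy).1 (him y hy).2] at hyΓ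
    exact notMem_of_mem_curveSide (hexp y hy) hyΓ
  have hOim : closure O ⊆ {z | 2 * Real.pi ≤ z.im ∧ z.im ≤ 4 * Real.pi} := by
    refine closure_minimal (fun z hz => hz.1) ?_
    exact (isClosed_le continuous_const Complex.continuous_im).inter
      (isClosed_le Complex.continuous_im continuous_const)
  have hOcl : ∀ z ∈ closure O, exp z ∈ curveSide h e → z ∈ O := by
    intro z hz hze
    refine ⟨hOim hz, hze, fun hzΩ => ?_⟩
    obtain ⟨ε, hε, hball⟩ := hlocal z hze
    obtain ⟨x, hxO, hx⟩ := Metric.mem_closure_iff.1 hz ε hε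
    refine hxO.2.2 (subset_component (S := ball z ε ∩ {z | 2 * Real.pi ≤ z.im ∧ z.im ≤ 4 * Real.pi})
      (Convex.isPreconnected ?_) ?_ ⟨mem_ball_self hε, hOim hz⟩ hzΩ
      ⟨by rwa [mem_ball, dist_comm], hxO.1⟩)
    · exact (convex_ball z ε).inter ((convex_halfSpace_im_ge _).inter (convex_halfSpace_im_le _))
    · rintro y ⟨hy1, hy2⟩ hyΓ
      rw [hσ.mem_iff_of_strip hy2.1 hy2.2] at hyΓ
      exact notMem_of_mem_curveSide (hball y hy1) hyΓ
  have hcl : closure (exp '' O) ⊆ exp '' closure O :=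
    closure_minimal (image_mono subset_closure)
      (hOb.isCompact_closure.image Complex.continuous_exp).isClosed
  -- If `O` is nonempty, its image is the whole side. This is absurd for the exterior, which is
  -- unbounded, and for the interior, which contains `0`.
  have hsub : curveSide h e ⊆ exp '' O := by
    refine (isPreconnected_curveSide h he).subset_of_closure_inter_subset
      (Complex.isOpenMap_exp _ hOopen)
      ⟨exp w, hw, w, ⟨⟨h1, h2⟩, hw, hwn⟩, rfl⟩ ?_
    rintro _ ⟨hy, hye⟩
    obtain ⟨z, hz, rfl⟩ := hcl hy
    exact ⟨z, hOcl z hz hye, rfl⟩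
  rcases (abs_eq zero_le_one).1 he with rfl | rfl
  · exact not_isBounded_curveSide_one h
      (((hOb.isCompact_closure.image Complex.continuous_exp).isBounded.subset
        (image_mono subset_closure)).subset hsub)
  · obtain ⟨z, -, hz⟩ := hsub hσ.zero_mem_side
    exact exp_ne_zero z hz

open Set Metric Complex in
/-- Every complementary component of the self-similar curve is the one of `1` or of `-1`. -/
theorem IsGeneratingCurve.exists_ray (hσ : IsGeneratingCurve (h '' sphere 0 1)) {z₀ : ℂ}
    (hz₀ : z₀ ∈ (selfSimilarCurve (h '' sphere 0 1))ᶜ) :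
    ∃ e : ℝ, |e| = 1 ∧ connectedComponentIn (selfSimilarCurve (h '' sphere 0 1))ᶜ z₀ =
      connectedComponentIn (selfSimilarCurve (h '' sphere 0 1))ᶜ (e:ℂ) := by
  set Γ := selfSimilarCurve (h '' sphere 0 1) with hΓ
  obtain ⟨C, hC, hcone⟩ := hσ.exists_cone
  have hreal : ∀ t : ℝ, t ≠ 0 → ∃ e : ℝ, |e| = 1 ∧ (t:ℂ) ∈ connectedComponentIn Γᶜ (e:ℂ) := by
    intro t ht
    refine ⟨SignType.sign t, ?_, cone_subset_component ?_ hcone ?_ ?_⟩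
    · rcases lt_or_gt_of_ne ht with h1 | h1 <;> simp [h1]
    · rcases lt_or_gt_of_ne ht with h1 | h1 <;> simp [h1]
    · simp [sign_mul_self]
    · simpa [sign_mul_self] using ht
  suffices ∃ e : ℝ, |e| = 1 ∧ z₀ ∈ connectedComponentIn Γᶜ (e:ℂ) by
    obtain ⟨e, he, h1⟩ := this
    exact ⟨e, he, (connectedComponentIn_eq h1).symm⟩
  rcases eq_or_ne z₀.im 0 with him | him
  · have : z₀ = (z₀.re : ℂ) := by apply Complex.ext <;> simp [him]
    rw [this]
    refine hreal _ fun h0 => hz₀ ?_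
    rw [this, h0]
    exact zero_mem_selfSimilarCurve _
  -- A symmetry `z ↦ ± 2 ^ (-n) z` of the curve moves `z₀` into the fundamental strip `2π ≤ Im ≤
  -- 4π`.
  · obtain ⟨n, hn1, hn2⟩ := exists_mem_Ico_zpow (x := |z₀.im| / (2 * Real.pi))
      (by have := Real.pi_pos; have := abs_pos.2 him; positivity) (one_lt_two (α := ℝ))
    have h2n : (0:ℝ) < 2 ^ n := by positivity
    have h2pi : 0 < 2 * Real.pi := by have := Real.pi_pos; positivity
    rw [le_div_iff₀ h2pi] at hn1
    rw [div_lt_iff₀ h2pi, zpow_add_one₀ two_ne_zero] at hn2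
    set s : ℝ := ((SignType.sign z₀.im : SignType) : ℝ) with hs
    have hss : s * s = 1 := by
      rcases lt_or_gt_of_ne him with h1 | h1 <;> simp [hs, h1]
    have hsim : s * z₀.im = |z₀.im| := by rw [hs, sign_mul_self]
    set c : ℝ := s * 2 ^ (-n) with hc
    have hc0 : c ≠ 0 := by
      rw [hc]; refine mul_ne_zero ?_ (by positivity)
      rintro h0; rw [h0] at hss; simp at hss
    have hcΓ : ∀ z : ℂ, (c : ℂ) * z ∈ Γ ↔ z ∈ Γ := by
      intro z
      have h3 : (c : ℂ) * z = (2:ℂ) ^ (-n) * (s * z) := by rw [hc]; push_cast; ring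
      rw [h3, zpow_mul_mem_selfSimilarCurve]
      rcases lt_or_gt_of_ne him with h1 | h1
      · rw [hs, sign_neg h1]
        simpa using neg_mem_selfSimilarCurve
      · rw [hs, sign_pos h1, hΓ]; simp
    have hcim : ((c:ℂ) * z₀).im = 2 ^ (-n) * |z₀.im| := by
      rw [im_ofReal_mul, hc, ← hsim]; ring
    have hi1 : 2 * Real.pi ≤ ((c:ℂ) * z₀).im := by
      rw [hcim, zpow_neg, ← div_eq_inv_mul, le_div_iff₀ h2n]; linarith
    have hi2 : ((c:ℂ) * z₀).im ≤ 4 * Real.pi := by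
      rw [hcim, zpow_neg, ← div_eq_inv_mul, div_le_iff₀ h2n]; linarith
    have hcz : (c:ℂ) * z₀ ∉ Γ := fun h3 => hz₀ ((hcΓ z₀).1 h3)
    have hexp : exp ((c:ℂ) * z₀) ∉ h '' sphere 0 1 := by
      rwa [hΓ, hσ.mem_iff_of_strip hi1 hi2] at hcz
    obtain ⟨e, he, hside⟩ := exists_mem_curveSide hexp
    have hmem := hσ.mem_component_of_exp he hi1 hi2 hside
    have he0 : e ≠ 0 := by rintro rfl; simp at he
    have heΩ : (e:ℂ) ∈ connectedComponentIn Γᶜ (e:ℂ) := by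
      refine cone_subset_component he hcone ?_ ?_
      · simp [← sq, sq_nonneg]
      · simpa using he0
    have hcC : (c:ℂ) ≠ 0 := by exact_mod_cast hc0
    -- Undoing the symmetry may exchange the two components, so the sign `e'` is read off from the
    -- image of the real point `e`.
    obtain ⟨e', he', h4⟩ := hreal (c⁻¹ * e) (mul_ne_zero (inv_ne_zero hc0) he0)
    refine ⟨e', he', ?_⟩
    refine subset_component (S := (fun z => (c:ℂ)⁻¹ * z) '' connectedComponentIn Γᶜ (e:ℂ))
      (isPreconnected_connectedComponentIn.image _ (by fun_prop)) ?_
      ⟨e, heΩ, by push_cast; rfl⟩ h4 ⟨_, hmem, by simp [hcC]⟩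
    rintro _ ⟨x, hx, rfl⟩ hxΓ
    rw [← hcΓ, mul_inv_cancel_left₀ hcC] at hxΓ
    exact connectedComponentIn_subset _ _ hx hxΓ

-- The clauses follow from the invariance of the curve under powers of two, from the free cone
-- around the real axis, and from the fact that the lines `Im = ±π` meet the curve only at the
-- vertices.
open Set Metric Complex in
theorem IsGeneratingCurve.isDyadicDomain (hσ : IsGeneratingCurve (h '' sphere 0 1)) {e : ℝ}
    (he : |e| = 1) :
    IsDyadicDomain (connectedComponentIn (selfSimilarCurve (h '' sphere 0 1))ᶜ (e:ℂ)) := by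
  set Γ := selfSimilarCurve (h '' sphere 0 1) with hΓ
  obtain ⟨C, hC, hcone⟩ := hσ.exists_cone
  have he0 : e ≠ 0 := by rintro rfl; simp at he
  have hee : e * e = 1 := by
    rcases (abs_eq zero_le_one).1 he with rfl | rfl <;> norm_num
  have hray : ∀ t : ℝ, 0 < t → (e * t : ℂ) ∈ connectedComponentIn Γᶜ (e:ℂ) := by
    intro t ht
    have h1 : e * (e * t : ℂ).re = t := by simp; linear_combination t * hee
    refine cone_subset_component he hcone ?_ ?_
    · rw [h1]; simpa using ht.le
    · rw [h1]; exact ht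
  have h2 : ∀ (n : ℤ) (z : ℂ), z ∈ connectedComponentIn Γᶜ (e:ℂ) →
      (2:ℂ) ^ n * z ∈ connectedComponentIn Γᶜ (e:ℂ) := by
    intro n z hz
    refine subset_component (S := (fun z => (2:ℂ) ^ n * z) '' connectedComponentIn Γᶜ (e:ℂ))
      (isPreconnected_connectedComponentIn.image _ (by fun_prop)) ?_
      ⟨e, by simpa using hray 1 one_pos, rfl⟩ ?_ ⟨z, hz, rfl⟩
    · rintro _ ⟨x, hx, rfl⟩ hxΓ
      rw [zpow_mul_mem_selfSimilarCurve] at hxΓ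
      exact connectedComponentIn_subset _ _ hx hxΓ
    · have := hray (2 ^ n) (by positivity)
      push_cast at this
      rwa [mul_comm] at this
  refine ⟨isPreconnected_connectedComponentIn,
    fun h0 => connectedComponentIn_subset _ _ h0 (zero_mem_selfSimilarCurve _), fun z => ?_,
    ⟨e, he, hray⟩, fun s d hs hd => ?_,
    fun s hs h0 => connectedComponentIn_subset _ _ h0 (hσ.vertex_mem hs), C, hC, ?_⟩
  · refine ⟨fun hz => ?_, fun hz => by simpa using h2 1 z hz⟩
    have := h2 (-1) _ hz
    simpa using this
  · by_cases hex : ∃ x : ℝ, 0 < x ∧ (d * x + s * Real.pi * I : ℂ) ∈ connectedComponentIn Γᶜ (e:ℂ)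
    · left
      obtain ⟨x, hx, hxΩ⟩ := hex
      intro y hy
      refine subset_component (S := (fun x : ℝ => (d * x + s * Real.pi * I : ℂ)) '' Ioi 0)
        (isPreconnected_Ioi.image _ (by fun_prop)) ?_ ⟨x, hx, rfl⟩ hxΩ ⟨y, hy, rfl⟩
      rintro _ ⟨t, ht, rfl⟩
      exact hσ.line_notMem hs hd ht
    · right
      intro x hx hxΩ
      exact hex ⟨x, hx, hxΩ⟩
  · have hK : IsClosed {z : ℂ | 1 ≤ ‖z‖ ∧ ‖z‖ ≤ 2 ∧ C * |z.im| ≤ |z.re|} :=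
      (isClosed_le continuous_const continuous_norm).inter
        ((isClosed_le continuous_norm continuous_const).inter
          (isClosed_le (continuous_const.mul Complex.continuous_im.abs) Complex.continuous_re.abs))
    -- A limit point of the component in the cone is off the curve, so adjoining it keeps the set
    -- connected: the component is closed within the cone.
    have hE : {z ∈ connectedComponentIn Γᶜ (e:ℂ) | 1 ≤ ‖z‖ ∧ ‖z‖ ≤ 2 ∧ C * |z.im| ≤ |z.re|} =
        {z : ℂ | 1 ≤ ‖z‖ ∧ ‖z‖ ≤ 2 ∧ C * |z.im| ≤ |z.re|} ∩
          closure (connectedComponentIn Γᶜ (e:ℂ)) := by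
      ext z
      refine ⟨fun hz => ⟨hz.2, subset_closure hz.1⟩, fun hz => ⟨?_, hz.1⟩⟩
      have hzΓ : z ∉ Γ := by
        intro hmem
        have h3 := hcone z hmem (by rintro rfl; have := hz.1.1; norm_num at this)
        exact absurd hz.1.2.2 (not_le.2 h3)
      have hpre : IsPreconnected (insert z (connectedComponentIn Γᶜ (e:ℂ))) :=
        isPreconnected_connectedComponentIn.subset_closure (subset_insert _ _)
          (insert_subset hz.2 subset_closure)
      refine subset_component hpre (w := (e:ℂ)) ?_ (mem_insert_of_mem _ ?_) ?_ (mem_insert z _)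
      · rintro x (rfl | hx)
        · exact hzΓ
        · exact connectedComponentIn_subset _ _ hx
      · simpa using hray 1 one_pos
      · simpa using hray 1 one_pos
    rw [hE]
    exact Metric.isCompact_of_isClosed_isBounded (hK.inter isClosed_closure)
      ((isBounded_iff_forall_norm_le.2 ⟨2, fun z hz => hz.1.2.1⟩))

end GeneratingCurve

/-! ### Uniform accessibility of boundary points -/

-- Bounded points at distance at least `κ` from the complement form a compact subset of `Ω`. Read
-- contrapositively: at bounded size, a small real part of `τ` forces closeness to the boundary.
open Set Metric in
theorem IsTractModel.exists_re_ge {τ : ℂ → ℂ} {Ω : Set ℂ} (hτ : IsTractModel τ Ω)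
    (hΩ0 : (0 : ℂ) ∉ Ω) (R : ℝ) {κ : ℝ} (hκ : 0 < κ) :
    ∃ u : ℝ, 0 < u ∧ ∀ q ∈ Ω, ‖q‖ ≤ R → ball q κ ⊆ Ω → u ≤ (τ q).re := by
  set A : Set ℂ := {q | ‖q‖ ≤ R ∧ κ ≤ infDist q Ωᶜ} with hA
  have hAc : IsCompact A := by
    refine Metric.isCompact_of_isClosed_isBounded ?_
      (isBounded_iff_forall_norm_le.2 ⟨R, fun z hz => hz.1⟩)
    exact (isClosed_le continuous_norm continuous_const).inter
      (isClosed_le continuous_const (continuous_infDist_pt _))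
  have hAΩ : A ⊆ Ω := by
    intro q hq
    by_contra hqn
    have := hq.2
    rw [infDist_zero_of_mem (mem_compl hqn)] at this
    linarith
  have hmem : ∀ q ∈ Ω, ‖q‖ ≤ R → ball q κ ⊆ Ω → q ∈ A := by
    intro q _ hqR hball
    refine ⟨hqR, (le_infDist ⟨0, hΩ0⟩).2 fun y hy => ?_⟩
    by_contra hlt
    push Not at hlt
    exact hy (hball (by rwa [mem_ball, dist_comm]))
  rcases A.eq_empty_or_nonempty with h1 | h1
  · refine ⟨1, one_pos, fun q hq hqR hball => ?_⟩
    have := hmem q hq hqR hball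
    simp [h1] at this
  · obtain ⟨q, hq, hmin⟩ := hAc.exists_isMinOn h1
      (Complex.continuous_re.comp_continuousOn (hτ.differentiableOn.continuousOn.mono hAΩ))
    exact ⟨_, hτ.isBiholo.mapsTo q (hAΩ hq), fun z hz hzR hball => hmin (hmem z hz hzR hball)⟩

section GeneratingCurve

variable {h : ℂ ≃ₜ ℂ}

open Set Metric Complex in
theorem exists_lipschitzOnWith_exp (C : ℝ) : ∃ K : ℝ≥0, LipschitzOnWith K exp {z : ℂ | z.re ≤ C} := by
  refine ⟨(Real.exp C).toNNReal, ?_⟩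
  refine (convex_halfSpace_re_le C).lipschitzOnWith_of_nnnorm_deriv_le
    (fun z _ => Complex.differentiableAt_exp) fun z hz => ?_
  rw [Complex.deriv_exp, ← NNReal.coe_le_coe, coe_nnnorm, norm_exp,
    Real.coe_toNNReal _ (Real.exp_pos C).le]
  exact Real.exp_le_exp.2 hz

open Set Metric Complex in
/-- Some part of the lifted arc away from its end points has positive Hausdorff measure. -/
theorem IsGeneratingCurve.exists_pos_measure (hσ : IsGeneratingCurve (h '' sphere 0 1)) {Θ : ℝ}
    (hΘ : 0 < Θ) (hpos : 0 < μH[Θ] (h '' sphere 0 1)) :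
    ∃ δ : ℝ, 0 < δ ∧ δ ≤ 1 ∧ 0 < μH[Θ] {p : ℂ | exp p ∈ h '' sphere 0 1 ∧
      2 * Real.pi + δ ≤ p.im ∧ p.im ≤ 4 * Real.pi - δ} := by
  have hpi := Real.pi_pos
  obtain ⟨C, hC, hCre, -⟩ := hσ.exists_re_bound
  obtain ⟨K, hK⟩ := exists_lipschitzOnWith_exp C
  set E : ℝ → Set ℂ := fun δ => {p : ℂ | exp p ∈ h '' sphere 0 1 ∧
      2 * Real.pi + δ ≤ p.im ∧ p.im ≤ 4 * Real.pi - δ} with hE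
  by_contra hcon
  push Not at hcon
  have hzero : ∀ n : ℕ, μH[Θ] (exp '' E (1 / (n + 1))) = 0 := by
    intro n
    have h1 : μH[Θ] (E (1 / (n + 1))) = 0 := le_antisymm (hcon _ (by positivity) (by
      rw [div_le_one (by positivity)]; linarith [(Nat.cast_nonneg n : (0:ℝ) ≤ n)])) zero_le
    have h2 : LipschitzOnWith K exp (E (1 / (n + 1))) :=
      hK.mono fun p hp => (le_abs_self _).trans (hCre p hp.1)
    have h3 := h2.hausdorffMeasure_image_le hΘ.le
    rw [h1, mul_zero] at h3
    exact le_antisymm h3 zero_le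
  have hcover : h '' sphere 0 1 ⊆ {1} ∪ ⋃ n : ℕ, exp '' E (1 / (n + 1)) := by
    intro y hy
    by_cases hy1 : y = 1
    · exact Or.inl hy1
    right
    have hy0 : y ≠ 0 := by
      rintro rfl
      have := hσ.eq_one le_rfl (t := 0) (by simpa using hy)
      norm_num at this
    have harg : arg y ≠ 0 := by
      intro h0
      refine hy1 ?_
      have h1 : y = ((‖y‖ : ℝ) : ℂ) := by
        conv_lhs => rw [← norm_mul_exp_arg_mul_I y, h0]
        simp
      rw [h1] at hy ⊢
      rw [hσ.eq_one (norm_nonneg _) hy]; simp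
    obtain ⟨w, hw, hw1, hw2⟩ : ∃ w, exp w = y ∧ 2 * Real.pi < w.im ∧ w.im < 4 * Real.pi := by
      rcases lt_or_gt_of_ne harg with h1 | h1
      · refine ⟨log y + 2 * (2 * Real.pi * I), ?_, ?_, ?_⟩
        · rw [show (2:ℂ) = ((2:ℤ):ℂ) by norm_num, ← exp_log hy0]
          simpa [exp_log hy0] using (exp_periodic.int_mul 2) (log y)
        · simp [log_im]; linarith [neg_pi_lt_arg y]
        · simp [log_im]; linarith
      · refine ⟨log y + 2 * Real.pi * I, ?_, ?_, ?_⟩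
        · rw [exp_periodic, exp_log hy0]
        · simp [log_im]; linarith
        · simp [log_im]; linarith [arg_le_pi y]
    obtain ⟨n, hn⟩ := exists_nat_one_div_lt
      (lt_min (sub_pos.2 hw1) (sub_pos.2 hw2) : 0 < min (w.im - 2 * Real.pi) (4 * Real.pi - w.im))
    refine mem_iUnion.2 ⟨n, w, ⟨by rwa [hw], ?_, ?_⟩, hw⟩
    · linarith [min_le_left (w.im - 2 * Real.pi) (4 * Real.pi - w.im)]
    · linarith [min_le_right (w.im - 2 * Real.pi) (4 * Real.pi - w.im)]
  have hnull : μH[Θ] (h '' sphere 0 1) = 0 := by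
    refine measure_mono_null hcover (measure_union_null ?_ (measure_iUnion_null hzero))
    have := Measure.nullSingletonClass_hausdorff ℂ hΘ
    exact measure_singleton 1
  exact hpos.ne' hnull

open Set Metric Complex in
/-- Quasiconformality: the distance to the curve along the image of a radius. -/
theorem ball_subset_curveSide {H : ℝ} (hH : 0 < H)
    (hq : ∀ x y z : ℂ, ‖y - x‖ ≤ ‖z - x‖ → ‖h y - h x‖ ≤ H * ‖h z - h x‖) {e s : ℝ} (he : |e| = 1)
    (hs : 0 < s) (hs1 : s ≤ 1 / 2) {ξ : ℂ} (hξ : ‖ξ‖ = 1) :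
    ball (h ((1 + e * s) * ξ)) (‖h ((1 + e * s) * ξ) - h ξ‖ / H) ⊆ curveSide h e ∧
      h ((1 + e * s) * ξ) ∈ curveSide h e := by
  have hee : e * e = 1 := by
    rcases (abs_eq zero_le_one).1 he with rfl | rfl <;> norm_num
  have hes : |e * s| = s := by rw [abs_mul, he, one_mul, abs_of_pos hs]
  have hes1 := abs_le.1 (hes.le.trans hs1)
  have hnorm : ‖(1 + e * s : ℂ)‖ = 1 + e * s := by
    rw [show (1 + e * s : ℂ) = ((1 + e * s : ℝ) : ℂ) by push_cast; rfl, norm_real,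
      Real.norm_of_nonneg (by linarith)]
  have hmem : h ((1 + e * s) * ξ) ∈ curveSide h e := by
    refine ⟨_, ?_, rfl⟩
    show 0 < e * (‖(1 + e * s) * ξ‖ - 1)
    rw [norm_mul, hnorm, hξ]
    have : e * ((1 + e * s) * 1 - 1) = s := by linear_combination s * hee
    rw [this]; exact hs
  refine ⟨?_, hmem⟩
  have hdist : 0 < ‖h ((1 + e * s) * ξ) - h ξ‖ := by
    rw [norm_pos_iff, sub_ne_zero]
    intro h1
    refine notMem_of_mem_curveSide hmem ⟨ξ, by simpa using hξ, h1.symm⟩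
  refine subset_curveSide he (convex_ball _ _).isPreconnected ?_ (mem_ball_self (by positivity)) hmem
  rintro _ hz ⟨ζ, hζ, rfl⟩
  rw [mem_ball, dist_eq_norm, lt_div_iff₀ hH] at hz
  -- `ξ` is the point of the circle nearest to `(1 + es) ξ`, so quasisymmetry compares its image
  -- with that of any other `ζ` on the circle.
  have h1 := hq ((1 + e * s) * ξ) ξ ζ (by
    have h2 : ‖ξ - (1 + e * s) * ξ‖ = s := by
      rw [show ξ - (1 + e * s) * ξ = -((e * s : ℝ) : ℂ) * ξ by push_cast; ring, norm_mul, norm_neg,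
        norm_real, Real.norm_eq_abs, hes, hξ, mul_one]
    rw [h2]
    have h3 := abs_norm_sub_norm_le ζ ((1 + e * s) * ξ)
    rw [norm_mul, hnorm, hξ, mem_sphere_zero_iff_norm.1 hζ] at h3
    have : |1 - (1 + e * s) * 1| = s := by
      rw [show 1 - (1 + e * s) * 1 = -(e * s) by ring, abs_neg, hes]
    linarith)
  rw [norm_sub_rev] at h1
  linarith

open Set Metric Complex in
/-- The lift of the image of a radius stays well inside the component. -/
theorem IsGeneratingCurve.access_path (hσ : IsGeneratingCurve (h '' sphere 0 1)) {H : ℝ} (hH : 1 ≤ H)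
    (hq : ∀ x y z : ℂ, ‖y - x‖ ≤ ‖z - x‖ → ‖h y - h x‖ ≤ H * ‖h z - h x‖) {e : ℝ} (he : |e| = 1)
    {m M δ : ℝ} (hm : 0 < m) (hδ : 0 < δ) (hδ1 : δ ≤ 1) (hmM : m ≤ M)
    {s : ℝ} (hs : 0 < s) (hs1 : s ≤ 1 / 2)
    {ξ p : ℂ} (hξ : ‖ξ‖ = 1) (hp : exp p = h ξ) (hpm : m ≤ ‖exp p‖) (hpM : ‖exp p‖ ≤ M)
    (hQM : ‖h ((1 + e * s) * ξ)‖ ≤ M)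
    (hclose : ‖h ((1 + e * s) * ξ) - h ξ‖ ≤ m * (δ / 4))
    (hp1 : 2 * Real.pi + δ ≤ p.im) (hp2 : p.im ≤ 4 * Real.pi - δ) :
    let q := p + log (1 + (h ((1 + e * s) * ξ) / exp p - 1))
    q ∈ connectedComponentIn (selfSimilarCurve (h '' sphere 0 1))ᶜ (e:ℂ) ∧
      ‖q - p‖ ≤ δ / 2 ∧ ‖h ((1 + e * s) * ξ) - h ξ‖ ≤ 2 * M * ‖q - p‖ ∧
      ball q (‖q - p‖ / (3 * M * H / m)) ⊆
        connectedComponentIn (selfSimilarCurve (h '' sphere 0 1))ᶜ (e:ℂ) := by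
  intro q
  set Q := h ((1 + e * s) * ξ) with hQ
  set t := Q / exp p - 1 with ht
  have hM : 0 < M := hm.trans_le hmM
  have hP0 : 0 < ‖exp p‖ := hm.trans_le hpm
  have ht1 : ‖t‖ = ‖Q - h ξ‖ / ‖exp p‖ := by
    rw [ht, ← hp, ← norm_div, sub_div, div_self (exp_ne_zero p)]
  have ht2 : ‖t‖ ≤ δ / 4 := by
    rw [ht1, div_le_iff₀ hP0]
    refine hclose.trans ?_
    rw [mul_comm]; gcongr
  have ht3 : ‖t‖ ≤ 1 / 2 := by linarith
  have hqp : q - p = log (1 + t) := add_sub_cancel_left p _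
  have hqpn : ‖q - p‖ ≤ 3 / 2 * ‖t‖ := by
    rw [hqp]; exact norm_log_one_add_half_le_self ht3
  have hqpδ : ‖q - p‖ ≤ 3 / 8 * δ := by linarith
  have h1t : 1 + t ≠ 0 := slitPlane_ne_zero (mem_slitPlane_of_norm_lt_one (by linarith))
  -- `q` is the lift of `Q` close to `p`; the principal logarithm is legitimate because `Q / exp p`
  -- is near `1`.
  have hexpq : exp q = Q := by
    show exp (p + log (1 + t)) = Q
    rw [exp_add, exp_log h1t, ht]
    field_simp [exp_ne_zero p]
    ring
  have hpi := Real.pi_pos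
  obtain ⟨hball, hQside⟩ := ball_subset_curveSide (by linarith : 0 < H) hq he hs hs1 hξ
  rw [← hQ] at hball hQside
  have him : ∀ y : ℂ, ‖y - p‖ ≤ δ → 2 * Real.pi ≤ y.im ∧ y.im ≤ 4 * Real.pi := by
    intro y hy
    have := (abs_im_le_norm (y - p)).trans hy
    rw [sub_im, abs_le] at this
    constructor <;> linarith
  refine ⟨?_, by linarith, ?_, ?_⟩
  · obtain ⟨h1, h2⟩ := him q (by linarith)
    exact hσ.mem_component_of_exp he h1 h2 (by rwa [hexpq])
  · have h1 : Q - h ξ = exp p * (exp (q - p) - 1) := by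
      rw [mul_sub, ← exp_add, add_sub_cancel, hexpq, hp, mul_one]
    have h2 := norm_exp_sub_one_le (x := q - p) (by linarith)
    rw [h1, norm_mul]
    calc ‖exp p‖ * ‖exp (q - p) - 1‖ ≤ M * (2 * ‖q - p‖) := by gcongr
      _ = _ := by ring
  · intro y hy
    rw [mem_ball, dist_eq_norm] at hy
    -- Here `H` is the quasisymmetry constant, and `M`, `m` bound the distortion of `exp` at the
    -- points in question.
    have hK : 1 ≤ 3 * M * H / m := by
      rw [le_div_iff₀ hm]; nlinarith
    have hy1 : ‖y - q‖ ≤ ‖q - p‖ := hy.le.trans (div_le_self (norm_nonneg _) hK)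
    have hy2 : ‖y - p‖ ≤ δ := by
      have : y - p = (y - q) + (q - p) := by ring
      rw [this]
      refine (norm_add_le _ _).trans ?_
      linarith
    obtain ⟨h1, h2⟩ := him y hy2
    refine hσ.mem_component_of_exp he h1 h2 (hball ?_)
    have h3 : exp y - Q = Q * (exp (y - q) - 1) := by
      rw [mul_sub, ← hexpq, ← exp_add, add_sub_cancel, mul_one]
    have h4 := norm_exp_sub_one_le (x := y - q) (by linarith)
    rw [mem_ball, dist_eq_norm, h3, norm_mul, lt_div_iff₀ (by linarith : 0 < H)]
    have h5 : ‖y - q‖ * (3 * M * H / m) < ‖q - p‖ := by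
      rwa [lt_div_iff₀ (by positivity)] at hy
    have h6 : ‖q - p‖ ≤ 3 / 2 * (‖Q - h ξ‖ / m) := by
      refine hqpn.trans ?_
      rw [ht1]; gcongr
    have h7 : ‖y - q‖ * (3 * M * H / m) < 3 / 2 * (‖Q - h ξ‖ / m) := h5.trans_le h6
    have h8 : ‖y - q‖ * (3 * M * H) < 3 / 2 * ‖Q - h ξ‖ := by
      have := mul_lt_mul_of_pos_right h7 hm
      field_simp at this
      linarith
    calc ‖Q‖ * ‖exp (y - q) - 1‖ * H ≤ M * (2 * ‖y - q‖) * H := by gcongr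
      _ < ‖Q - h ξ‖ := by linarith

open Set Metric Complex in
/-- The points of a set of positive Hausdorff measure are uniformly accessible from the tract. -/
theorem IsGeneratingCurve.exists_accessible (hσ : IsGeneratingCurve (h '' sphere 0 1))
    (hq : IsQuasiconformalPlane h) {e : ℝ} (he : |e| = 1) {Θ : ℝ} (hΘ : 0 < Θ)
    (hpos : 0 < μH[Θ] (h '' sphere 0 1)) {τ : ℂ → ℂ} {Ω : Set ℂ}
    (hΩ : Ω = connectedComponentIn (selfSimilarCurve (h '' sphere 0 1))ᶜ (e:ℂ))
    (hτ : IsTractModel τ Ω) :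
    ∃ E : Set ℂ, 0 < μH[Θ] E ∧ ∃ H r R u : ℝ, 1 ≤ H ∧ 0 < r ∧ r ≤ R ∧ 0 < u ∧ ∀ p ∈ E, p ∉ Ω ∧
      ∀ x : ℝ, 0 < x → x ≤ u → ∃ q ∈ Ω, (τ q).re = x ∧ r ≤ ‖q‖ ∧ ‖q‖ ≤ R ∧
        ball q (‖q - p‖ / H) ⊆ Ω := by
  have hpi := Real.pi_pos
  obtain ⟨δ, hδ, hδ1, hE⟩ := hσ.exists_pos_measure hΘ hpos
  obtain ⟨C, hC, hCre, -⟩ := hσ.exists_re_bound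
  obtain ⟨H₀, hH₀⟩ := hq
  set H := max H₀ 1 with hH
  have hH1 : 1 ≤ H := le_max_right _ _
  have hqc : ∀ x y z : ℂ, ‖y - x‖ ≤ ‖z - x‖ → ‖h y - h x‖ ≤ H * ‖h z - h x‖ := fun x y z hxyz =>
    (hH₀ x y z hxyz).trans (mul_le_mul_of_nonneg_right (le_max_left _ _) (norm_nonneg _))
  obtain ⟨M, hM⟩ := ((isCompact_closedBall (0:ℂ) 2).image h.continuous).isBounded.exists_norm_le
  set m := Real.exp (-C) with hm
  have hm0 : 0 < m := Real.exp_pos _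
  have hhM : ∀ z : ℂ, ‖z‖ ≤ 2 → ‖h z‖ ≤ M := fun z hz => hM _ ⟨z, by simpa using hz, rfl⟩
  have hlow : ∀ p : ℂ, exp p ∈ h '' sphere 0 1 → m ≤ ‖exp p‖ := by
    intro p hp
    rw [norm_exp]
    exact Real.exp_le_exp.2 (abs_le.1 (hCre p hp)).1
  have hupp : ∀ p : ℂ, exp p ∈ h '' sphere 0 1 → ‖exp p‖ ≤ M := by
    rintro p ⟨z, hz, hzp⟩
    rw [← hzp]; exact hhM z (by rw [mem_sphere_zero_iff_norm.1 hz]; norm_num)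
  have hmM : m ≤ M := by
    obtain ⟨p, hp⟩ : {p : ℂ | exp p ∈ h '' sphere 0 1 ∧ 2 * Real.pi + δ ≤ p.im ∧
        p.im ≤ 4 * Real.pi - δ}.Nonempty := nonempty_of_measure_ne_zero hE.ne'
    exact (hlow p hp.1).trans (hupp p hp.1)
  have hM0 : 0 < M := hm0.trans_le hmM
  obtain ⟨ε, hε, hunif⟩ := Metric.uniformContinuousOn_iff_le.1
    ((isCompact_closedBall (0:ℂ) 2).uniformContinuousOn_of_continuous h.continuous.continuousOn)
    (m * (δ / 4)) (by positivity)
  set s₀ := min ε (1 / 2) with hs₀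
  have hs₀pos : 0 < s₀ := lt_min hε (by norm_num)
  have hes : ∀ s : ℝ, 0 < s → |e * s| = s := by
    intro s hs; rw [abs_mul, he, one_mul, abs_of_pos hs]
  have hpath : ∀ s ξ, 0 < s → s ≤ s₀ → ‖ξ‖ = 1 → ‖((1 + e * s) * ξ : ℂ)‖ ≤ 2 ∧
      ‖h ((1 + e * s) * ξ) - h ξ‖ ≤ m * (δ / 4) := by
    intro s ξ hs hs1 hξ
    have h1 : s ≤ 1 / 2 := hs1.trans (min_le_right _ _)
    have h2 : ‖((1 + e * s) * ξ : ℂ)‖ ≤ 2 := by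
      rw [norm_mul, hξ, mul_one]
      refine (norm_add_le _ _).trans ?_
      rw [norm_one, ← ofReal_mul, norm_real, Real.norm_eq_abs, hes s hs]; linarith
    refine ⟨h2, ?_⟩
    have := hunif ((1 + e * s) * ξ) (by simpa using h2) ξ (by simp [hξ]) (by
      rw [dist_eq_norm, show (1 + e * s) * ξ - ξ = ((e * s : ℝ) : ℂ) * ξ by push_cast; ring, norm_mul,
        norm_real, Real.norm_eq_abs, hes s hs, hξ, mul_one]
      exact hs1.trans (min_le_left _ _))
    rwa [dist_eq_norm] at this
  set K := 3 * M * H / m with hK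
  have hK1 : 1 ≤ K := by rw [hK, le_div_iff₀ hm0]; nlinarith
  set R := C + 4 * Real.pi + 1 with hR
  -- a lower bound for the distance at the end of the path
  obtain ⟨κ, hκ, hκle⟩ : ∃ κ : ℝ, 0 < κ ∧ ∀ ξ : ℂ, ‖ξ‖ = 1 → κ ≤ ‖h ((1 + e * s₀) * ξ) - h ξ‖ := by
    obtain ⟨ξ₁, hξ₁, hmin⟩ := (isCompact_sphere (0:ℂ) 1).exists_isMinOn ⟨1, by simp⟩
      (f := fun ξ => ‖h ((1 + e * s₀) * ξ) - h ξ‖)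
      (Continuous.continuousOn (((h.continuous.comp (continuous_const.mul continuous_id)).sub
        h.continuous).norm))
    refine ⟨_, ?_, fun ξ hξ => hmin (by simpa using hξ)⟩
    rw [norm_pos_iff, sub_ne_zero]
    intro h1
    have h2 := h.injective h1
    have h3 : ((e * s₀ : ℝ) : ℂ) * ξ₁ = 0 := by push_cast; linear_combination h2
    have h4 := congrArg norm h3
    rw [norm_mul, norm_real, Real.norm_eq_abs, hes _ hs₀pos, mem_sphere_zero_iff_norm.1 hξ₁] at h4
    simp at h4
    linarith
  set κ' := κ / (2 * M) / K with hκ'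
  have hκ'0 : 0 < κ' := by positivity
  have hΩ0 : (0 : ℂ) ∉ Ω := by
    rw [hΩ]; exact fun h0 => connectedComponentIn_subset _ _ h0 (zero_mem_selfSimilarCurve _)
  have hτc : ContinuousOn (fun z => (τ z).re) Ω :=
    Complex.continuous_re.comp_continuousOn hτ.differentiableOn.continuousOn
  -- All paths end at distance at least `κ'` from the complement, so `Re τ ≥ u` at their far ends
  -- and every smaller value is passed on the way to `p`.
  obtain ⟨u, hu, hule⟩ := hτ.exists_re_ge hΩ0 R hκ'0
  obtain ⟨N, hN⟩ := hτ.norm_lt_of_norm_lt (R + 1)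
  refine ⟨_, hE, K, 2 * Real.pi, R, u, hK1, by positivity, by linarith, hu, ?_⟩
  rintro p ⟨hpσ, hp1, hp2⟩
  obtain ⟨ξ, hξ', hξp⟩ := hpσ
  have hξ : ‖ξ‖ = 1 := by simpa using hξ'
  have hpσ : exp p ∈ h '' sphere 0 1 := ⟨ξ, hξ', hξp⟩
  have hpΩ : p ∉ Ω := by
    intro hpm
    rw [hΩ] at hpm
    refine connectedComponentIn_subset _ _ hpm ?_
    rwa [hσ.mem_iff_of_strip (by linarith) (by linarith)]
  refine ⟨hpΩ, fun x hx hxu => ?_⟩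
  set q : ℝ → ℂ := fun s => p + log (1 + (h ((1 + e * s) * ξ) / exp p - 1)) with hqdef
  have hprop : ∀ s, 0 < s → s ≤ s₀ → q s ∈ Ω ∧ ‖q s - p‖ ≤ δ / 2 ∧
      ‖h ((1 + e * s) * ξ) - h ξ‖ ≤ 2 * M * ‖q s - p‖ ∧ ball (q s) (‖q s - p‖ / K) ⊆ Ω := by
    intro s hs hs1
    obtain ⟨h1, h2⟩ := hpath s ξ hs hs1 hξ
    rw [hΩ]
    exact hσ.access_path hH1 hqc he hm0 hδ hδ1 hmM hs (hs1.trans (min_le_right _ _)) hξ hξp.symm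
      (hlow p hpσ) (hupp p hpσ) (hhM _ h1) h2 hp1 hp2
  have hcontAt : ∀ s, 0 ≤ s → s ≤ s₀ → ContinuousAt q s := by
    intro s hs hs1
    have h1 : ‖h ((1 + e * s) * ξ) / exp p - 1‖ < 1 := by
      rcases hs.eq_or_lt with rfl | hs
      · simp [hξp, exp_ne_zero]
      · have h2 := (hpath s ξ hs hs1 hξ).2
        have hP0 : 0 < ‖exp p‖ := hm0.trans_le (hlow p hpσ)
        have h3 : h ((1 + e * s) * ξ) / exp p - 1 = (h ((1 + e * s) * ξ) - h ξ) / exp p := by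
          rw [sub_div, hξp, div_self (exp_ne_zero p)]
        rw [h3, norm_div, div_lt_one hP0]
        have h4 : m * (δ / 4) < m := by nlinarith
        linarith [hlow p hpσ]
    have h2 : Continuous fun s : ℝ => 1 + (h ((1 + e * s) * ξ) / exp p - 1) :=
      continuous_const.add (((h.continuous.comp (by fun_prop)).div_const _).sub continuous_const)
    exact continuousAt_const.add
      (ContinuousAt.clog h2.continuousAt (mem_slitPlane_of_norm_lt_one h1))
  have hq0 : q 0 = p := by simp [hqdef, hξp, exp_ne_zero]
  have hnormq : ∀ s, 0 < s → s ≤ s₀ → 2 * Real.pi ≤ ‖q s‖ ∧ ‖q s‖ ≤ R := by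
    intro s hs hs1
    have h1 := (hprop s hs hs1).2.1
    constructor
    · have h2 := (abs_im_le_norm (q s - p)).trans h1
      rw [sub_im, abs_le] at h2
      have := (le_abs_self _).trans (abs_im_le_norm (q s))
      linarith
    · have h2 := norm_le_norm_add_norm_sub' (q s) p
      have h3 := norm_le_abs_re_add_abs_im p
      have h4 := hCre p hpσ
      have h5 : |p.im| = p.im := abs_of_nonneg (by linarith)
      linarith
  -- near the boundary the real part is small
  obtain ⟨s₁, hs₁, hs₁0, hs₁x⟩ : ∃ s₁, 0 < s₁ ∧ s₁ ≤ s₀ ∧ (τ (q s₁)).re < x := by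
    -- A compact subset of `Ω`, hence not containing `p`. Close to `p` the path avoids it, and since
    -- `|τ| < N` along the path, the real part there is below `x`.
    set B : Set ℂ := Function.invFunOn τ Ω '' {w | x ≤ w.re ∧ ‖w‖ ≤ N} with hB
    have hsub : {w : ℂ | x ≤ w.re ∧ ‖w‖ ≤ N} ⊆ rightHalfPlane := fun w hw => hx.trans_le hw.1
    have hBc : IsCompact B := by
      refine IsCompact.image_of_continuousOn ?_ (hτ.isBiholo.diff_inv.continuousOn.mono hsub)
      exact Metric.isCompact_of_isClosed_isBounded
        ((isClosed_le continuous_const Complex.continuous_re).inter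
          (isClosed_le continuous_norm continuous_const))
        (isBounded_iff_forall_norm_le.2 ⟨N, fun z hz => hz.2⟩)
    have hpB : q 0 ∉ B := by
      rw [hq0]
      rintro ⟨w, hw, hwp⟩
      exact hpΩ (hwp ▸ hτ.isBiholo.mapsTo_inv w (hsub hw))
    have hev := (hcontAt 0 le_rfl hs₀pos.le).eventually (hBc.isClosed.isOpen_compl.mem_nhds hpB)
    obtain ⟨η, hη, hball⟩ := Metric.eventually_nhds_iff.1 hev
    refine ⟨min (η / 2) s₀, lt_min (by positivity) hs₀pos, min_le_right _ _, ?_⟩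
    set s₁ := min (η / 2) s₀ with hs₁
    have hs₁pos : 0 < s₁ := lt_min (by positivity) hs₀pos
    have h1 := hball (y := s₁) (by
      rw [Real.dist_0_eq_abs, abs_of_pos hs₁pos]
      exact (min_le_left _ _).trans_lt (by linarith))
    have h2 := (hprop s₁ hs₁pos (min_le_right _ _)).1
    by_contra hle
    push Not at hle
    refine h1 ⟨τ (q s₁), ⟨hle, (hN _ h2 ?_).le⟩, hτ.isBiholo.left_inv _ h2⟩
    linarith [(hnormq s₁ hs₁pos (min_le_right _ _)).2]
  have hs₀x : x ≤ (τ (q s₀)).re := by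
    obtain ⟨h0, -, h3, h4⟩ := hprop s₀ hs₀pos le_rfl
    refine hxu.trans (hule _ h0 (hnormq s₀ hs₀pos le_rfl).2 ((ball_subset_ball ?_).trans h4))
    rw [hκ']
    gcongr
    rw [div_le_iff₀ (by positivity)]
    linarith [hκle ξ hξ]
  have hIVT := intermediate_value_Icc hs₁0 (f := fun s => (τ (q s)).re) (hτc.comp
    (fun s hs => (hcontAt s (hs₁.le.trans hs.1) hs.2).continuousWithinAt)
    (fun s hs => (hprop s (hs₁.trans_le hs.1) hs.2).1))
  obtain ⟨s, hs, hsx⟩ := hIVT ⟨hs₁x.le, hs₀x⟩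
  have hspos := hs₁.trans_le hs.1
  exact ⟨q s, (hprop s hspos hs.2).1, hsx, (hnormq s hspos hs.2).1, (hnormq s hspos hs.2).2,
    (hprop s hspos hs.2).2.2.2⟩

end GeneratingCurve

/-! ### Logarithms, Hausdorff content and distortion of the inverse map -/

open Set Metric Complex in
theorem exists_log_of_ball {g : ℂ → ℂ} (hg : DifferentiableOn ℂ g (ball 0 1))
    (h0 : ∀ z ∈ ball (0:ℂ) 1, g z ≠ 0) :
    ∃ l : ℂ → ℂ, DifferentiableOn ℂ l (ball 0 1) ∧ ∀ z ∈ ball (0:ℂ) 1, exp (l z) = g z := by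
  have hprim : DifferentiableOn ℂ (fun z => deriv g z / g z) (ball 0 1) :=
    (hg.deriv isOpen_ball).div hg h0
  have hmem0 : (0:ℂ) ∈ ball (0:ℂ) 1 := mem_ball_self one_pos
  obtain ⟨l, hl0, hl⟩ := hprim.isExactOn_ball.with_val_at 0 (log (g 0))
  refine ⟨l, fun z hz => (hl z hz).differentiableAt.differentiableWithinAt, fun z hz => ?_⟩
  have hc : ∀ z ∈ ball (0:ℂ) 1, HasDerivAt (fun z => g z * exp (-l z)) 0 z := by
    intro z hz
    have hkz := (hg.differentiableAt (isOpen_ball.mem_nhds hz)).hasDerivAt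
    refine (hkz.mul (hl z hz).neg.cexp).congr_deriv ?_
    field_simp [h0 z hz]
    ring
  have hconst := (convex_ball (0:ℂ) 1).is_const_of_fderivWithin_eq_zero (𝕜 := ℂ)
    (f := fun z => g z * exp (-l z))
    (fun z hz => (hc z hz).differentiableAt.differentiableWithinAt)
    (fun z hz => by
      rw [fderivWithin_of_isOpen isOpen_ball hz]
      have := (hc z hz).hasFDerivAt.fderiv
      rw [this]; ext; simp) hz hmem0
  simp only [hl0] at hconst
  rw [Complex.exp_neg, Complex.exp_neg, exp_log (h0 0 hmem0), mul_inv_cancel₀ (h0 0 hmem0),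
    mul_inv_eq_one₀ (exp_ne_zero _)] at hconst
  exact hconst.symm

open Set Metric Complex in
theorem exists_log_of_rightHalfPlane {g : ℂ → ℂ} (hg : DifferentiableOn ℂ g rightHalfPlane)
    (h0 : ∀ w ∈ rightHalfPlane, g w ≠ 0) :
    ∃ l : ℂ → ℂ, DifferentiableOn ℂ l rightHalfPlane ∧ ∀ w ∈ rightHalfPlane, exp (l w) = g w := by
  have hc := isBiholo_cayley
  obtain ⟨l, hl, hle⟩ := exists_log_of_ball (g := fun z => g (cayleyInv z))
    (hg.comp hc.diff_inv hc.mapsTo_inv) (fun z hz => h0 _ (hc.mapsTo_inv z hz))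
  refine ⟨fun w => l (cayley w), hl.comp hc.diff hc.mapsTo, fun w hw => ?_⟩
  rw [hle _ (hc.mapsTo w hw), hc.left_inv w hw]

open Set Metric in
/-- A set of positive Hausdorff measure has positive content with respect to finite covers by
balls. -/
theorem exists_content_pos {E : Set ℂ} {Θ : ℝ} (hΘ : 0 < Θ) (hE : 0 < μH[Θ] E) :
    ∃ c : ℝ, 0 < c ∧ ∀ (S : Finset ℤ) (z : ℤ → ℂ) (ρ : ℤ → ℝ), (∀ k ∈ S, 0 ≤ ρ k) →
      (∀ p ∈ E, ∃ k ∈ S, ‖z k - p‖ ≤ ρ k) → c ≤ ∑ k ∈ S, (2 * ρ k) ^ Θ := by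
  by_contra hcon
  push Not at hcon
  have hpos : ∀ n : ℕ, (0:ℝ) < 1 / (n + 1) := fun n => by positivity
  choose S z ρ hρ hcov hsum using fun n : ℕ => hcon _ (hpos n)
  -- A small sum forces small discs, so covers of small content already compute the Hausdorff
  -- measure.
  have hterm : ∀ n : ℕ, ∀ k ∈ S n, (2 * ρ n k) ≤ (1 / (n + 1 : ℝ)) ^ (1 / Θ) := by
    intro n k hk
    have h1 : (2 * ρ n k) ^ Θ ≤ 1 / (n + 1) := by
      refine le_trans ?_ (hsum n).le
      exact Finset.single_le_sum (f := fun k => (2 * ρ n k) ^ Θ)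
        (fun j hj => Real.rpow_nonneg (by linarith [hρ n j hj]) _) hk
    have h2 : 0 ≤ 2 * ρ n k := by linarith [hρ n k hk]
    calc 2 * ρ n k = ((2 * ρ n k) ^ Θ) ^ (1 / Θ) := by
          rw [← Real.rpow_mul h2, mul_one_div_cancel hΘ.ne', Real.rpow_one]
      _ ≤ _ := Real.rpow_le_rpow (Real.rpow_nonneg h2 _) h1 (by positivity)
  have hediam : ∀ n : ℕ, ∀ k ∈ S n, ediam (closedBall (z n k) (ρ n k)) ≤ ENNReal.ofReal (2 * ρ n k) := by
    intro n k hk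
    refine ediam_le fun x hx y hy => ?_
    rw [edist_dist]
    refine ENNReal.ofReal_le_ofReal ?_
    rw [mem_closedBall] at hx hy
    have := dist_triangle_right x y (z n k)
    linarith
  have hlim := Measure.hausdorffMeasure_le_liminf_sum (ι := fun n => {k // k ∈ S n}) Θ E (l := atTop)
    (fun n : ℕ => ENNReal.ofReal ((1 / (n + 1 : ℝ)) ^ (1 / Θ))) (by
      rw [← ENNReal.ofReal_zero]
      refine ENNReal.tendsto_ofReal ?_
      have := (tendsto_one_div_add_atTop_nhds_zero_nat (𝕜 := ℝ)).rpow_const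
        (p := 1 / Θ) (Or.inr (by positivity))
      rwa [Real.zero_rpow (by positivity)] at this)
    (fun n k => closedBall (z n k.1) (ρ n k.1))
    (Eventually.of_forall fun n k => (hediam n k.1 k.2).trans
      (ENNReal.ofReal_le_ofReal (hterm n k.1 k.2)))
    (Eventually.of_forall fun n p hp => by
      obtain ⟨k, hk, h1⟩ := hcov n p hp
      refine mem_iUnion.2 ⟨⟨k, hk⟩, ?_⟩
      rwa [mem_closedBall, dist_comm, dist_eq_norm])
  have hle : ∀ n : ℕ, ∑ k : {k // k ∈ S n}, ediam (closedBall (z n k.1) (ρ n k.1)) ^ Θ ≤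
      ENNReal.ofReal (1 / (n + 1)) := by
    intro n
    calc ∑ k : {k // k ∈ S n}, ediam (closedBall (z n k.1) (ρ n k.1)) ^ Θ
        ≤ ∑ k : {k // k ∈ S n}, ENNReal.ofReal ((2 * ρ n k.1) ^ Θ) := by
          refine Finset.sum_le_sum fun k _ => ?_
          rw [← ENNReal.ofReal_rpow_of_nonneg (by linarith [hρ n k.1 k.2]) hΘ.le]
          exact ENNReal.rpow_le_rpow (hediam n k.1 k.2) hΘ.le
      _ = ENNReal.ofReal (∑ k ∈ S n, (2 * ρ n k) ^ Θ) := by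
          rw [← Finset.sum_coe_sort (S n), ENNReal.ofReal_sum_of_nonneg]
          exact fun k _ => Real.rpow_nonneg (by linarith [hρ n k.1 k.2]) _
      _ ≤ _ := ENNReal.ofReal_le_ofReal (hsum n).le
  have hzero : liminf (fun n : ℕ => ∑ k : {k // k ∈ S n},
      ediam (closedBall (z n k.1) (ρ n k.1)) ^ Θ) atTop = 0 := by
    refine Tendsto.liminf_eq (tendsto_of_tendsto_of_tendsto_of_le_of_le tendsto_const_nhds ?_
      (fun n => zero_le) hle)
    rw [← ENNReal.ofReal_zero]
    exact ENNReal.tendsto_ofReal tendsto_one_div_add_atTop_nhds_zero_nat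
  rw [hzero] at hlim
  exact absurd hlim (not_le.2 hE)

-- The distance to `x` is `1`-Lipschitz and maps a connected set onto a set containing a
-- nondegenerate interval.
open Set Metric in
theorem hausdorffMeasure_one_pos_of_isPreconnected {S : Set ℂ} (hS : IsPreconnected S) {x y : ℂ}
    (hx : x ∈ S) (hy : y ∈ S) (hxy : x ≠ y) : 0 < μH[1] S := by
  have hlip : LipschitzWith 1 (fun z : ℂ => dist z x) := LipschitzWith.dist_left x
  have h1 := hlip.lipschitzOnWith.hausdorffMeasure_image_le (s := S) zero_le_one
  have hsub : Icc (dist x x) (dist y x) ⊆ (fun z : ℂ => dist z x) '' S :=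
    (hS.image _ hlip.continuous.continuousOn).Icc_subset ⟨x, hx, rfl⟩ ⟨y, hy, rfl⟩
  have h2 := measure_mono (μ := μH[1]) hsub
  rw [hausdorffMeasure_real, Real.volume_Icc, dist_self, sub_zero] at h2
  have h3 : 0 < ENNReal.ofReal (dist y x) := ENNReal.ofReal_pos.2 (dist_pos.2 hxy.symm)
  rw [hausdorffMeasure_real] at h1
  simp only [ENNReal.coe_one, ENNReal.one_rpow, one_mul] at h1
  exact h3.trans_le (h2.trans h1)

open Set Metric Complex in
theorem ball_subset_rightHalfPlane (w : ℂ) : ball w w.re ⊆ rightHalfPlane := by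
  intro z hz
  rw [mem_ball, dist_eq_norm] at hz
  have := (abs_re_le_norm (z - w)).trans_lt hz
  rw [sub_re, abs_lt] at this
  show 0 < z.re
  linarith

section Biholo

variable {t φ : ℂ → ℂ} {Ω : Set ℂ}

-- Koebe's bound on the disk of radius `Re w` about `w`, which lies in the half-plane, with `p` as
-- omitted value.
open Set Metric Complex in
theorem IsBiholo.norm_deriv_mul_re_le (hB : IsBiholo t φ Ω rightHalfPlane) {w p : ℂ}
    (hw : 0 < w.re) (hp : p ∉ Ω) : ‖deriv φ w‖ * w.re ≤ 12 * ‖φ w - p‖ := by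
  have hs := ball_subset_rightHalfPlane w
  refine norm_deriv_mul_le_of_notMem_image hw (hB.diff_inv.mono hs) (hB.symm.injOn.mono hs) ?_
  rintro ⟨z, hz, rfl⟩
  exact hp (hB.mapsTo_inv z (hs hz))

-- Within `Re w / 100` of `w` the distortion factor is at most `exp (24 / 100)`, which is below `2`.
open Set Metric Complex in
theorem IsBiholo.norm_deriv_le (hB : IsBiholo t φ Ω rightHalfPlane) {w v : ℂ}
    (hv : ‖v - w‖ ≤ w.re / 100) (hw : 0 < w.re) :
    ‖deriv φ v‖ ≤ 2 * ‖deriv φ w‖ ∧ ‖deriv φ w‖ ≤ 2 * ‖deriv φ v‖ ∧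
      ‖φ v - φ w‖ ≤ 2 * ‖deriv φ w‖ * ‖v - w‖ := by
  have hs := ball_subset_rightHalfPlane w
  have hd := hB.diff_inv.mono hs
  have hi := hB.symm.injOn.mono hs
  have he : ∀ x : ℝ, x ≤ w.re / 100 → Real.exp (24 * (x / w.re)) ≤ 2 := by
    intro x hx
    have h1 : x / w.re ≤ 1 / 100 := by rw [div_le_iff₀ hw]; linarith
    calc Real.exp (24 * (x / w.re)) ≤ Real.exp (1 / 2) := Real.exp_le_exp.2 (by linarith)
      _ ≤ 2 := by
        have h2 : Real.exp (1 / 2) ^ 2 = Real.exp 1 := by rw [← Real.exp_nat_mul]; norm_num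
        have := Real.exp_one_lt_d9
        nlinarith [Real.exp_pos (1 / 2)]
  have hwc : w ∈ closedBall w (w.re / 2) := mem_closedBall_self (by linarith)
  have hvc : v ∈ closedBall w (w.re / 2) := by
    rw [mem_closedBall, dist_eq_norm]; linarith
  refine ⟨?_, ?_, ?_⟩
  · refine (norm_deriv_le_exp_mul_of_injOn hd hi hwc hvc hw).trans ?_
    exact mul_le_mul_of_nonneg_right (he _ hv) (norm_nonneg _)
  · refine (norm_deriv_le_exp_mul_of_injOn hd hi hvc hwc hw).trans ?_
    rw [norm_sub_rev]
    exact mul_le_mul_of_nonneg_right (he _ hv) (norm_nonneg _)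
  · refine (norm_image_sub_le_of_injOn hd hi hw (r := w.re / 100) (by linarith) hv).trans ?_
    gcongr
    exact he _ le_rfl

end Biholo

open Set Metric Complex in
theorem IsBiholo.deriv_mul_deriv {t φ : ℂ → ℂ} {U V : Set ℂ} (hB : IsBiholo t φ U V) {w : ℂ}
    (hw : w ∈ V) : deriv t (φ w) * deriv φ w = 1 := by
  have h1 := (hB.diff_inv.differentiableAt (hB.isOpen_target.mem_nhds hw)).hasDerivAt
  have h2 := (hB.diff.differentiableAt (hB.isOpen_source.mem_nhds (hB.mapsTo_inv w hw))).hasDerivAt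
  have h3 := h2.comp w h1
  have h4 : (t ∘ φ) =ᶠ[𝓝 w] id := by
    filter_upwards [hB.isOpen_target.mem_nhds hw] with v hv using hB.right_inv v hv
  exact (h3.congr_of_eventuallyEq h4.symm).unique (hasDerivAt_id w)

-- The heights `v + 2πk` with `k` in one residue class modulo `L` have spacing `2πL`, so the nearest
-- one is within half of that.
open Set Metric Complex in
theorem exists_int_abs_le (y v : ℝ) (L : ℕ) (hL : 0 < L) (j : ℤ) :
    ∃ k : ℤ, k % L = j % L ∧ |v + 2 * Real.pi * k - y| ≤ Real.pi * L := by
  have hpi := Real.pi_pos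
  have hL' : (0:ℝ) < L := by exact_mod_cast hL
  set s := (y - v - 2 * Real.pi * j) / (2 * Real.pi * L) with hs
  refine ⟨j + L * round s, by simp, ?_⟩
  have h1 := abs_sub_round s
  have h2 : v + 2 * Real.pi * ((j + L * round s : ℤ) : ℝ) - y = -(s - round s) * (2 * Real.pi * L) := by
    rw [hs]; push_cast; field_simp; ring
  rw [h2, abs_mul, abs_neg, abs_of_pos (by positivity : 0 < 2 * Real.pi * L)]
  nlinarith [mul_le_mul_of_nonneg_right h1 (by positivity : 0 ≤ 2 * Real.pi * (L:ℝ))]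

/-! ### Lower bounds for the transfer operator -/

/-- The data of a dyadic tract with a boundary set of positive dimension that is uniformly
accessible from the tract. -/
structure AccessibleTract (τ φ : ℂ → ℂ) (Ω E : Set ℂ) (a b Θ H r R u c : ℝ) : Prop where
  biholo : IsBiholo τ φ Ω rightHalfPlane
  zero_notMem : (0 : ℂ) ∉ Ω
  one_lt : 1 < a
  zpow_mem : ∀ (n : ℤ) (z : ℂ), z ∈ Ω → (2 : ℂ) ^ n * z ∈ Ω
  affine : ∀ z ∈ Ω, ∀ n : ℤ, (τ ((2 : ℂ) ^ n * z)).re = a ^ n * (τ z).re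
  norm_lt : ∀ ρ : ℝ, ∃ M : ℝ, ∀ z ∈ Ω, ‖z‖ < ρ → ‖τ z‖ < M
  dim_pos : 0 < Θ
  one_le_H : 1 ≤ H
  r_pos : 0 < r
  r_le : r ≤ R
  u_pos : 0 < u
  c_pos : 0 < c
  access : ∀ p ∈ E, p ∉ Ω ∧ ∀ x : ℝ, 0 < x → x ≤ u → ∃ q ∈ Ω, (τ q).re = x ∧ r ≤ ‖q‖ ∧ ‖q‖ ≤ R ∧
    Metric.ball q (‖q - p‖ / H) ⊆ Ω
  content : ∀ (S : Finset ℤ) (z : ℤ → ℂ) (ρ : ℤ → ℝ), (∀ k ∈ S, 0 ≤ ρ k) →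
    (∀ p ∈ E, ∃ k ∈ S, ‖z k - p‖ ≤ ρ k) → c ≤ ∑ k ∈ S, (2 * ρ k) ^ Θ
  nonempty : E.Nonempty
  small : ∀ κ : ℝ, 0 < κ → ∃ u' : ℝ, 0 < u' ∧ ∀ q ∈ Ω, ‖q‖ ≤ R → Metric.ball q κ ⊆ Ω → u' ≤ (τ q).re

section AccessibleTract

variable {τ φ : ℂ → ℂ} {Ω E : Set ℂ} {a b Θ H r R u c : ℝ}

open Set Metric Complex in
theorem AccessibleTract.norm_two_zpow_mul (n : ℤ) (z : ℂ) : ‖(2:ℂ) ^ n * z‖ = 2 ^ n * ‖z‖ := by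
  rw [norm_mul, norm_zpow, Complex.norm_ofNat]

open Set Metric Complex in
/-- Access from scale `2 ^ n`. -/
theorem AccessibleTract.access_scaled (hA : AccessibleTract τ φ Ω E a b Θ H r R u c) {p : ℂ}
    (hp : p ∈ E) (n : ℤ) {x : ℝ} (hx : 0 < x) (hxu : x ≤ u * a ^ n) :
    ∃ q ∈ Ω, (τ q).re = x ∧ 2 ^ n * r ≤ ‖q‖ ∧ ‖q‖ ≤ 2 ^ n * R ∧ q ≠ 2 ^ n * p ∧
      ball q (‖q - 2 ^ n * p‖ / H) ⊆ Ω ∧ ∀ κ u' : ℝ,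
        (∀ q ∈ Ω, ‖q‖ ≤ R → ball q κ ⊆ Ω → u' ≤ (τ q).re) → x < u' * a ^ n →
        ‖q - 2 ^ n * p‖ ≤ κ * H * 2 ^ n := by
  have hH : 0 < H := zero_lt_one.trans_le hA.one_le_H
  have ha : 0 < a := zero_lt_one.trans hA.one_lt
  have han : 0 < a ^ n := zpow_pos ha n
  have h2n : (0:ℝ) < 2 ^ n := by positivity
  obtain ⟨hpΩ, hacc⟩ := hA.access p hp
  obtain ⟨q, hq, hqx, hqr, hqR, hball⟩ := hacc (x / a ^ n) (by positivity) (by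
    rwa [div_le_iff₀ han])
  have h2C : (2:ℂ) ^ n ≠ 0 := zpow_ne_zero _ two_ne_zero
  refine ⟨2 ^ n * q, hA.zpow_mem n q hq, ?_, ?_, ?_, ?_, ?_, ?_⟩
  · rw [hA.affine q hq, hqx]; field_simp
  · rw [norm_two_zpow_mul]; gcongr
  · rw [norm_two_zpow_mul]; gcongr
  · intro h1
    exact hpΩ (mul_left_cancel₀ h2C h1 ▸ hq)
  · intro y hy
    have h1 : (2:ℂ) ^ n * ((2:ℂ) ^ (-n) * y) = y := by
      rw [← mul_assoc, ← zpow_add₀ two_ne_zero]; simp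
    rw [← h1]
    refine hA.zpow_mem n _ (hball ?_)
    rw [← mul_sub, norm_two_zpow_mul, mem_ball, dist_eq_norm, ← h1, ← mul_sub, norm_two_zpow_mul,
      mul_div_assoc] at hy
    rw [mem_ball, dist_eq_norm]
    exact lt_of_mul_lt_mul_left hy h2n.le
  · intro κ u' hκ hxu'
    rw [← mul_sub, norm_two_zpow_mul, mul_comm, mul_le_mul_iff_left₀ h2n]
    by_contra hlt
    push Not at hlt
    have h1 := hκ q hq hqR ((ball_subset_ball ((le_div_iff₀ hH).2 hlt.le)).trans hball)
    rw [hqx, le_div_iff₀ han] at h1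
    linarith

-- `τ` is bounded on bounded parts of `Ω`, so only finitely many heights on the line qualify. Thus
-- the sums over annuli are finite.
open Set Metric Complex in
theorem AccessibleTract.finite_norm_le (hA : AccessibleTract τ φ Ω E a b Θ H r R u c) (ρ : ℝ) {w : ℂ}
    (hw : 0 < w.re) : {k : ℤ | ‖φ (w + 2 * Real.pi * k * I)‖ ≤ ρ}.Finite := by
  obtain ⟨M, hM⟩ := hA.norm_lt (ρ + 1)
  have hpi := Real.pi_pos
  refine (Set.finite_Icc (⌊(-M - w.im) / (2 * Real.pi)⌋) (⌈(M - w.im) / (2 * Real.pi)⌉)).subset ?_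
  intro k hk
  have hwk : w + 2 * Real.pi * k * I ∈ rightHalfPlane := by
    show 0 < (w + 2 * Real.pi * k * I).re
    simpa using hw
  have h1 := hM _ (hA.biholo.mapsTo_inv _ hwk) (lt_of_le_of_lt hk (by linarith))
  rw [hA.biholo.right_inv _ hwk] at h1
  have h2 := (abs_im_le_norm _).trans_lt h1
  have h3 : (w + 2 * Real.pi * k * I).im = w.im + 2 * Real.pi * k := by simp
  rw [h3, abs_lt] at h2
  constructor
  · refine (Int.cast_le (R := ℝ)).1 ((Int.floor_le _).trans ?_)
    rw [div_le_iff₀ (by positivity)]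
    linarith
  · refine (Int.cast_le (R := ℝ)).1 (le_trans ?_ (Int.le_ceil _))
    rw [le_div_iff₀ (by positivity)]
    linarith

open Set Metric Complex in
/-- The contribution of the annulus of size `2 ^ n` to the transfer operator. -/
theorem AccessibleTract.exists_row_sum (hA : AccessibleTract τ φ Ω E a b Θ H r R u c) :
    ∃ κ : ℝ, 0 < κ ∧ ∀ (n : ℤ) (w : ℂ), 400 ≤ w.re → w.re ≤ u * a ^ n → ∃ S : Finset ℤ,
      (∀ k ∈ S, 2 ^ n * (r / 2) ≤ ‖φ (w + 2 * Real.pi * k * I)‖ ∧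
        ‖φ (w + 2 * Real.pi * k * I)‖ ≤ 2 ^ n * (2 * R)) ∧
      κ * w.re ≤ w.re ^ Θ * ∑ k ∈ S, (‖deriv φ (w + 2 * Real.pi * k * I)‖ /
        ‖φ (w + 2 * Real.pi * k * I)‖) ^ Θ := by
  have hR : 0 < R := hA.r_pos.trans_le hA.r_le
  have hr := hA.r_pos
  have hH : 0 < H := zero_lt_one.trans_le hA.one_le_H
  have hc := hA.c_pos
  have hΘ := hA.dim_pos
  refine ⟨c / 800 / (20 * H * R) ^ Θ, by positivity, fun n w hw hwu => ?_⟩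
  set x := w.re with hx
  have hx0 : 0 < x := by linarith
  have h2n : (0:ℝ) < 2 ^ n := by positivity
  set W : ℤ → ℂ := fun k => w + 2 * Real.pi * k * I with hW
  have hWre : ∀ k, (W k).re = x := by intro k; simp [hW, hx]
  have hWim : ∀ k, (W k).im = w.im + 2 * Real.pi * k := by intro k; simp [hW]
  have hWH : ∀ k, W k ∈ rightHalfPlane := by
    intro k
    show 0 < (W k).re
    rw [hWre]; exact hx0
  have hφ0 : ∀ k, 0 < ‖φ (W k)‖ := fun k => norm_pos_iff.2 fun h0 =>
    hA.zero_notMem (h0 ▸ hA.biholo.mapsTo_inv _ (hWH k))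
  set S : Finset ℤ := ((hA.finite_norm_le (2 ^ n * (2 * R)) hx0).inter_of_left
    {k : ℤ | 2 ^ n * (r / 2) ≤ ‖φ (W k)‖}).toFinset with hS
  have hSmem : ∀ k, k ∈ S ↔ ‖φ (W k)‖ ≤ 2 ^ n * (2 * R) ∧ 2 ^ n * (r / 2) ≤ ‖φ (W k)‖ := by
    intro k; rw [hS, Set.Finite.mem_toFinset]; rfl
  refine ⟨S, fun k hk => ⟨((hSmem k).1 hk).2, ((hSmem k).1 hk).1⟩, ?_⟩
  -- Since `πL ≤ x / 100`, every point of the line `Re = x` is within the distortion radius of a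
  -- point `W k` from any given residue class modulo `L`.
  set L : ℕ := ⌊x / 400⌋₊ with hL
  have hL1 : 1 ≤ L := by
    rw [hL, Nat.one_le_floor_iff, le_div_iff₀ (by norm_num)]; linarith
  have hL2 : (L:ℝ) ≤ x / 400 := Nat.floor_le (by positivity)
  have hL3 : x / 800 ≤ L := by
    have h1 := Nat.lt_floor_add_one (x / 400)
    rw [← hL] at h1
    have h2 : (1:ℝ) ≤ L := by exact_mod_cast hL1
    linarith
  -- every residue class modulo `L` gives a cover of `E`
  have hcover : ∀ j : ℤ, ∀ p ∈ E, ∃ k ∈ S.filter (fun k => k % L = j % L),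
      ‖(2:ℂ) ^ (-n) * φ (W k) - p‖ ≤ 5 * H * x * 2 ^ (-n) * ‖deriv φ (W k)‖ := by
    intro j p hp
    obtain ⟨Z, hZ, hZx, hZr, hZR, hZp, hball, -⟩ := hA.access_scaled hp n hx0 hwu
    obtain ⟨k, hkj, hk⟩ := exists_int_abs_le (τ Z).im w.im L hL1 j
    have hv : ‖τ Z - W k‖ ≤ (W k).re / 100 := by
      refine (norm_le_abs_re_add_abs_im _).trans ?_
      rw [sub_re, sub_im, hWre, hWim, hZx, sub_self, abs_zero, zero_add, abs_sub_comm]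
      refine hk.trans ?_
      have := Real.pi_lt_four
      nlinarith
    obtain ⟨hd1, -, hd3⟩ := hA.biholo.norm_deriv_le hv (by rw [hWre]; exact hx0)
    have hd4 := hA.biholo.norm_deriv_mul_re_le (w := W k) (by rw [hWre]; exact hx0) hA.zero_notMem
    rw [sub_zero, hWre] at hd4
    rw [hA.biholo.left_inv Z hZ] at hd3
    rw [hWre] at hv
    have hd5 : ‖Z - φ (W k)‖ ≤ ‖deriv φ (W k)‖ * x / 50 := by
      refine hd3.trans ?_
      nlinarith [norm_nonneg (deriv φ (W k))]
    have hn1 : ‖Z‖ ≤ ‖φ (W k)‖ + ‖Z - φ (W k)‖ := by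
      have := norm_add_le (φ (W k)) (Z - φ (W k)); rwa [add_sub_cancel] at this
    have hn2 : ‖φ (W k)‖ ≤ ‖Z‖ + ‖Z - φ (W k)‖ := by
      have := norm_sub_le Z (Z - φ (W k)); rwa [sub_sub_cancel] at this
    have hpos := hφ0 k
    refine ⟨k, ?_, ?_⟩
    · rw [Finset.mem_filter, hSmem]
      refine ⟨⟨?_, ?_⟩, hkj⟩ <;> linarith
    · -- distance of `Z` to the boundary
      set d := ‖Z - 2 ^ n * p‖ / H with hd
      have hd0 : 0 < d := div_pos (norm_pos_iff.2 (sub_ne_zero.2 hZp)) hH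
      have h1 := mul_norm_deriv_le_two_mul_re hd0 (hA.biholo.diff.mono hball)
        (fun z hz => hA.biholo.mapsTo z (hball hz))
      rw [hZx] at h1
      have hvH := hA.biholo.mapsTo Z hZ
      have h2 := congrArg norm (hA.biholo.deriv_mul_deriv hvH)
      rw [hA.biholo.left_inv Z hZ, norm_mul, norm_one] at h2
      have h3 : d ≤ 2 * x * ‖deriv φ (τ Z)‖ := by
        calc d = d * (‖deriv τ Z‖ * ‖deriv φ (τ Z)‖) := by rw [h2, mul_one]
          _ = d * ‖deriv τ Z‖ * ‖deriv φ (τ Z)‖ := by ring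
          _ ≤ _ := by gcongr
      have h4 : ‖Z - 2 ^ n * p‖ ≤ 4 * H * x * ‖deriv φ (W k)‖ := by
        have h5 : ‖Z - 2 ^ n * p‖ = d * H := by rw [hd]; field_simp
        rw [h5]
        calc d * H ≤ (2 * x * (2 * ‖deriv φ (W k)‖)) * H := by
              gcongr; exact h3.trans (by gcongr)
          _ = _ := by ring
      have h6 : (2:ℂ) ^ (-n) * φ (W k) - p = (2:ℂ) ^ (-n) * (φ (W k) - 2 ^ n * p) := by
        rw [mul_sub, ← mul_assoc ((2:ℂ) ^ (-n)) ((2:ℂ) ^ n), ← zpow_add₀ two_ne_zero]; simp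
      rw [h6, norm_two_zpow_mul]
      have h7 : ‖φ (W k) - 2 ^ n * p‖ ≤ 5 * H * x * ‖deriv φ (W k)‖ := by
        have h8 : φ (W k) - 2 ^ n * p = (Z - 2 ^ n * p) - (Z - φ (W k)) := by ring
        rw [h8]
        refine (norm_sub_le _ _).trans ?_
        have h9 : 0 ≤ x * ‖deriv φ (W k)‖ := by positivity
        nlinarith [hA.one_le_H]
      calc (2:ℝ) ^ (-n) * ‖φ (W k) - 2 ^ n * p‖ ≤ 2 ^ (-n) * (5 * H * x * ‖deriv φ (W k)‖) := by
            gcongr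
        _ = _ := by ring
  -- The content bound for one covering family; `2 ^ (-n)` is exchanged for `2R / |φ|` by means of
  -- the size of the annulus.
  have hclass : ∀ j : ℤ, c ≤ (20 * H * R * x) ^ Θ * ∑ k ∈ S.filter (fun k => k % L = j % L),
      (‖deriv φ (W k)‖ / ‖φ (W k)‖) ^ Θ := by
    intro j
    refine (hA.content _ _ _ (fun k _ => by positivity) (hcover j)).trans ?_
    rw [Finset.mul_sum]
    refine Finset.sum_le_sum fun k hk => ?_
    rw [← Real.mul_rpow (by positivity) (by positivity)]
    refine Real.rpow_le_rpow (by positivity) ?_ hΘ.le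
    have hk1 := ((hSmem k).1 (Finset.mem_filter.1 hk).1).1
    have hk2 : (2:ℝ) ^ (-n) ≤ 2 * R / ‖φ (W k)‖ := by
      rw [zpow_neg, le_div_iff₀ (hφ0 k), ← div_eq_inv_mul, div_le_iff₀ h2n]; linarith
    calc 2 * (5 * H * x * 2 ^ (-n) * ‖deriv φ (W k)‖)
        ≤ 2 * (5 * H * x * (2 * R / ‖φ (W k)‖) * ‖deriv φ (W k)‖) := by gcongr
      _ = _ := by ring
  -- The `L` residue classes are disjoint and each contributes `c`; this is where the factor `x` is
  -- gained.
  have hsum : (L:ℝ) * c ≤ (20 * H * R * x) ^ Θ * ∑ k ∈ S, (‖deriv φ (W k)‖ / ‖φ (W k)‖) ^ Θ := by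
    have hmap : ∀ k ∈ S, (k % (L:ℤ)).toNat ∈ Finset.range L := by
      intro k _
      have h1 : 0 ≤ k % (L:ℤ) := Int.emod_nonneg _ (by omega)
      have h2 : k % (L:ℤ) < L := Int.emod_lt_of_pos _ (by omega)
      rw [Finset.mem_range]; omega
    rw [← Finset.sum_fiberwise_of_maps_to hmap, Finset.mul_sum]
    have : (L:ℝ) * c = ∑ _j ∈ Finset.range L, c := by simp
    rw [this]
    refine Finset.sum_le_sum fun j hj => ?_
    have h3 : S.filter (fun k : ℤ => (k % (L:ℤ)).toNat = j) = S.filter (fun k : ℤ => k % L = (j:ℤ) % L) := by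
      refine Finset.filter_congr fun k _ => ?_
      have h1 : 0 ≤ k % (L:ℤ) := Int.emod_nonneg _ (by omega)
      have hj' := Finset.mem_range.1 hj
      rw [Int.emod_eq_of_lt (a := (j:ℤ)) (by omega) (by omega)]
      omega
    rw [h3]
    exact hclass j
  have hfin : c / 800 * x ≤ (20 * H * R) ^ Θ * (x ^ Θ *
      ∑ k ∈ S, (‖deriv φ (W k)‖ / ‖φ (W k)‖) ^ Θ) := by
    rw [Real.mul_rpow (by positivity) hx0.le, mul_assoc] at hsum
    refine le_trans ?_ hsum
    nlinarith
  have hpos : 0 < (20 * H * R) ^ Θ := by positivity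
  rw [div_mul_eq_mul_div, div_le_iff₀ hpos]
  linarith

end AccessibleTract

section AccessibleTract

variable {τ φ : ℂ → ℂ} {Ω E : Set ℂ} {a b Θ H r R u c : ℝ}

open Set Metric Complex in
/-- Summing the contributions of a block of well separated annuli makes the transfer operator
expanding. -/
theorem AccessibleTract.exists_block_sum (hA : AccessibleTract τ φ Ω E a b Θ H r R u c) (hlt : Θ < 2) :
    ∃ n₁ : ℕ, 1 ≤ n₁ ∧ ∀ᶠ J : ℕ in atTop, ∀ w : ℂ, 200 * ((n₁ * J : ℕ) : ℝ) ≤ w.re →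
      w.re ≤ 300 * ((n₁ * J : ℕ) : ℝ) → ∃ S : Finset ℤ,
      (∀ k ∈ S, 400 * ((n₁ * J : ℕ) : ℝ) * Real.log 2 + Real.log (r / 2) ≤
          Real.log ‖φ (w + 2 * Real.pi * k * I)‖ ∧ Real.log ‖φ (w + 2 * Real.pi * k * I)‖ ≤
          401 * ((n₁ * J : ℕ) : ℝ) * Real.log 2 + Real.log (2 * R)) ∧
      2 ≤ ∑ k ∈ S, (‖deriv φ (w + 2 * Real.pi * k * I)‖ / ‖φ (w + 2 * Real.pi * k * I)‖) ^ Θ := by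
  obtain ⟨κ, hκ, hrow⟩ := hA.exists_row_sum
  have hr := hA.r_pos
  have hR : 0 < R := hr.trans_le hA.r_le
  have hΘ := hA.dim_pos
  have hu := hA.u_pos
  have ha : 0 < a := zero_lt_one.trans hA.one_lt
  -- Scales whose exponents differ by at least `n₁` give disjoint annuli `2 ^ n (r / 2) ≤ |z| ≤ 2 ^
  -- n (2R)`, so their letters are distinct.
  obtain ⟨n₁, hn₁⟩ := pow_unbounded_of_one_lt (4 * R / r) (one_lt_two (α := ℝ))
  rw [div_lt_iff₀ hr] at hn₁
  have hn₁1 : 1 ≤ n₁ := by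
    rcases Nat.eq_zero_or_pos n₁ with h0 | h0
    · rw [h0, pow_zero] at hn₁; linarith [hA.r_le]
    · exact h0
  refine ⟨n₁, hn₁1, ?_⟩
  have hn₁0 : (0:ℝ) < n₁ := by exact_mod_cast hn₁1
  have hMtend : Tendsto (fun J : ℕ => n₁ * J) atTop atTop :=
    tendsto_id.const_mul_atTop' (by omega)
  have hMtend' : Tendsto (fun J : ℕ => ((n₁ * J : ℕ) : ℝ)) atTop atTop :=
    tendsto_natCast_atTop_atTop.comp hMtend
  have hgrow : ∀ᶠ M : ℕ in atTop, 300 * (M:ℝ) ≤ u * a ^ M := by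
    have h1 := tendsto_pow_const_div_const_pow_of_one_lt 1 hA.one_lt
    filter_upwards [h1.eventually_lt_const (by positivity : 0 < u / 300)] with M hM
    rw [pow_one, div_lt_iff₀ (by positivity)] at hM
    linarith
  -- With `M = n₁ J` there are `M / n₁` annuli, each contributing at least `200 κ M / (300 M) ^ Θ`.
  -- The total is unbounded exactly because `Θ < 2`.
  have hbig : Tendsto (fun J : ℕ => κ * 200 / (n₁ * 300 ^ Θ) * ((n₁ * J : ℕ) : ℝ) ^ (2 - Θ))
      atTop atTop :=
    ((tendsto_rpow_atTop (by linarith)).comp hMtend').const_mul_atTop (by positivity)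
  filter_upwards [hMtend.eventually hgrow, hbig.eventually_ge_atTop 2, eventually_ge_atTop 2]
    with J hJ1 hJ2 hJ3 w hw1 hw2
  set M : ℕ := n₁ * J with hM
  have hM2 : 2 ≤ M := by rw [hM]; nlinarith
  have hM2' : (2:ℝ) ≤ M := by exact_mod_cast hM2
  have hM0 : (0:ℝ) < M := by linarith
  -- These exponents lie in `[400M, 401M]`, and since `log 2 ≈ 0.693` the new real parts are between
  -- `277M` and `279M` up to constants: inside the range `[200M, 300M]` from which the step starts.
  -- The requirement `x ≤ u a ^ n` is met because `a ^ M` outgrows `300M`.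
  set n : ℕ → ℤ := fun j => ((400 * M + n₁ * j : ℕ) : ℤ) with hn
  have hwu : ∀ j, w.re ≤ u * a ^ (n j) := by
    intro j
    refine hw2.trans (hJ1.trans ?_)
    rw [hn, zpow_natCast]
    gcongr
    · exact hA.one_lt.le
    · nlinarith
  choose S hS1 hS2 using fun j => hrow (n j) w (by linarith) (hwu j)
  have hx0 : 0 < w.re := by linarith
  have hφ0 : ∀ k : ℤ, 0 < ‖φ (w + 2 * Real.pi * k * I)‖ := fun k => norm_pos_iff.2 fun h0 =>
    hA.zero_notMem (h0 ▸ hA.biholo.mapsTo_inv _ (by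
      show 0 < (w + 2 * Real.pi * k * I).re
      simpa using hx0))
  have hdisj : ((Finset.range J : Finset ℕ) : Set ℕ).PairwiseDisjoint S := by
    have key : ∀ i j, i < j → Disjoint (S i) (S j) := by
      intro i j hij
      rw [Finset.disjoint_left]
      intro k hki hkj
      have h1 := (hS1 i k hki).2
      have h2 := (hS1 j k hkj).1
      have h3 : (2:ℝ) ^ n i * 2 ^ n₁ ≤ 2 ^ n j := by
        rw [hn, zpow_natCast, zpow_natCast, ← pow_add]
        exact pow_le_pow_right₀ one_le_two (by nlinarith)
      have h4 : (0:ℝ) < 2 ^ n i := by positivity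
      nlinarith [mul_lt_mul_of_pos_left hn₁ h4, mul_le_mul_of_nonneg_right h3 hr.le]
    intro i _ j _ hij
    rcases lt_or_gt_of_ne hij with h1 | h1
    · exact key i j h1
    · exact (key j i h1).symm
  refine ⟨(Finset.range J).biUnion S, fun k hk => ?_, ?_⟩
  · obtain ⟨j, hj, hkj⟩ := Finset.mem_biUnion.1 hk
    obtain ⟨h1, h2⟩ := hS1 j k hkj
    have hjJ := Finset.mem_range.1 hj
    have hlog2 := Real.log_pos one_lt_two
    have hnj1 : 400 * (M:ℝ) ≤ (n j : ℝ) := by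
      simp only [hn]; push_cast; nlinarith [(Nat.cast_nonneg j : (0:ℝ) ≤ j)]
    have hnj2 : (n j : ℝ) ≤ 401 * (M:ℝ) := by
      have : n₁ * j ≤ M := Nat.mul_le_mul_left _ hjJ.le
      have h3 : ((n₁ * j : ℕ) : ℝ) ≤ M := by exact_mod_cast this
      simp only [hn]; push_cast at h3 ⊢; linarith
    have h2n : (0:ℝ) < 2 ^ n j := by positivity
    have hl1 := Real.log_le_log (by positivity) h1
    have hl2 := Real.log_le_log (hφ0 k) h2
    rw [Real.log_mul h2n.ne' (by positivity), Real.log_zpow] at hl1 hl2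
    constructor
    · nlinarith
    · nlinarith
  · rw [Finset.sum_biUnion hdisj]
    have hterm : ∀ j ∈ Finset.range J, κ * (200 * M) / (300 * M) ^ Θ ≤
        ∑ k ∈ S j, (‖deriv φ (w + 2 * Real.pi * k * I)‖ / ‖φ (w + 2 * Real.pi * k * I)‖) ^ Θ := by
      intro j _
      have h1 := hS2 j
      have hsum0 : 0 ≤ ∑ k ∈ S j,
          (‖deriv φ (w + 2 * Real.pi * k * I)‖ / ‖φ (w + 2 * Real.pi * k * I)‖) ^ Θ :=
        Finset.sum_nonneg fun k _ => Real.rpow_nonneg (by positivity) _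
      rw [div_le_iff₀ (by positivity)]
      calc κ * (200 * M) ≤ κ * w.re := by gcongr
        _ ≤ _ := h1
        _ ≤ (300 * M) ^ Θ * _ := by
            refine mul_le_mul_of_nonneg_right ?_ hsum0
            exact Real.rpow_le_rpow hx0.le hw2 hΘ.le
        _ = _ := mul_comm _ _
    refine le_trans ?_ (Finset.sum_le_sum hterm)
    rw [Finset.sum_const, Finset.card_range, nsmul_eq_mul]
    refine hJ2.trans (le_of_eq ?_)
    have hJM : (J:ℝ) = M / n₁ := by rw [hM]; push_cast; field_simp
    rw [hJM, Real.mul_rpow (by norm_num) hM0.le, Real.rpow_sub hM0, Real.rpow_two]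
    field_simp

end AccessibleTract

/-! ### Words of inverse branches in logarithmic coordinates -/

section Words

/-- The inverse branches of the exponential model in logarithmic coordinates, where `l` is a
logarithm of the inverse uniformization. -/
noncomputable def logBranch (l : ℂ → ℂ) (k : ℤ) (w : ℂ) : ℂ := l (w + 2 * Real.pi * k * Complex.I)

/-- The composition of inverse branches along a word, the first letter being applied first. -/
noncomputable def runWord (l : ℂ → ℂ) (ks : List ℤ) (w : ℂ) : ℂ :=
  ks.foldl (fun v k => logBranch l k v) w

/-- Words of length `N + 1` whose orbit from `w` stays in the strip `X₁ ≤ Re ≤ X₂` and finally comes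
back close to `w₀`. -/
def IsReturnWord (l : ℂ → ℂ) (X₁ X₂ : ℝ) (w₀ : ℂ) (ε : ℝ) : ℕ → List ℤ → ℂ → Prop
  | 0, ks, w => ∃ k, ks = [k] ∧ ‖logBranch l k w - w₀‖ ≤ ε
  | N + 1, ks, w => ∃ k ks', ks = k :: ks' ∧ X₁ ≤ (logBranch l k w).re ∧ (logBranch l k w).re ≤ X₂ ∧
      IsReturnWord l X₁ X₂ w₀ ε N ks' (logBranch l k w)

@[simp]
theorem runWord_nil (l : ℂ → ℂ) (w : ℂ) : runWord l [] w = w := rfl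

@[simp]
theorem runWord_cons (l : ℂ → ℂ) (k : ℤ) (ks : List ℤ) (w : ℂ) :
    runWord l (k :: ks) w = runWord l ks (logBranch l k w) := rfl

/-- A logarithm of the inverse of a conformal map of a domain omitting `0` onto the half-plane. -/
structure IsLogInverse (t φ l : ℂ → ℂ) (Ω : Set ℂ) : Prop where
  biholo : IsBiholo t φ Ω rightHalfPlane
  zero_notMem : (0 : ℂ) ∉ Ω
  diff : DifferentiableOn ℂ l rightHalfPlane
  exp_eq : ∀ w ∈ rightHalfPlane, Complex.exp (l w) = φ w

variable {t φ l : ℂ → ℂ} {Ω : Set ℂ}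

open Set Metric Complex in
theorem IsLogInverse.deriv_eq (hl : IsLogInverse t φ l Ω) {w : ℂ} (hw : 0 < w.re) :
    ‖deriv l w‖ = ‖deriv φ w‖ / ‖φ w‖ := by
  have hnh : rightHalfPlane ∈ 𝓝 w := isOpen_rightHalfPlane.mem_nhds hw
  have h1 := (hl.diff.differentiableAt hnh).hasDerivAt.cexp
  have h2 : (fun v => exp (l v)) =ᶠ[𝓝 w] φ := by
    filter_upwards [hnh] with v hv using hl.exp_eq v hv
  have h3 := h2.deriv_eq
  rw [h1.deriv, hl.exp_eq w hw] at h3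
  have h4 : φ w ≠ 0 := by rw [← hl.exp_eq w hw]; exact exp_ne_zero _
  rw [← h3, norm_mul, mul_div_cancel_left₀ _ (norm_ne_zero_iff.2 h4)]

-- `φ` omits `0`, so Koebe bounds `|φ'| / |φ|`: the contraction of the branches far to the right, in
-- the manner of Eremenko and Lyubich.
open Set Metric Complex in
theorem IsLogInverse.norm_deriv_mul_re_le (hl : IsLogInverse t φ l Ω) {w : ℂ} (hw : 0 < w.re) :
    ‖deriv l w‖ * w.re ≤ 12 := by
  have h4 : 0 < ‖φ w‖ := by rw [← hl.exp_eq w hw]; exact norm_pos_iff.2 (exp_ne_zero _)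
  have h1 := hl.biholo.norm_deriv_mul_re_le hw hl.zero_notMem
  rw [sub_zero] at h1
  rw [hl.deriv_eq hw, div_mul_eq_mul_div, div_le_iff₀ h4]
  exact h1

theorem logBranch_shift_re (k : ℤ) (w : ℂ) : (w + 2 * Real.pi * k * Complex.I).re = w.re := by simp

theorem IsLogInverse.hasDerivAt_logBranch (hl : IsLogInverse t φ l Ω) (k : ℤ) {w : ℂ}
    (hw : 0 < w.re) :
    HasDerivAt (logBranch l k) (deriv l (w + 2 * Real.pi * k * Complex.I)) w := by
  have h1 : 0 < (w + 2 * Real.pi * k * Complex.I).re := by rwa [logBranch_shift_re]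
  exact (hl.diff.differentiableAt (isOpen_rightHalfPlane.mem_nhds h1)).hasDerivAt.comp_add_const w _

theorem IsLogInverse.exp_logBranch (hl : IsLogInverse t φ l Ω) (k : ℤ) {w : ℂ}
    (hw : 0 < w.re) : Complex.exp (logBranch l k w) = φ (w + 2 * Real.pi * k * Complex.I) :=
  hl.exp_eq _ (by
    show 0 < (w + 2 * Real.pi * k * Complex.I).re
    rwa [logBranch_shift_re])

theorem IsLogInverse.logBranch_re (hl : IsLogInverse t φ l Ω) (k : ℤ) {w : ℂ}
    (hw : 0 < w.re) :
    (logBranch l k w).re = Real.log ‖φ (w + 2 * Real.pi * k * Complex.I)‖ := by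
  rw [← hl.exp_logBranch k hw, Complex.norm_exp, Real.log_exp]

open Set Metric Complex in
/-- Far to the right the inverse branches are strong contractions. -/
theorem IsLogInverse.logBranch_contract (hl : IsLogInverse t φ l Ω) (k : ℤ) {w v : ℂ}
    (hw : 12000 ≤ w.re) (hv : 12000 ≤ v.re) :
    ‖logBranch l k w - logBranch l k v‖ ≤ 1 / 1000 * ‖w - v‖ := by
  refine (convex_halfSpace_re_ge 12000).norm_image_sub_le_of_norm_hasDerivWithin_le
    (f' := fun w => deriv l (w + 2 * Real.pi * k * I)) (fun z hz => ?_) (fun z hz => ?_) hv hw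
  · have hz' : 12000 ≤ z.re := hz
    exact (hl.hasDerivAt_logBranch k (by linarith)).hasDerivWithinAt
  · have hz' : 12000 ≤ z.re := hz
    have h1 := hl.norm_deriv_mul_re_le (w := z + 2 * Real.pi * k * I) (by
      rw [logBranch_shift_re]; linarith)
    rw [logBranch_shift_re] at h1
    have h2 := mul_le_mul_of_nonneg_left hz' (norm_nonneg (deriv l (z + 2 * Real.pi * k * I)))
    linarith

theorem IsReturnWord.length_eq {X₁ X₂ : ℝ} {w₀ : ℂ} {ε : ℝ} {N : ℕ} {ks : List ℤ} {w : ℂ}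
    (h : IsReturnWord l X₁ X₂ w₀ ε N ks w) : ks.length = N + 1 := by
  induction N generalizing ks w with
  | zero => obtain ⟨k, rfl, -⟩ := h; rfl
  | succ N ih => obtain ⟨k, ks', rfl, -, -, h'⟩ := h; simp [ih h']

/-- The orbits of points close to the base point of a return word. -/
theorem IsReturnWord.orbit (hl : IsLogInverse t φ l Ω) {X₁ X₂ : ℝ} {w₀ : ℂ} {ε : ℝ}
    (hX : 12001 ≤ X₁) {N : ℕ} {ks : List ℤ} {w y : ℂ} (h : IsReturnWord l X₁ X₂ w₀ ε N ks w)
    (hw : 12001 ≤ w.re) (hy : ‖y - w‖ ≤ 1) :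
    (∀ i, i ≤ N → 12000 ≤ (runWord l (ks.take i) y).re) ∧
      (∀ i, 1 ≤ i → i ≤ N → (runWord l (ks.take i) y).re ≤ X₂ + 1) ∧
      ‖runWord l ks y - w₀‖ ≤ ε + 1 / 1000 := by
  have hyre : ∀ {y w : ℂ}, ‖y - w‖ ≤ 1 → |y.re - w.re| ≤ 1 := by
    intro y w h1
    have := (Complex.abs_re_le_norm (y - w)).trans h1
    rwa [Complex.sub_re] at this
  have hy12 : 12000 ≤ y.re := by linarith [(abs_le.1 (hyre hy)).1]
  induction N generalizing ks w y with
  | zero =>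
    obtain ⟨k, rfl, hk⟩ := h
    refine ⟨fun i hi => ?_, fun i h1 h2 => by omega, ?_⟩
    · obtain rfl : i = 0 := by omega
      simpa using hy12
    · rw [runWord_cons, runWord_nil]
      have h1 := hl.logBranch_contract k hy12 (by linarith : 12000 ≤ w.re)
      calc ‖logBranch l k y - w₀‖ = ‖(logBranch l k w - w₀) + (logBranch l k y - logBranch l k w)‖ := by
            congr 1; ring
        _ ≤ ε + 1 / 1000 := (norm_add_le _ _).trans (by linarith)
  | succ N ih =>
    obtain ⟨k, ks', rfl, hk1, hk2, h'⟩ := h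
    have h1 := hl.logBranch_contract k hy12 (by linarith : 12000 ≤ w.re)
    have hyk : ‖logBranch l k y - logBranch l k w‖ ≤ 1 := by linarith
    have hyk' := abs_le.1 (hyre hyk)
    obtain ⟨i1, i2, i3⟩ := ih h' (by linarith) hyk (by linarith [hyk'.1])
    refine ⟨fun i hi => ?_, fun i hi1 hi2 => ?_, by simpa using i3⟩
    · rcases i with _ | i
      · simpa using hy12
      · rw [List.take_succ_cons, runWord_cons]
        exact i1 i (by omega)
    · obtain ⟨i, rfl⟩ : ∃ j, i = j + 1 := ⟨i - 1, by omega⟩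
      rw [List.take_succ_cons, runWord_cons]
      rcases Nat.eq_zero_or_pos i with rfl | hi0
      · rw [List.take_zero, runWord_nil]; linarith [hyk'.2]
      · exact i2 i hi0 (by omega)

theorem runWord_differentiableAt (hl : IsLogInverse t φ l Ω) {ks : List ℤ} {y : ℂ}
    (h : ∀ i < ks.length, 0 < (runWord l (ks.take i) y).re) :
    DifferentiableAt ℂ (runWord l ks) y := by
  induction ks generalizing y with
  | nil => exact differentiableAt_id
  | cons k ks ih =>
    have h0 : 0 < y.re := by simpa using h 0 (by simp)
    have h1 : DifferentiableAt ℂ (runWord l ks) (logBranch l k y) :=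
      ih (y := logBranch l k y) fun i hi => by simpa using h (i + 1) (by simpa using hi)
    exact h1.comp y (hl.hasDerivAt_logBranch k h0).differentiableAt

end Words

section Words

variable {t φ l : ℂ → ℂ} {Ω : Set ℂ}

theorem IsReturnWord.differentiableAt (hl : IsLogInverse t φ l Ω) {X₁ X₂ : ℝ} {w₀ : ℂ} {ε : ℝ}
    (hX : 12001 ≤ X₁) {N : ℕ} {ks : List ℤ} {w : ℂ} (h : IsReturnWord l X₁ X₂ w₀ ε N ks w)
    (hw : 12001 ≤ w.re) : DifferentiableAt ℂ (runWord l ks) w := by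
  refine runWord_differentiableAt hl fun i hi => ?_
  rw [h.length_eq] at hi
  have := (h.orbit hl hX hw (y := w) (by simp)).1 i (by omega)
  linarith

theorem IsReturnWord.norm_deriv_cons (hl : IsLogInverse t φ l Ω) {X₁ X₂ : ℝ} {w₀ : ℂ} {ε : ℝ}
    (hX : 12001 ≤ X₁) {N : ℕ} {k : ℤ} {ks : List ℤ} {w : ℂ}
    (h : IsReturnWord l X₁ X₂ w₀ ε N ks (logBranch l k w))
    (hw : 12001 ≤ w.re) (hk : 12001 ≤ (logBranch l k w).re) :
    ‖deriv (runWord l (k :: ks)) w‖ =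
      ‖deriv l (w + 2 * Real.pi * k * Complex.I)‖ * ‖deriv (runWord l ks) (logBranch l k w)‖ := by
  have h1 := (h.differentiableAt hl hX hk).hasDerivAt
  have h2 := hl.hasDerivAt_logBranch k (w := w) (by linarith)
  have h3 := h1.comp w h2
  have h4 : runWord l (k :: ks) = runWord l ks ∘ logBranch l k := rfl
  rw [h4, h3.deriv, norm_mul, mul_comm]

/-- Words with exponentially growing sums of derivatives. -/
theorem exists_return_words (hl : IsLogInverse t φ l Ω) {X₁ X₂ X₃ Θ κ ε : ℝ} {w₀ : ℂ}
    (hX : 12001 ≤ X₁) (hX₃ : X₂ ≤ X₃)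
    (hbase : ∀ w : ℂ, X₁ ≤ w.re → w.re ≤ X₂ → ∃ k : ℤ, ‖logBranch l k w - w₀‖ ≤ ε ∧
      κ ≤ ‖deriv l (w + 2 * Real.pi * k * Complex.I)‖ ^ Θ)
    (hstep : ∀ w : ℂ, X₁ ≤ w.re → w.re ≤ X₃ → ∃ S : Finset ℤ,
      (∀ k ∈ S, X₁ ≤ (logBranch l k w).re ∧ (logBranch l k w).re ≤ X₂) ∧
      2 ≤ ∑ k ∈ S, ‖deriv l (w + 2 * Real.pi * k * Complex.I)‖ ^ Θ) (hκ : 0 ≤ κ) (N : ℕ) {w : ℂ}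
    (hw1 : X₁ ≤ w.re) (hw2 : w.re ≤ X₃) :
    ∃ T : Finset (List ℤ), (∀ ks ∈ T, IsReturnWord l X₁ X₂ w₀ ε (N + 1) ks w) ∧
      κ * 2 ^ (N + 1) ≤ ∑ ks ∈ T, ‖deriv (runWord l ks) w‖ ^ Θ := by
  -- Prepending a letter at least doubles the sum, by the chain rule. The starting point is allowed
  -- up to `X₃`, since words will start at `w₀`, to the right of `X₂`.
  have step : ∀ N : ℕ, (∀ w : ℂ, X₁ ≤ w.re → w.re ≤ X₂ → ∃ T : Finset (List ℤ),
      (∀ ks ∈ T, IsReturnWord l X₁ X₂ w₀ ε N ks w) ∧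
      κ * 2 ^ N ≤ ∑ ks ∈ T, ‖deriv (runWord l ks) w‖ ^ Θ) →
      ∀ w : ℂ, X₁ ≤ w.re → w.re ≤ X₃ → ∃ T : Finset (List ℤ),
      (∀ ks ∈ T, IsReturnWord l X₁ X₂ w₀ ε (N + 1) ks w) ∧
      κ * 2 ^ (N + 1) ≤ ∑ ks ∈ T, ‖deriv (runWord l ks) w‖ ^ Θ := by
    intro N ih w hw1 hw2
    obtain ⟨S, hS1, hS2⟩ := hstep w hw1 hw2
    have hT : ∀ k : ℤ, ∃ T : Finset (List ℤ), k ∈ S →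
        (∀ ks ∈ T, IsReturnWord l X₁ X₂ w₀ ε N ks (logBranch l k w)) ∧
        κ * 2 ^ N ≤ ∑ ks ∈ T, ‖deriv (runWord l ks) (logBranch l k w)‖ ^ Θ := by
      intro k
      by_cases hk : k ∈ S
      · obtain ⟨T, hT⟩ := ih _ (hS1 k hk).1 (hS1 k hk).2
        exact ⟨T, fun _ => hT⟩
      · exact ⟨∅, fun h => absurd h hk⟩
    choose T hT using hT
    have hcons : ∀ k : ℤ, Function.Injective (List.cons k) := fun k => List.cons_injective
    refine ⟨S.biUnion fun k => (T k).map ⟨List.cons k, hcons k⟩, fun ks hks => ?_, ?_⟩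
    · obtain ⟨k, hk, hks⟩ := Finset.mem_biUnion.1 hks
      obtain ⟨ks', hks', rfl⟩ := Finset.mem_map.1 hks
      exact ⟨k, ks', rfl, (hS1 k hk).1, (hS1 k hk).2, (hT k hk).1 ks' hks'⟩
    · rw [Finset.sum_biUnion]
      swap
      · intro i _ j _ hij
        rw [Function.onFun, Finset.disjoint_left]
        intro ks h1 h2
        obtain ⟨ks1, -, rfl⟩ := Finset.mem_map.1 h1
        obtain ⟨ks2, -, h3⟩ := Finset.mem_map.1 h2
        exact hij (List.cons.inj h3).1.symm
      · calc κ * 2 ^ (N + 1) = (κ * 2 ^ N) * 2 := by ring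
          _ ≤ (κ * 2 ^ N) * ∑ k ∈ S, ‖deriv l (w + 2 * Real.pi * k * Complex.I)‖ ^ Θ := by gcongr
          _ = ∑ k ∈ S, ‖deriv l (w + 2 * Real.pi * k * Complex.I)‖ ^ Θ * (κ * 2 ^ N) := by
              rw [Finset.mul_sum]; exact Finset.sum_congr rfl fun k _ => mul_comm _ _
          _ ≤ _ := by
            refine Finset.sum_le_sum fun k hk => ?_
            rw [Finset.sum_map]
            refine (mul_le_mul_of_nonneg_left (hT k hk).2 (Real.rpow_nonneg (norm_nonneg _) _)).trans ?_
            rw [Finset.mul_sum]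
            refine Finset.sum_le_sum fun ks hks => ?_
            have h1 := ((hT k hk).1 ks hks).norm_deriv_cons hl hX (by linarith)
              (by linarith [(hS1 k hk).1])
            show _ ≤ ‖deriv (runWord l (k :: ks)) w‖ ^ Θ
            rw [h1, Real.mul_rpow (norm_nonneg _) (norm_nonneg _)]
  -- The induction runs over starting points up to `X₂`; only the outermost letter uses the larger
  -- range.
  refine step N ?_ w hw1 hw2
  induction N with
  | zero =>
    intro w hw1 hw2
    obtain ⟨k, hk1, hk2⟩ := hbase w hw1 hw2
    refine ⟨{[k]}, fun ks hks => ⟨k, Finset.mem_singleton.1 hks, hk1⟩, ?_⟩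
    have h1 : runWord l [k] = logBranch l k := rfl
    rw [Finset.sum_singleton, h1, (hl.hasDerivAt_logBranch k (by linarith)).deriv]
    simpa using hk2
  | succ N ih => exact fun w hw1 hw2 => step N ih w hw1 (hw2.trans hX₃)

open Set Metric Complex in
/-- If `φ` varies slowly at `v` then the logarithm is almost constant near `v`. -/
theorem IsLogInverse.near_of_slow (hl : IsLogInverse t φ l Ω) {v z : ℂ} (hv : 0 < v.re)
    (hsm : ‖deriv φ v‖ * v.re ≤ ‖φ v‖ / 100) (hz : ‖z - v‖ ≤ v.re / 100) :
    ‖deriv φ v‖ / 2 / (2 * ‖φ v‖) ≤ ‖deriv l z‖ ∧ ‖l z - l v‖ ≤ 1 / 1000 := by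
  have hq0 : 0 < ‖φ v‖ := by rw [← hl.exp_eq v hv]; exact norm_pos_iff.2 (exp_ne_zero _)
  have hnear : ∀ z : ℂ, ‖z - v‖ ≤ v.re / 100 → ‖deriv φ v‖ / 2 / (2 * ‖φ v‖) ≤ ‖deriv l z‖ ∧
      ‖deriv l z‖ ≤ 4 * (‖deriv φ v‖ / ‖φ v‖) := by
    intro z hz
    obtain ⟨h1, h2, h3⟩ := hl.biholo.norm_deriv_le hz hv
    have hzre : 0 < z.re := by
      have h4 := (abs_re_le_norm (z - v)).trans hz
      rw [sub_re, abs_le] at h4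
      linarith
    have h5 : ‖φ z - φ v‖ ≤ ‖φ v‖ / 2 := by
      refine h3.trans ?_
      have : 2 * ‖deriv φ v‖ * ‖z - v‖ ≤ 2 * ‖deriv φ v‖ * (v.re / 100) := by gcongr
      linarith
    have h6 : ‖φ v‖ ≤ ‖φ z‖ + ‖φ z - φ v‖ := by
      have := norm_sub_le (φ z) (φ z - φ v); rwa [sub_sub_cancel] at this
    have h7 : ‖φ z‖ ≤ ‖φ v‖ + ‖φ z - φ v‖ := by
      have := norm_add_le (φ v) (φ z - φ v); rwa [add_sub_cancel] at this
    have h8 : 0 < ‖φ z‖ := by linarith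
    rw [hl.deriv_eq hzre]
    constructor
    · exact div_le_div₀ (norm_nonneg _) (by linarith) h8 (by linarith)
    · rw [← mul_div_assoc, div_le_div_iff₀ h8 hq0]
      nlinarith [norm_nonneg (deriv φ v), norm_nonneg (deriv φ z)]
  refine ⟨(hnear z hz).1, ?_⟩
  have hsub : closedBall v (v.re / 100) ⊆ rightHalfPlane :=
    (closedBall_subset_ball (by linarith)).trans (ball_subset_rightHalfPlane v)
  have h2 := (convex_closedBall v (v.re / 100)).norm_image_sub_le_of_norm_deriv_le
    (𝕜 := ℂ) (f := l) (C := 4 * (‖deriv φ v‖ / ‖φ v‖)) (x := v) (y := z)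
    (fun z hz => hl.diff.differentiableAt (isOpen_rightHalfPlane.mem_nhds (hsub hz)))
    (fun z hz => (hnear z (by rwa [mem_closedBall, dist_eq_norm] at hz)).2)
    (mem_closedBall_self (by positivity)) (by rwa [mem_closedBall, dist_eq_norm])
  refine h2.trans ?_
  calc 4 * (‖deriv φ v‖ / ‖φ v‖) * ‖z - v‖
      ≤ 4 * (‖deriv φ v‖ / ‖φ v‖) * (v.re / 100) := by gcongr
    _ = 4 / 100 * (‖deriv φ v‖ * v.re) / ‖φ v‖ := by ring
    _ ≤ 4 / 100 * (‖φ v‖ / 100) / ‖φ v‖ := by gcongr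
    _ = 4 / 10000 := by field_simp; norm_num
    _ ≤ _ := by norm_num

end Words

section AccessibleTract

variable {τ φ l : ℂ → ℂ} {Ω E : Set ℂ} {a b Θ H r R u c : ℝ}

open Set Metric Complex in
/-- A finite family of inverse branches, all defined near a point `w₀` and returning close to it, with
a large sum of derivatives. -/
theorem AccessibleTract.exists_words (hA : AccessibleTract τ φ Ω E a b Θ H r R u c) (hlt : Θ < 2)
    (hl : IsLogInverse τ φ l Ω) (A : ℝ) :
    ∃ (w₀ : ℂ) (N : ℕ) (T : Finset (List ℤ)), 12001 ≤ w₀.re ∧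
      (∀ ks ∈ T, ks.length = N + 1 ∧ ∀ y : ℂ, ‖y - w₀‖ ≤ 1 →
        (∀ i, i ≤ N → 12000 ≤ (runWord l (ks.take i) y).re) ∧
        (∀ i, 1 ≤ i → i ≤ N → (runWord l (ks.take i) y).re ≤ w₀.re - 1) ∧
        ‖runWord l ks y - w₀‖ ≤ 1 / 500) ∧
      A < ∑ ks ∈ T, ‖deriv (runWord l ks) w₀‖ ^ Θ := by
  have hr := hA.r_pos
  have hR : 0 < R := hr.trans_le hA.r_le
  have hH : 0 < H := zero_lt_one.trans_le hA.one_le_H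
  have ha : 0 < a := zero_lt_one.trans hA.one_lt
  have hpi := Real.pi_pos
  have hlog1 := Real.log_two_gt_d9
  have hlog2 := Real.log_two_lt_d9
  obtain ⟨n₁, hn₁, hblock⟩ := hA.exists_block_sum hlt
  obtain ⟨p, hp⟩ := hA.nonempty
  have hpΩ := (hA.access p hp).1
  -- With Koebe's constant `12`, a boundary distance of at most `κ₀ H 2 ^ n` gives `|φ'| Re v ≤ 2 ^
  -- n r / 100 ≤ |q| / 100`, the slowness needed at the return point.
  set κ₀ := r / (1200 * H) with hκ₀
  have hκ₀0 : 0 < κ₀ := by positivity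
  obtain ⟨u', hu', hsmall⟩ := hA.small κ₀ hκ₀0
  -- `C` extra doublings place `w₀` at least `2` to the right of the strip in which the words run.
  obtain ⟨C, hC⟩ := exists_nat_ge ((Real.log (2 * R) - Real.log r + 2) / Real.log 2)
  rw [div_le_iff₀ (by linarith)] at hC
  set K := |Real.log (r / 2)| + |Real.log (2 * R)| + |Real.log R| + C + 13000 with hK
  have hMtend : Tendsto (fun J : ℕ => n₁ * J) atTop atTop :=
    tendsto_id.const_mul_atTop' (by omega)
  have hgrow : ∀ u : ℝ, 0 < u → ∀ᶠ M : ℕ in atTop, 300 * (M:ℝ) < u * a ^ M := by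
    intro u hu
    have h1 := tendsto_pow_const_div_const_pow_of_one_lt 1 hA.one_lt
    filter_upwards [h1.eventually_lt_const (by positivity : 0 < u / 300)] with M hM
    rw [pow_one, div_lt_iff₀ (by positivity)] at hM
    linarith
  obtain ⟨J, hJ1, hJ2, hJ3, hJ4⟩ := (hblock.and ((hMtend.eventually (hgrow u hA.u_pos)).and
    ((hMtend.eventually (hgrow u' hu')).and
    ((tendsto_natCast_atTop_atTop.comp hMtend).eventually_ge_atTop K)))).exists
  set M : ℕ := n₁ * J with hM
  have hMK : K ≤ (M:ℝ) := hJ4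
  have ha1 := abs_nonneg (Real.log (r / 2))
  have ha2 := abs_nonneg (Real.log (2 * R))
  have ha3 := abs_nonneg (Real.log R)
  have hC0 : (0:ℝ) ≤ C := Nat.cast_nonneg C
  have hM0 : 13000 ≤ (M:ℝ) := by linarith
  set X₁ := 400 * (M:ℝ) * Real.log 2 + Real.log (r / 2) with hX₁
  set X₂ := 401 * (M:ℝ) * Real.log 2 + Real.log (2 * R) with hX₂
  -- The strip `X₁ ≤ Re ≤ X₂` has width about `x / 400`, so all of it is within `x / 100` of the
  -- line `Re = x`, with room left for the vertical error `π`.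
  set x := 400 * (M:ℝ) * Real.log 2 with hx
  have hMl1 : 0.6931 * (M:ℝ) ≤ M * Real.log 2 := by nlinarith
  have hMl2 : M * Real.log 2 ≤ 0.6932 * (M:ℝ) := by nlinarith
  have hX₁1 : 200 * (M:ℝ) ≤ X₁ := by linarith [neg_abs_le (Real.log (r / 2))]
  have hX₂1 : X₂ ≤ 300 * (M:ℝ) := by linarith [le_abs_self (Real.log (2 * R))]
  have hx0 : 0 < x := by linarith
  set n : ℤ := ((401 * M + C : ℕ) : ℤ) with hn
  have han : a ^ M ≤ a ^ n := by
    rw [hn, zpow_natCast]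
    exact pow_le_pow_right₀ hA.one_lt.le (by omega)
  obtain ⟨q, hq, hqx, hqr, hqR, -, -, hqs⟩ := hA.access_scaled hp n hx0 (by
    have := mul_le_mul_of_nonneg_left han hA.u_pos.le
    linarith)
  have hqs' := hqs κ₀ u' hsmall (by
    have := mul_le_mul_of_nonneg_left han hu'.le
    linarith)
  set v := τ q with hv
  have hvH : v ∈ rightHalfPlane := hA.biholo.mapsTo q hq
  have hφv : φ v = q := hA.biholo.left_inv q hq
  have hvre : v.re = x := hqx
  have h2n : (0:ℝ) < 2 ^ n := by positivity
  have hq0 : 0 < ‖q‖ := lt_of_lt_of_le (by positivity) hqr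
  set w₀ := l v with hw₀
  have hw₀re : w₀.re = Real.log ‖q‖ := by
    rw [← hφv, ← hl.exp_eq v hvH, norm_exp, Real.log_exp]
  have hlogn : Real.log (2 ^ n) = 401 * (M * Real.log 2) + C * Real.log 2 := by
    rw [Real.log_zpow, hn]; push_cast; ring
  have hw₀1 : X₂ + 2 ≤ w₀.re := by
    have := Real.log_le_log (by positivity) hqr
    rw [Real.log_mul h2n.ne' hr.ne', hlogn, ← hw₀re] at this
    linarith
  have hw₀2 : w₀.re ≤ 300 * (M:ℝ) := by
    have := Real.log_le_log hq0 hqR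
    rw [Real.log_mul h2n.ne' hR.ne', hlogn, ← hw₀re] at this
    nlinarith [le_abs_self (Real.log R)]
  -- smallness of the derivative at the return point
  have hpn : (2:ℂ) ^ n * p ∉ Ω := by
    intro hmem
    refine hpΩ ?_
    have := hA.zpow_mem (-n) _ hmem
    rwa [← mul_assoc, ← zpow_add₀ two_ne_zero, neg_add_cancel, zpow_zero, one_mul] at this
  have hsm : ‖deriv φ v‖ * x ≤ ‖q‖ / 100 := by
    have h1 := hA.biholo.norm_deriv_mul_re_le hvH hpn
    rw [hvre, hφv] at h1
    have h2 : κ₀ * H * 2 ^ n = 2 ^ n * r / 1200 := by rw [hκ₀]; field_simp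
    rw [h2] at hqs'
    linarith
  have hdv : 0 < ‖deriv φ v‖ := norm_pos_iff.2
    (deriv_ne_zero_of_injOn isOpen_rightHalfPlane hA.biholo.diff_inv hA.biholo.symm.injOn hvH)
  set κ := (‖deriv φ v‖ / 2 / (2 * ‖q‖)) ^ Θ with hκ
  have hκ0 : 0 < κ := by positivity
  -- Some translate of `w` by `2πik` is within `x / 100` of `v`, where `l` is almost constant; `κ`
  -- does not depend on `w` or on the word.
  have hbase : ∀ w : ℂ, X₁ ≤ w.re → w.re ≤ X₂ → ∃ k : ℤ, ‖logBranch l k w - w₀‖ ≤ 1 / 1000 ∧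
      κ ≤ ‖deriv l (w + 2 * Real.pi * k * I)‖ ^ Θ := by
    intro w hw1 hw2
    obtain ⟨k, -, hk⟩ := exists_int_abs_le v.im w.im 1 one_pos 0
    have hz : ‖(w + 2 * Real.pi * k * I) - v‖ ≤ v.re / 100 := by
      refine (norm_le_abs_re_add_abs_im _).trans ?_
      have him : (w + 2 * Real.pi * k * I).im = w.im + 2 * Real.pi * k := by simp
      rw [sub_re, sub_im, logBranch_shift_re, him, hvre]
      have h1 : |w.re - x| ≤ M * Real.log 2 + |Real.log (r / 2)| + |Real.log (2 * R)| := by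
        rw [abs_le]
        constructor <;> linarith [neg_abs_le (Real.log (r / 2)), le_abs_self (Real.log (2 * R))]
      have := Real.pi_lt_four
      push_cast at hk
      linarith
    obtain ⟨h1, h2⟩ := hl.near_of_slow hvH (by rwa [hvre, hφv]) hz
    rw [hφv] at h1
    exact ⟨k, h2, Real.rpow_le_rpow (by positivity) h1 hA.dim_pos.le⟩
  have hstep : ∀ w : ℂ, X₁ ≤ w.re → w.re ≤ 300 * (M:ℝ) → ∃ S : Finset ℤ,
      (∀ k ∈ S, X₁ ≤ (logBranch l k w).re ∧ (logBranch l k w).re ≤ X₂) ∧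
      2 ≤ ∑ k ∈ S, ‖deriv l (w + 2 * Real.pi * k * I)‖ ^ Θ := by
    intro w hw1 hw2
    obtain ⟨S, hS1, hS2⟩ := hJ1 w (hX₁1.trans hw1) hw2
    have hw0 : 0 < w.re := by linarith
    refine ⟨S, fun k hk => ?_, ?_⟩
    · rw [hl.logBranch_re k hw0]; exact hS1 k hk
    · refine hS2.trans (le_of_eq (Finset.sum_congr rfl fun k _ => ?_))
      rw [hl.deriv_eq (by rwa [logBranch_shift_re])]
  -- The cost `κ` of returning is paid once per word, whereas the sum doubles with each letter
  -- before it.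
  obtain ⟨N, hN⟩ := pow_unbounded_of_one_lt (A / κ) (one_lt_two (α := ℝ))
  rw [div_lt_iff₀ hκ0] at hN
  have hX12 : X₁ ≤ X₂ := by
    have : Real.log (r / 2) ≤ Real.log (2 * R) := Real.log_le_log (by positivity) (by linarith [hA.r_le])
    linarith
  have hX₁2 : 12001 ≤ X₁ := by linarith
  obtain ⟨T, hT1, hT2⟩ := exists_return_words hl (Θ := Θ) hX₁2 hX₂1 hbase hstep hκ0.le N
    (w := w₀) (by linarith) hw₀2
  refine ⟨w₀, N + 1, T, by linarith, fun ks hks => ⟨(hT1 ks hks).length_eq, fun y hy => ?_⟩, ?_⟩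
  · obtain ⟨h1, h2, h3⟩ := (hT1 ks hks).orbit hl hX₁2 (by linarith) hy
    exact ⟨h1, fun i hi1 hi2 => by linarith [h2 i hi1 hi2], by linarith⟩
  · rw [pow_succ] at hT2
    have : 0 < κ * 2 ^ N := by positivity
    linarith

end AccessibleTract

/-! ### Hausdorff dimension of sets containing separated images of themselves -/

section SelfSimilar

variable {ι : Type*} {T : Finset ι} {g : ι → ℂ → ℂ} {A : Set ℂ} {c : ι → ℝ≥0} {δ : ℝ≥0∞} {t : ℝ}

open Set Metric in
/-- Finite covers of a set containing its separated images under a family of maps that contract not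
too much. -/
theorem rpow_le_sum_ediam_of_cover (ht : 0 < t) (hA : A.Nonempty) (hT : 2 ≤ T.card)
    (hg : ∀ i ∈ T, ∀ x ∈ A, g i x ∈ A)
    (hc0 : ∀ i ∈ T, 0 < c i) (hc : ∀ i ∈ T, ∀ x ∈ A, ∀ y ∈ A, c i * edist x y ≤ edist (g i x) (g i y))
    (hδ : ∀ i ∈ T, ∀ j ∈ T, i ≠ j → ∀ x ∈ A, ∀ y ∈ A, δ ≤ edist (g i x) (g j y))
    (hsum : 1 ≤ ∑ i ∈ T, (c i : ℝ≥0∞) ^ t) (m : ℕ) :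
    ∀ (s : Finset ℕ) (U : ℕ → Set ℂ), s.card ≤ m → A ⊆ ⋃ j ∈ s, U j →
      δ ^ t ≤ ∑ j ∈ s, ediam (U j) ^ t := by
  classical
  induction m with
  | zero =>
    intro s U hs hcov
    obtain ⟨x, hx⟩ := hA
    have h0 : s = ∅ := by simpa using hs
    have := hcov hx
    simp [h0] at this
  | succ m ih =>
    intro s U hs hcov
    -- Once all members of the cover are smaller than `δ`, none meets two different images of `A`,
    -- so the cover splits into disjoint subcovers, one for each map.
    by_cases hbig : ∃ j ∈ s, δ ≤ ediam (U j)
    · obtain ⟨j, hj, hjδ⟩ := hbig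
      exact (ENNReal.rpow_le_rpow hjδ ht.le).trans
        (Finset.single_le_sum (f := fun j => ediam (U j) ^ t) (fun _ _ => zero_le) hj)
    push Not at hbig
    set S : ι → Finset ℕ := fun i => s.filter fun j => (U j ∩ g i '' A).Nonempty with hS
    have hdisj : ∀ i ∈ T, ∀ i' ∈ T, i ≠ i' → Disjoint (S i) (S i') := by
      intro i hi i' hi' hne
      rw [Finset.disjoint_left]
      intro j hj hj'
      obtain ⟨hjs, x, hxU, y, hy, rfl⟩ := Finset.mem_filter.1 hj
      obtain ⟨-, x', hxU', y', hy', rfl⟩ := Finset.mem_filter.1 hj'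
      exact absurd ((hδ i hi i' hi' hne y hy y' hy').trans (edist_le_ediam_of_mem hxU hxU'))
        (not_le.2 (hbig j hjs))
    have hne : ∀ i ∈ T, (S i).Nonempty := by
      intro i hi
      obtain ⟨x, hx⟩ := hA
      obtain ⟨j, hj, hxj⟩ := mem_iUnion₂.1 (hcov (hg i hi x hx))
      exact ⟨j, Finset.mem_filter.2 ⟨hj, g i x, hxj, x, hx, rfl⟩⟩
    -- A second map uses up at least one member of the cover, so each subcover is strictly smaller
    -- and the induction applies.
    have hcard : ∀ i ∈ T, (S i).card ≤ m := by
      intro i hi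
      obtain ⟨i', hi', hii'⟩ := Finset.exists_mem_ne (by omega : 1 < T.card) i
      obtain ⟨j, hj⟩ := hne i' hi'
      have hlt : S i ⊂ s := by
        rw [Finset.ssubset_iff_of_subset (Finset.filter_subset _ _)]
        exact ⟨j, (Finset.mem_filter.1 hj).1,
          fun h => Finset.disjoint_left.1 (hdisj i hi i' hi' hii'.symm) h hj⟩
      have := Finset.card_lt_card hlt
      omega
    -- Pulling a subcover back by `g i` covers `A` again and enlarges diameters by at most `1 / c
    -- i`.
    have hgroup : ∀ i ∈ T, (c i : ℝ≥0∞) ^ t * δ ^ t ≤ ∑ j ∈ S i, ediam (U j) ^ t := by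
      intro i hi
      have h1 := ih (S i) (fun j => {x ∈ A | g i x ∈ U j}) (hcard i hi) (by
        intro x hx
        obtain ⟨j, hj, hxj⟩ := mem_iUnion₂.1 (hcov (hg i hi x hx))
        exact mem_iUnion₂.2 ⟨j, Finset.mem_filter.2 ⟨hj, g i x, hxj, x, hx, rfl⟩, hx, hxj⟩)
      have hci : (c i : ℝ≥0∞) ≠ 0 := by exact_mod_cast (hc0 i hi).ne'
      calc (c i : ℝ≥0∞) ^ t * δ ^ t
          ≤ (c i : ℝ≥0∞) ^ t * ∑ j ∈ S i, ediam {x ∈ A | g i x ∈ U j} ^ t := by gcongr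
        _ = ∑ j ∈ S i, (c i : ℝ≥0∞) ^ t * ediam {x ∈ A | g i x ∈ U j} ^ t := Finset.mul_sum _ _ _
        _ ≤ _ := by
          refine Finset.sum_le_sum fun j _ => ?_
          rw [← ENNReal.mul_rpow_of_nonneg _ _ ht.le]
          refine ENNReal.rpow_le_rpow ?_ ht.le
          have h2 : ediam {x ∈ A | g i x ∈ U j} ≤ ediam (U j) / c i := by
            refine ediam_le fun x hx y hy => ?_
            rw [ENNReal.le_div_iff_mul_le (Or.inl hci) (Or.inl ENNReal.coe_ne_top), mul_comm]
            exact (hc i hi x hx.1 y hy.1).trans (edist_le_ediam_of_mem hx.2 hy.2)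
          rw [mul_comm]
          exact (ENNReal.le_div_iff_mul_le (Or.inl hci) (Or.inl ENNReal.coe_ne_top)).1 h2
    calc δ ^ t ≤ (∑ i ∈ T, (c i : ℝ≥0∞) ^ t) * δ ^ t := le_mul_of_one_le_left zero_le hsum
      _ = ∑ i ∈ T, (c i : ℝ≥0∞) ^ t * δ ^ t := Finset.sum_mul _ _ _
      _ ≤ ∑ i ∈ T, ∑ j ∈ S i, ediam (U j) ^ t := Finset.sum_le_sum hgroup
      _ = ∑ j ∈ T.biUnion S, ediam (U j) ^ t :=
          (Finset.sum_biUnion fun i hi j hj hij => hdisj i hi j hj hij).symm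
      _ ≤ _ := Finset.sum_le_sum_of_subset
          (Finset.biUnion_subset.2 fun i _ => Finset.filter_subset _ _)

-- Thickening the members of a countable cover makes them open at an arbitrarily small cost, after
-- which compactness selects a finite subcover.
open Set Metric in
theorem le_hausdorffMeasure_of_finite_covers (ht : 0 < t) (hA : IsCompact A) {η : ℝ≥0∞}
    (h : ∀ (s : Finset ℕ) (U : ℕ → Set ℂ), A ⊆ ⋃ j ∈ s, U j → η ≤ ∑ j ∈ s, ediam (U j) ^ t) :
    η ≤ μH[t] A := by
  rw [Measure.hausdorffMeasure_apply]
  refine le_iSup₂_of_le 1 one_pos (le_iInf fun U => le_iInf fun hU => le_iInf fun hdiam => ?_)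
  refine ENNReal.le_of_forall_pos_le_add fun ε hε _ => ?_
  obtain ⟨ε', hε', hεsum⟩ := ENNReal.exists_pos_sum_of_countable
    (ENNReal.coe_ne_zero.2 hε.ne') ℕ
  have hr : ∀ n, ∃ r : ℝ≥0, 0 < r ∧
      ediam (thickening r (U n)) ^ t ≤ (⨆ _ : (U n).Nonempty, ediam (U n) ^ t) + ε' n := by
    intro n
    rcases (U n).eq_empty_or_nonempty with h0 | h0
    · refine ⟨1, one_pos, ?_⟩
      simp [h0, ENNReal.zero_rpow_of_pos ht]
    · have hfin : ediam (U n) ^ t ≠ ∞ :=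
        ENNReal.rpow_ne_top_of_nonneg ht.le ((hdiam n).trans_lt ENNReal.one_lt_top).ne
      have hcont : Tendsto (fun r : ℝ≥0 => (ediam (U n) + 2 * (r : ℝ≥0∞)) ^ t) (𝓝 0)
          (𝓝 (ediam (U n) ^ t)) := by
        have h1 : Continuous fun r : ℝ≥0 => (ediam (U n) + 2 * (r : ℝ≥0∞)) ^ t :=
          ENNReal.continuous_rpow_const.comp (continuous_const.add
            ((ENNReal.continuous_const_mul (by norm_num)).comp ENNReal.continuous_coe))
        simpa using h1.tendsto 0
      have hlt : ediam (U n) ^ t < ediam (U n) ^ t + ε' n :=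
        ENNReal.lt_add_right hfin (ENNReal.coe_ne_zero.2 (hε' n).ne')
      have hev := hcont.eventually_lt_const hlt
      obtain ⟨r, hr1, hr2⟩ := ((hev.filter_mono nhdsWithin_le_nhds).and
        (self_mem_nhdsWithin : Ioi (0:ℝ≥0) ∈ 𝓝[>] 0)).exists
      refine ⟨r, hr2, ?_⟩
      rw [ciSup_pos h0]
      exact (ENNReal.rpow_le_rpow (ediam_thickening_le r) ht.le).trans hr1.le
  choose r hr0 hr using hr
  obtain ⟨s, hs⟩ := hA.elim_finite_subcover (fun n => thickening (r n) (U n))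
    (fun n => isOpen_thickening) (hU.trans (iUnion_mono fun n =>
      self_subset_thickening (by exact_mod_cast hr0 n) _))
  calc η ≤ ∑ j ∈ s, ediam (thickening (r j) (U j)) ^ t := h s _ hs
    _ ≤ ∑ j ∈ s, ((⨆ _ : (U j).Nonempty, ediam (U j) ^ t) + ε' j) :=
        Finset.sum_le_sum fun j _ => hr j
    _ ≤ ∑' j, ((⨆ _ : (U j).Nonempty, ediam (U j) ^ t) + (ε' j : ℝ≥0∞)) := ENNReal.sum_le_tsum s
    _ = _ := ENNReal.tsum_add
    _ ≤ _ := by gcongr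

open Set Metric in
/-- A lower bound for the Hausdorff dimension of a compact set that contains its separated images
under finitely many maps. -/
theorem le_dimH_of_separated_images {t : ℝ≥0} (ht : 0 < t) (hA : A.Nonempty) (hAc : IsCompact A)
    (hT : 2 ≤ T.card) (hg : ∀ i ∈ T, ∀ x ∈ A, g i x ∈ A)
    (hgc : ∀ i ∈ T, ContinuousOn (g i) A)
    (hc0 : ∀ i ∈ T, 0 < c i) (hc : ∀ i ∈ T, ∀ x ∈ A, ∀ y ∈ A, c i * edist x y ≤ edist (g i x) (g i y))
    (hdisj : ∀ i ∈ T, ∀ j ∈ T, i ≠ j → ∀ x ∈ A, ∀ y ∈ A, g i x ≠ g j y)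
    (hsum : 1 ≤ ∑ i ∈ T, (c i : ℝ≥0∞) ^ (t : ℝ)) : (t : ℝ≥0∞) ≤ dimH A := by
  have hpair : ∀ q : ι × ι, ∃ r : ℝ≥0, 0 < r ∧ (q.1 ∈ T → q.2 ∈ T → q.1 ≠ q.2 →
      ∀ x ∈ A, ∀ y ∈ A, (r : ℝ≥0∞) ≤ edist (g q.1 x) (g q.2 y)) := by
    rintro ⟨i, j⟩
    by_cases hij : i ∈ T ∧ j ∈ T ∧ i ≠ j
    · obtain ⟨hi, hj, hne⟩ := hij
      obtain ⟨r, hr, h1⟩ := Metric.exists_pos_forall_lt_edist (hAc.image_of_continuousOn (hgc i hi))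
        (hAc.image_of_continuousOn (hgc j hj)).isClosed (by
          rw [Set.disjoint_left]
          rintro _ ⟨x, hx, rfl⟩ ⟨y, hy, hxy⟩
          exact hdisj i hi j hj hne x hx y hy hxy.symm)
      exact ⟨r, hr, fun _ _ _ x hx y hy => (h1 _ ⟨x, hx, rfl⟩ _ ⟨y, hy, rfl⟩).le⟩
    · exact ⟨1, one_pos, fun h1 h2 h3 => absurd ⟨h1, h2, h3⟩ hij⟩
  choose r hr0 hr using hpair
  have hTne : T.Nonempty := Finset.card_pos.1 (by omega)
  set δ : ℝ≥0 := (T ×ˢ T).inf' (hTne.product hTne) r with hδ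
  have hδ0 : 0 < δ := (Finset.lt_inf'_iff _).2 fun q _ => hr0 q
  refine le_dimH_of_hausdorffMeasure_ne_zero (ne_of_gt ?_)
  have hle := le_hausdorffMeasure_of_finite_covers (t := t) (η := (δ : ℝ≥0∞) ^ (t:ℝ)) (by exact_mod_cast ht)
    hAc fun s U hU => rpow_le_sum_ediam_of_cover (by exact_mod_cast ht) hA hT hg hc0 hc
      (fun i hi j hj hij x hx y hy => le_trans ?_ (hr (i, j) hi hj hij x hx y hy)) hsum s.card s U
      le_rfl hU
  · refine lt_of_lt_of_le ?_ hle
    exact ENNReal.rpow_pos (by exact_mod_cast hδ0) ENNReal.coe_ne_top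
  · exact_mod_cast Finset.inf'_le r (Finset.mk_mem_product hi hj)

end SelfSimilar

open Set Metric in
theorem dimH_le_dimH_image {F : ℂ → ℂ} {A : Set ℂ} {K : ℝ≥0}
    (h : ∀ x ∈ A, ∀ y ∈ A, edist x y ≤ K * edist (F x) (F y)) : dimH A ≤ dimH (F '' A) := by
  have hinj : InjOn F A := by
    intro x hx y hy hxy
    have := h x hx y hy
    rw [hxy, edist_self, mul_zero] at this
    exact edist_le_zero.1 this
  have h1 : LipschitzOnWith K (Function.invFunOn F A) (F '' A) := by
    rintro _ ⟨x, hx, rfl⟩ _ ⟨y, hy, rfl⟩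
    rw [hinj.leftInvOn_invFunOn hx, hinj.leftInvOn_invFunOn hy]
    exact h x hx y hy
  have h2 := h1.dimH_image_le
  rwa [hinj.leftInvOn_invFunOn.image_image] at h2

open Set Metric Complex in
/-- A univalent function is bi-Lipschitz near the centre of a disc. -/
theorem mul_norm_sub_le_of_injOn {g : ℂ → ℂ} {c x y : ℂ} (hg : DifferentiableOn ℂ g (ball c 1))
    (hi : InjOn g (ball c 1)) (hx : x ∈ ball c (1 / 100)) (hy : y ∈ ball c (1 / 100)) :
    ‖deriv g c‖ / 2 * ‖x - y‖ ≤ ‖g x - g y‖ := by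
  have hcc : c ∈ ball c (1 / 100) := mem_ball_self (by norm_num)
  have hsub1 : ball c (1 / 100) ⊆ ball c 1 := ball_subset_ball (by norm_num)
  have hda : ∀ z ∈ ball c (1 / 100), DifferentiableAt ℂ g z := fun z hz =>
    hg.differentiableAt (isOpen_ball.mem_nhds (hsub1 hz))
  have hdd : DifferentiableOn ℂ (deriv g) (ball c 1) := hg.deriv isOpen_ball
  have hexp : Real.exp (24 / 100) ≤ 4 / 3 := by
    have h1 := Real.exp_bound_div_one_sub_of_interval (x := 24 / 100) (by norm_num) (by norm_num)
    norm_num at h1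
    linarith
  have hd1 : ∀ z ∈ ball c (1 / 100), ‖deriv g z‖ ≤ 4 / 3 * ‖deriv g c‖ := by
    intro z hz
    rw [mem_ball, dist_eq_norm] at hz
    have h1 := norm_deriv_le_exp_mul_of_injOn (R := 1) hg hi (z := c) (w := z)
      (mem_closedBall_self (by norm_num))
      (by rw [mem_closedBall, dist_eq_norm]; linarith) one_pos
    refine h1.trans (mul_le_mul_of_nonneg_right (le_trans ?_ hexp) (norm_nonneg _))
    exact Real.exp_le_exp.2 (by rw [div_one]; linarith)
  have hd2 : ∀ z ∈ ball c (1 / 100), ‖deriv (deriv g) z‖ ≤ 32 * ‖deriv g c‖ := by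
    intro z hz
    have hs : ball z (1 / 2) ⊆ ball c 1 := by
      refine ball_subset_ball' ?_
      rw [mem_ball] at hz; linarith
    have h1 := norm_deriv_deriv_le_of_injOn (by norm_num : (0:ℝ) < 1 / 2) (hg.mono hs) (hi.mono hs)
    linarith [hd1 z hz]
  have hd3 : ∀ z ∈ ball c (1 / 100), ‖deriv g z - deriv g c‖ ≤ 1 / 2 * ‖deriv g c‖ := by
    intro z hz
    have h1 := (convex_ball c (1 / 100)).norm_image_sub_le_of_norm_deriv_le (𝕜 := ℂ)
      (fun z hz => hdd.differentiableAt (isOpen_ball.mem_nhds (hsub1 hz))) hd2 hcc hz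
    rw [mem_ball, dist_eq_norm] at hz
    nlinarith [norm_nonneg (deriv g c)]
  -- The mean value inequality for `g` minus its linear part: on this small disc `g'` deviates from
  -- `g'(c)` by at most half of it.
  have h1 := (convex_ball c (1 / 100)).norm_image_sub_le_of_norm_hasDerivWithin_le
    (f := fun z => g z - deriv g c * z) (f' := fun z => deriv g z - deriv g c)
    (fun z hz => by
      have := ((hda z hz).hasDerivAt.sub ((hasDerivAt_id z).const_mul (deriv g c))).hasDerivWithinAt
        (s := ball c (1 / 100))
      rw [mul_one] at this
      exact this) hd3 hy hx
  have h2 : g x - g y = deriv g c * (x - y) + ((g x - deriv g c * x) - (g y - deriv g c * y)) := by ring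
  have h3 : ‖deriv g c * (x - y)‖ ≤ ‖g x - g y‖ +
      ‖(g x - deriv g c * x) - (g y - deriv g c * y)‖ := by
    have : deriv g c * (x - y) = (g x - g y) - ((g x - deriv g c * x) - (g y - deriv g c * y)) := by
      ring
    rw [this]
    exact norm_sub_le _ _
  rw [norm_mul] at h3
  linarith

/-! ### Words as backward orbits of `z ↦ exp (t z)` -/

section Words

variable {t φ l : ℂ → ℂ} {Ω : Set ℂ}

theorem exists_runWord_take_succ (l : ℂ → ℂ) {ks : List ℤ} {i : ℕ} (hi : i < ks.length) (y : ℂ) :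
    ∃ k, runWord l (ks.take (i + 1)) y = logBranch l k (runWord l (ks.take i) y) := by
  refine ⟨ks[i], ?_⟩
  rw [List.take_succ_eq_append_getElem hi, runWord, List.foldl_append]
  rfl

theorem exp_shift (k : ℤ) (w : ℂ) :
    Complex.exp (w + 2 * Real.pi * k * Complex.I) = Complex.exp w := by
  have := (Complex.exp_periodic.int_mul k) w
  rw [← this]; congr 1; ring

open Complex in
/-- One step of the dynamics undoes the last branch. -/
theorem IsLogInverse.map_exp_logBranch (hl : IsLogInverse t φ l Ω) (k : ℤ) {v : ℂ} (hv : 0 < v.re) :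
    exp (logBranch l k v) ∈ Ω ∧ exp (t (exp (logBranch l k v))) = exp v ∧
      ‖deriv (fun z => exp (t z)) (exp (logBranch l k v))‖ * ‖exp (logBranch l k v)‖ * 12 ≥
        v.re * ‖exp v‖ := by
  have hs : v + 2 * Real.pi * k * I ∈ rightHalfPlane := by
    show 0 < (v + 2 * Real.pi * k * I).re
    rwa [logBranch_shift_re]
  rw [hl.exp_logBranch k hv]
  have hmem := hl.biholo.mapsTo_inv _ hs
  refine ⟨hmem, by rw [hl.biholo.right_inv _ hs, exp_shift], ?_⟩
  have h1 := (hl.biholo.diff.differentiableAt (hl.biholo.isOpen_source.mem_nhds hmem)).hasDerivAt.cexp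
  rw [h1.deriv, hl.biholo.right_inv _ hs, exp_shift, norm_mul]
  have h2 := congrArg norm (hl.biholo.deriv_mul_deriv hs)
  rw [norm_mul, norm_one] at h2
  have h3 := hl.biholo.norm_deriv_mul_re_le hs hl.zero_notMem
  rw [sub_zero, logBranch_shift_re] at h3
  set D := ‖deriv t (φ (v + 2 * Real.pi * k * I))‖
  have h4 : v.re ≤ D * (12 * ‖φ (v + 2 * Real.pi * k * I)‖) := by
    calc v.re = D * ‖deriv φ (v + 2 * Real.pi * k * I)‖ * v.re := by rw [h2, one_mul]
      _ = D * (‖deriv φ (v + 2 * Real.pi * k * I)‖ * v.re) := by ring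
      _ ≤ _ := mul_le_mul_of_nonneg_left h3 (norm_nonneg _)
  have := mul_le_mul_of_nonneg_right h4 (norm_nonneg (exp v))
  linarith

/-- Different words have different images. -/
theorem IsLogInverse.exp_runWord_inj (hl : IsLogInverse t φ l Ω) {ks ks' : List ℤ} {y y' : ℂ}
    (hlen : ks.length = ks'.length)
    (h : ∀ i < ks.length, 0 < (runWord l (ks.take i) y).re)
    (h' : ∀ i < ks'.length, 0 < (runWord l (ks'.take i) y').re)
    (heq : Complex.exp (runWord l ks y) = Complex.exp (runWord l ks' y')) :
    Complex.exp y = Complex.exp y' ∧ (y = y' → ks = ks') := by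
  induction ks generalizing ks' y y' with
  | nil =>
    obtain rfl : ks' = [] := by simpa using hlen.symm
    exact ⟨heq, fun _ => rfl⟩
  | cons k ks ih =>
    obtain ⟨k', ks', rfl⟩ : ∃ k' ks₁, ks' = k' :: ks₁ := by
      cases ks' with
      | nil => simp at hlen
      | cons k' ks₁ => exact ⟨k', ks₁, rfl⟩
    have hy : 0 < y.re := by simpa using h 0 (by simp)
    have hy' : 0 < y'.re := by simpa using h' 0 (by simp)
    obtain ⟨h1, h2⟩ := ih (ks' := ks') (y := logBranch l k y) (y' := logBranch l k' y')
      (by simpa using hlen) (fun i hi => by simpa using h (i + 1) (by simpa using hi))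
      (fun i hi => by simpa using h' (i + 1) (by simpa using hi)) heq
    rw [hl.exp_logBranch k hy, hl.exp_logBranch k' hy'] at h1
    have h3 := hl.biholo.symm.injOn
      (show 0 < (y + 2 * Real.pi * k * Complex.I).re by rwa [logBranch_shift_re])
      (show 0 < (y' + 2 * Real.pi * k' * Complex.I).re by rwa [logBranch_shift_re]) h1
    refine ⟨by rw [← exp_shift k y, h3, exp_shift], fun hyy => ?_⟩
    have h4 : ks = ks' := h2 (congrArg l h3)
    subst hyy
    have h5 : k = k' := by
      have h6 := congrArg Complex.im h3
      simpa using h6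
    rw [h4, h5]

theorem IsLogInverse.runWord_contract (hl : IsLogInverse t φ l Ω) {ks : List ℤ} {y y' : ℂ}
    (h : ∀ i < ks.length, 12000 ≤ (runWord l (ks.take i) y).re)
    (h' : ∀ i < ks.length, 12000 ≤ (runWord l (ks.take i) y').re) :
    ‖runWord l ks y - runWord l ks y'‖ ≤ (1 / 1000) ^ ks.length * ‖y - y'‖ := by
  induction ks generalizing y y' with
  | nil => simp
  | cons k ks ih =>
    have hy : 12000 ≤ y.re := by simpa using h 0 (by simp)
    have hy' : 12000 ≤ y'.re := by simpa using h' 0 (by simp)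
    have h1 := ih (y := logBranch l k y) (y' := logBranch l k y')
      (fun i hi => by simpa using h (i + 1) (by simpa using hi))
      (fun i hi => by simpa using h' (i + 1) (by simpa using hi))
    have h2 := hl.logBranch_contract k hy hy'
    rw [runWord_cons, runWord_cons, List.length_cons, pow_succ, mul_assoc]
    exact h1.trans (mul_le_mul_of_nonneg_left h2 (by positivity))

open Complex in
theorem eq_of_exp_eq_of_norm_sub_lt {x y : ℂ} (h : exp x = exp y) (hxy : ‖x - y‖ < 6) : x = y := by
  obtain ⟨n, hn⟩ := exp_eq_exp_iff_exists_int.1 h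
  have h1 : x - y = n * (2 * Real.pi * I) := by rw [hn]; ring
  rw [h1] at hxy
  have hpi := Real.pi_gt_three
  have h2 : ‖(n : ℂ) * (2 * Real.pi * I)‖ = |(n:ℝ)| * (2 * Real.pi) := by
    simp [abs_of_pos Real.pi_pos]
  rw [h2] at hxy
  have h3 : n = 0 := by
    by_contra hne
    have h4 : (1:ℝ) ≤ |(n:ℝ)| := by exact_mod_cast Int.one_le_abs hne
    nlinarith
  rw [hn, h3]; simp

end Words

/-! ### The expanding repeller of a return family -/

/-- A finite family of words of the same length whose inverse branches map a neighbourhood of `w₀`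
into itself, all intermediate images staying to the left of it. -/
structure IsReturnFamily (l : ℂ → ℂ) (w₀ : ℂ) (N : ℕ) (T : Finset (List ℤ)) : Prop where
  nonempty : T.Nonempty
  length_eq : ∀ ks ∈ T, ks.length = N + 1
  re_ge : ∀ ks ∈ T, ∀ y : ℂ, ‖y - w₀‖ ≤ 1 → ∀ i, i ≤ N → 12000 ≤ (runWord l (ks.take i) y).re
  re_le : ∀ ks ∈ T, ∀ y : ℂ, ‖y - w₀‖ ≤ 1 → ∀ i, 1 ≤ i → i ≤ N →
    (runWord l (ks.take i) y).re ≤ w₀.re - 1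
  norm_le : ∀ ks ∈ T, ∀ y : ℂ, ‖y - w₀‖ ≤ 1 → ‖runWord l ks y - w₀‖ ≤ 1 / 500

/-- The union of the exponentials of the images of a neighbourhood of `w₀` under all beginnings of
words of the family. -/
def returnNhds (l : ℂ → ℂ) (w₀ : ℂ) (N : ℕ) (T : Finset (List ℤ)) : Set ℂ :=
  {z | ∃ ks ∈ T, ∃ i, 1 ≤ i ∧ i ≤ N + 1 ∧ ∃ y, ‖y - w₀‖ < 1 / 100 ∧
    Complex.exp (runWord l (ks.take i) y) = z}

/-- The points whose orbits under `z ↦ exp (t z)` stay in the neighbourhood. -/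
def returnSet (t l : ℂ → ℂ) (w₀ : ℂ) (N : ℕ) (T : Finset (List ℤ)) : Set ℂ :=
  {z | ∀ n : ℕ, (fun z => Complex.exp (t z))^[n] z ∈ returnNhds l w₀ N T}

section Repeller

variable {t φ l : ℂ → ℂ} {Ω : Set ℂ} {w₀ : ℂ} {N : ℕ} {T : Finset (List ℤ)}

theorem IsReturnFamily.runWord_take_last (hT : IsReturnFamily l w₀ N T) {ks : List ℤ} (hks : ks ∈ T)
    (y : ℂ) : runWord l (ks.take (N + 1)) y = runWord l ks y := by
  rw [List.take_of_length_le (hT.length_eq ks hks).le]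

/-- Applying the map removes the last letter. The final clause is expansion by the factor `2` for
the metric `|dz| / |z|`: real parts at least `12000` far exceed Koebe's constant `12`. -/
theorem IsReturnFamily.step (hT : IsReturnFamily l w₀ N T) (hl : IsLogInverse t φ l Ω)
    {ks : List ℤ} (hks : ks ∈ T) {i : ℕ} (hi : i ≤ N) {y : ℂ} (hy : ‖y - w₀‖ ≤ 1) :
    Complex.exp (runWord l (ks.take (i + 1)) y) ∈ Ω ∧
      Complex.exp (t (Complex.exp (runWord l (ks.take (i + 1)) y))) =
        Complex.exp (runWord l (ks.take i) y) ∧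
      2 * ‖Complex.exp (t (Complex.exp (runWord l (ks.take (i + 1)) y)))‖ ≤
        ‖deriv (fun z => Complex.exp (t z)) (Complex.exp (runWord l (ks.take (i + 1)) y))‖ *
          ‖Complex.exp (runWord l (ks.take (i + 1)) y)‖ := by
  obtain ⟨k, hk⟩ := exists_runWord_take_succ l (i := i) (by rw [hT.length_eq ks hks]; omega) y
  have hre := hT.re_ge ks hks y hy i hi
  obtain ⟨h1, h2, h3⟩ := hl.map_exp_logBranch k (v := runWord l (ks.take i) y) (by linarith)
  rw [hk]
  refine ⟨h1, h2, ?_⟩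
  rw [h2]
  have := mul_le_mul_of_nonneg_right hre (norm_nonneg (Complex.exp (runWord l (ks.take i) y)))
  linarith [norm_nonneg (Complex.exp (runWord l (ks.take i) y))]

theorem IsReturnFamily.iterate (hT : IsReturnFamily l w₀ N T) (hl : IsLogInverse t φ l Ω)
    {ks : List ℤ} (hks : ks ∈ T) {y : ℂ} (hy : ‖y - w₀‖ ≤ 1) (j : ℕ) :
    ∀ i, i + j ≤ N + 1 → (fun z => Complex.exp (t z))^[j]
      (Complex.exp (runWord l (ks.take (i + j)) y)) = Complex.exp (runWord l (ks.take i) y) := by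
  induction j with
  | zero => intro i _; rfl
  | succ j ih =>
    intro i hi
    rw [Function.iterate_succ_apply, ← add_assoc, (hT.step hl hks (by omega) hy).2.1]
    exact ih i (by omega)

theorem IsReturnFamily.iterate_full (hT : IsReturnFamily l w₀ N T) (hl : IsLogInverse t φ l Ω)
    {ks : List ℤ} (hks : ks ∈ T) {y : ℂ} (hy : ‖y - w₀‖ < 1 / 100) :
    (∀ n ≤ N, (fun z => Complex.exp (t z))^[n] (Complex.exp (runWord l ks y)) ∈
      returnNhds l w₀ N T) ∧
    (fun z => Complex.exp (t z))^[N + 1] (Complex.exp (runWord l ks y)) = Complex.exp y := by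
  have hy1 : ‖y - w₀‖ ≤ 1 := by linarith
  rw [← hT.runWord_take_last hks y]
  constructor
  · intro n hn
    have h1 := hT.iterate hl hks hy1 n (N + 1 - n) (by omega)
    rw [Nat.sub_add_cancel (by omega)] at h1
    rw [h1]
    exact ⟨ks, hks, _, by omega, by omega, y, hy, rfl⟩
  · have h1 := hT.iterate hl hks hy1 (N + 1) 0 (by omega)
    rw [zero_add] at h1
    rw [h1, List.take_zero, runWord_nil]

/-- Proper beginnings of words stay at least `1` to the left of `w₀`, so comparing moduli shows that
only a complete word can reach a point near `w₀`. The disc is too small for the period `2πi` to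
intervene. -/
theorem IsReturnFamily.exists_of_mem (hT : IsReturnFamily l w₀ N T) {y : ℂ}
    (hy : ‖y - w₀‖ < 1 / 100) (h : Complex.exp y ∈ returnNhds l w₀ N T) :
    ∃ ks ∈ T, ∃ y', ‖y' - w₀‖ < 1 / 100 ∧ runWord l ks y' = y := by
  obtain ⟨ks, hks, i, hi1, hi2, y', hy', heq⟩ := h
  have hre : (runWord l (ks.take i) y').re = y.re := by
    have := congrArg norm heq
    rw [Complex.norm_exp, Complex.norm_exp] at this
    exact Real.exp_injective this
  have hyre := (Complex.abs_re_le_norm (y - w₀)).trans hy.le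
  rw [Complex.sub_re, abs_le] at hyre
  rcases Nat.lt_or_ge N i with h1 | h1
  · obtain rfl : i = N + 1 := by omega
    rw [hT.runWord_take_last hks] at heq
    refine ⟨ks, hks, y', hy', eq_of_exp_eq_of_norm_sub_lt heq ?_⟩
    have h2 := hT.norm_le ks hks y' (by linarith)
    have h3 : runWord l ks y' - y = (runWord l ks y' - w₀) - (y - w₀) := by ring
    rw [h3]
    exact (norm_sub_le _ _).trans_lt (by linarith)
  · have := hT.re_le ks hks y' (by linarith) i hi1 h1
    linarith

open Set Metric in
theorem IsReturnFamily.differentiableOn (hT : IsReturnFamily l w₀ N T) (hl : IsLogInverse t φ l Ω)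
    {ks : List ℤ} (hks : ks ∈ T) {i : ℕ} (hi : i ≤ N + 1) :
    DifferentiableOn ℂ (runWord l (ks.take i)) (ball w₀ 1) := by
  intro y hy
  rw [mem_ball, dist_eq_norm] at hy
  refine (runWord_differentiableAt hl fun j hj => ?_).differentiableWithinAt
  rw [List.length_take] at hj
  rw [List.take_take, min_eq_left (by omega)]
  have := hT.re_ge ks hks y hy.le j (by omega)
  linarith

-- The dynamics recovers `exp y` from the image, and `exp` is injective on a disc of radius `1`.
open Set Metric in
theorem IsReturnFamily.injOn (hT : IsReturnFamily l w₀ N T) (hl : IsLogInverse t φ l Ω)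
    {ks : List ℤ} (hks : ks ∈ T) {i : ℕ} (hi : i ≤ N + 1) :
    InjOn (fun y => Complex.exp (runWord l (ks.take i) y)) (ball w₀ 1) := by
  intro y hy y' hy' heq
  rw [mem_ball, dist_eq_norm] at hy hy'
  have hpos : ∀ y : ℂ, ‖y - w₀‖ < 1 → ∀ j < (ks.take i).length,
      0 < (runWord l ((ks.take i).take j) y).re := by
    intro y hy j hj
    rw [List.length_take] at hj
    rw [List.take_take, min_eq_left (by omega)]
    have := hT.re_ge ks hks y hy.le j (by omega)
    linarith
  refine eq_of_exp_eq_of_norm_sub_lt (hl.exp_runWord_inj rfl (hpos y hy) (hpos y' hy') heq).1 ?_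
  have h3 : y - y' = (y - w₀) - (y' - w₀) := by ring
  rw [h3]
  exact (norm_sub_le _ _).trans_lt (by linarith)

open Set Metric in
theorem IsReturnFamily.isOpen_returnNhds (hT : IsReturnFamily l w₀ N T) (hl : IsLogInverse t φ l Ω) :
    IsOpen (returnNhds l w₀ N T) := by
  rw [isOpen_iff_mem_nhds]
  rintro z ⟨ks, hks, i, hi1, hi2, y, hy, rfl⟩
  have hyb : y ∈ ball w₀ 1 := by rw [mem_ball, dist_eq_norm]; linarith
  have hd : DifferentiableOn ℂ (fun y => Complex.exp (runWord l (ks.take i) y)) (ball w₀ 1) :=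
    (hT.differentiableOn hl hks hi2).cexp
  have hne := deriv_ne_zero_of_injOn isOpen_ball hd (hT.injOn hl hks hi2) hyb
  have hst := (hd.analyticAt (isOpen_ball.mem_nhds hyb)).hasStrictDerivAt
  rw [← hst.map_nhds_eq hne]
  refine mem_of_superset (image_mem_map (isOpen_ball.mem_nhds
    (show y ∈ ball w₀ (1 / 100) by rwa [mem_ball, dist_eq_norm]))) ?_
  rintro _ ⟨y', hy', rfl⟩
  rw [mem_ball, dist_eq_norm] at hy'
  exact ⟨ks, hks, i, hi1, hi2, y', hy', rfl⟩

theorem IsReturnFamily.returnNhds_subset (hT : IsReturnFamily l w₀ N T) (hl : IsLogInverse t φ l Ω) :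
    returnNhds l w₀ N T ⊆ Ω := by
  rintro z ⟨ks, hks, i, hi1, hi2, y, hy, rfl⟩
  obtain ⟨i, rfl⟩ : ∃ j, i = j + 1 := ⟨i - 1, by omega⟩
  exact (hT.step hl hks (by omega) (by linarith)).1

theorem IsReturnFamily.two_mul_norm_le (hT : IsReturnFamily l w₀ N T) (hl : IsLogInverse t φ l Ω)
    {z : ℂ} (hz : z ∈ returnNhds l w₀ N T) :
    2 * ‖Complex.exp (t z)‖ ≤ ‖deriv (fun z => Complex.exp (t z)) z‖ * ‖z‖ := by
  obtain ⟨ks, hks, i, hi1, hi2, y, hy, rfl⟩ := hz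
  obtain ⟨i, rfl⟩ : ∃ j, i = j + 1 := ⟨i - 1, by omega⟩
  exact (hT.step hl hks (by omega) (by linarith)).2.2

/-- Each point of `A` is the image of a point of `A` under a complete word, so `N + 1` iterates stay
in the neighbourhood and lead back to `exp` of a point of `A`. -/
theorem IsReturnFamily.mem_returnSet_of_subset (hT : IsReturnFamily l w₀ N T)
    (hl : IsLogInverse t φ l Ω) {A : Set ℂ}
    (hA : ∀ y ∈ A, ∃ ks ∈ T, ∃ y' ∈ A, ‖y' - w₀‖ < 1 / 100 ∧ runWord l ks y' = y) {y : ℂ}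
    (hy : y ∈ A) : Complex.exp y ∈ returnSet t l w₀ N T := by
  intro n
  induction n using Nat.strong_induction_on generalizing y with
  | _ n ih =>
    obtain ⟨ks, hks, y', hy', hyn, rfl⟩ := hA y hy
    obtain ⟨h1, h2⟩ := hT.iterate_full hl hks hyn
    rcases Nat.lt_or_ge N n with h | h
    · obtain ⟨m, rfl⟩ : ∃ m, n = m + (N + 1) := ⟨n - (N + 1), by omega⟩
      rw [Function.iterate_add_apply, h2]
      exact ih m (by omega) hy'
    · exact h1 n h

theorem IsReturnFamily.runWord_mem_returnSet (hT : IsReturnFamily l w₀ N T)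
    (hl : IsLogInverse t φ l Ω) {ks : List ℤ} (hks : ks ∈ T) {y : ℂ} (hy : ‖y - w₀‖ < 1 / 100)
    (h : Complex.exp y ∈ returnSet t l w₀ N T) :
    Complex.exp (runWord l ks y) ∈ returnSet t l w₀ N T := by
  obtain ⟨h1, h2⟩ := hT.iterate_full hl hks hy
  intro n
  rcases Nat.lt_or_ge N n with h3 | h3
  · obtain ⟨m, rfl⟩ : ∃ m, n = m + (N + 1) := ⟨n - (N + 1), by omega⟩
    rw [Function.iterate_add_apply, h2]
    exact h m
  · exact h1 n h3

/-- A single word contracts the disc of radius `1 / 500` into itself; its fixed point gives a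
periodic orbit and shows that the repeller is nonempty. -/
theorem IsReturnFamily.exists_fixed (hT : IsReturnFamily l w₀ N T) (hl : IsLogInverse t φ l Ω) :
    ∃ y : ℂ, ‖y - w₀‖ < 1 / 100 ∧ Complex.exp y ∈ returnSet t l w₀ N T := by
  obtain ⟨ks, hks⟩ := hT.nonempty
  set D := Metric.closedBall w₀ (1 / 500) with hD
  have hDn : ∀ y ∈ D, ‖y - w₀‖ ≤ 1 / 500 := fun y hy => by
    rwa [hD, Metric.mem_closedBall, dist_eq_norm] at hy
  have hmaps : Set.MapsTo (runWord l ks) D D := by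
    intro y hy
    rw [hD, Metric.mem_closedBall, dist_eq_norm]
    exact hT.norm_le ks hks y (by linarith [hDn y hy])
  have hcontr : ContractingWith (1 / 2) (hmaps.restrict (runWord l ks) D D) := by
    refine ⟨by rw [div_lt_one (by norm_num)]; norm_num, LipschitzWith.of_dist_le_mul ?_⟩
    rintro ⟨x, hx⟩ ⟨y, hy⟩
    have h1 := hl.runWord_contract (ks := ks) (y := x) (y' := y)
      (fun i hi => hT.re_ge ks hks x (by linarith [hDn x hx]) i
        (by rw [hT.length_eq ks hks] at hi; omega))
      (fun i hi => hT.re_ge ks hks y (by linarith [hDn y hy]) i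
        (by rw [hT.length_eq ks hks] at hi; omega))
    rw [Subtype.dist_eq, Subtype.dist_eq, dist_eq_norm, dist_eq_norm]
    refine h1.trans (mul_le_mul_of_nonneg_right ?_ (norm_nonneg _))
    rw [hT.length_eq ks hks, pow_succ]
    have : (1 / 1000 : ℝ) ^ N ≤ 1 := pow_le_one₀ (by norm_num) (by norm_num)
    push_cast
    linarith
  obtain ⟨y, hyD, hfix, -, -⟩ := hcontr.exists_fixedPoint' Metric.isClosed_closedBall.isComplete hmaps
    (Metric.mem_closedBall_self (by norm_num)) (edist_ne_top _ _)
  have hy1 : ‖y - w₀‖ < 1 / 100 := by linarith [hDn y hyD]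
  refine ⟨y, hy1, hT.mem_returnSet_of_subset hl (A := {y}) ?_ rfl⟩
  intro x hx
  rw [Set.mem_singleton_iff.1 hx]
  exact ⟨ks, hks, y, rfl, hy1, hfix⟩

end Repeller

section Repeller

variable {t φ l : ℂ → ℂ} {Ω : Set ℂ} {w₀ : ℂ} {N : ℕ} {T : Finset (List ℤ)}

/-- The expansion factors for `|dz| / |z|` multiply along the orbit. -/
theorem IsReturnFamily.iterate_deriv (hT : IsReturnFamily l w₀ N T) (hl : IsLogInverse t φ l Ω) {z : ℂ}
    (n : ℕ) (hz : ∀ j < n, (fun z => Complex.exp (t z))^[j] z ∈ returnNhds l w₀ N T) :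
    DifferentiableAt ℂ (fun z => Complex.exp (t z))^[n] z ∧
      2 ^ n * ‖(fun z => Complex.exp (t z))^[n] z‖ ≤
        ‖deriv (fun z => Complex.exp (t z))^[n] z‖ * ‖z‖ := by
  induction n with
  | zero =>
    refine ⟨differentiableAt_id, ?_⟩
    rw [Function.iterate_zero]
    simp
  | succ n ih =>
    obtain ⟨h1, h2⟩ := ih fun j hj => hz j (by omega)
    have hm := hz n (by omega)
    have hmΩ := hT.returnNhds_subset hl hm
    have h3 : DifferentiableAt ℂ (fun z => Complex.exp (t z))
        ((fun z => Complex.exp (t z))^[n] z) :=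
      (hl.biholo.diff.differentiableAt (hl.biholo.isOpen_source.mem_nhds hmΩ)).cexp
    have h4 := hT.two_mul_norm_le hl hm
    rw [Function.iterate_succ']
    refine ⟨h3.comp z h1, ?_⟩
    rw [deriv_comp z h3 h1, norm_mul, Function.comp_apply]
    set f := fun z => Complex.exp (t z) with hf
    change 2 * ‖f (f^[n] z)‖ ≤ _ at h4
    calc 2 ^ (n + 1) * ‖f (f^[n] z)‖ = 2 ^ n * (2 * ‖f (f^[n] z)‖) := by ring
      _ ≤ 2 ^ n * (‖deriv f (f^[n] z)‖ * ‖f^[n] z‖) := by gcongr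
      _ = ‖deriv f (f^[n] z)‖ * (2 ^ n * ‖f^[n] z‖) := by ring
      _ ≤ ‖deriv f (f^[n] z)‖ * (‖deriv f^[n] z‖ * ‖z‖) := by gcongr
      _ = _ := by ring

theorem map_mem_returnSet {z : ℂ} (hz : z ∈ returnSet t l w₀ N T) :
    Complex.exp (t z) ∈ returnSet t l w₀ N T := by
  intro n
  have := hz (n + 1)
  rwa [Function.iterate_succ_apply] at this

theorem iterate_mem_returnSet {z : ℂ} (hz : z ∈ returnSet t l w₀ N T) (n : ℕ) :
    (fun z => Complex.exp (t z))^[n] z ∈ returnSet t l w₀ N T := by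
  intro m
  rw [← Function.iterate_add_apply]
  exact hz _

/-- After `i` steps the orbit is at `exp y` with `y` near `w₀` and still in the neighbourhood, so
`y` is itself the image of a complete word and thus within `1 / 500` of `w₀`. This replaces open
discs by smaller closed ones. -/
theorem IsReturnFamily.exists_core (hT : IsReturnFamily l w₀ N T) (hl : IsLogInverse t φ l Ω)
    {z : ℂ} (hz : z ∈ returnSet t l w₀ N T) :
    ∃ ks ∈ T, ∃ i, 1 ≤ i ∧ i ≤ N + 1 ∧ ∃ y, ‖y - w₀‖ ≤ 1 / 500 ∧
      Complex.exp (runWord l (ks.take i) y) = z := by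
  obtain ⟨ks, hks, i, hi1, hi2, y, hy, rfl⟩ := hz 0
  refine ⟨ks, hks, i, hi1, hi2, y, ?_, rfl⟩
  have h1 := hT.iterate hl hks (y := y) (by linarith) i 0 (by omega)
  have h2 := hz i
  rw [zero_add] at h1
  rw [h1, List.take_zero, runWord_nil] at h2
  obtain ⟨ks', hks', y', hy', rfl⟩ := hT.exists_of_mem hy h2
  exact hT.norm_le ks' hks' y' (by linarith)

-- The set lies in a compact core `K` inside the open neighbourhood. An orbit outside it leaves `K`
-- at a first time, up to which the iterate is continuous, so nearby orbits leave `K` too.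
open Set Metric in
theorem IsReturnFamily.isCompact_returnSet (hT : IsReturnFamily l w₀ N T)
    (hl : IsLogInverse t φ l Ω) : IsCompact (returnSet t l w₀ N T) := by
  set K : Set ℂ := ⋃ ks ∈ T, ⋃ i ∈ Finset.Icc 1 (N + 1),
    (fun y => Complex.exp (runWord l (ks.take i) y)) '' closedBall w₀ (1 / 500) with hK
  have hKmem : ∀ z, z ∈ K ↔ ∃ ks ∈ T, ∃ i, 1 ≤ i ∧ i ≤ N + 1 ∧ ∃ y, ‖y - w₀‖ ≤ 1 / 500 ∧
      Complex.exp (runWord l (ks.take i) y) = z := by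
    intro z
    simp only [hK, mem_iUnion, Finset.mem_Icc, mem_image, mem_closedBall, dist_eq_norm, exists_prop,
      and_assoc]
  have hKc : IsCompact K := by
    refine T.isCompact_biUnion fun ks hks => (Finset.Icc 1 (N + 1)).isCompact_biUnion fun i hi => ?_
    rw [Finset.mem_Icc] at hi
    refine (isCompact_closedBall _ _).image_of_continuousOn ?_
    exact ((hT.differentiableOn hl hks hi.2).cexp.continuousOn).mono
      (closedBall_subset_ball (by norm_num))
  have hXK : ∀ z ∈ returnSet t l w₀ N T, z ∈ K := fun z hz =>
    (hKmem z).2 (hT.exists_core hl hz)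
  have hKV : K ⊆ returnNhds l w₀ N T := by
    intro z hz
    obtain ⟨ks, hks, i, hi1, hi2, y, hy, h1⟩ := (hKmem z).1 hz
    exact ⟨ks, hks, i, hi1, hi2, y, by linarith, h1⟩
  refine hKc.of_isClosed_subset ?_ hXK
  rw [← isOpen_compl_iff, isOpen_iff_mem_nhds]
  intro z hz
  have hex : ∃ n, (fun z => Complex.exp (t z))^[n] z ∉ K := by
    by_contra hcon
    push Not at hcon
    exact hz fun n => hKV (hcon n)
  classical
  set n := Nat.find hex with hn
  have hmin : ∀ j < n, (fun z => Complex.exp (t z))^[j] z ∈ returnNhds l w₀ N T := by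
    intro j hj
    have := Nat.find_min hex hj
    push Not at this
    exact hKV this
  have hcont := (hT.iterate_deriv hl n hmin).1.continuousAt
  filter_upwards [hcont.eventually (hKc.isClosed.isOpen_compl.mem_nhds (Nat.find_spec hex))] with w hw hwX
  exact hw (hXK _ (iterate_mem_returnSet hwX n))

/-- For a preimage, an incomplete word is prolonged by its next letter; a complete one has arrived
near `w₀`, where a new word can begin. -/
theorem IsReturnFamily.image_returnSet (hT : IsReturnFamily l w₀ N T)
    (hl : IsLogInverse t φ l Ω) :
    (fun z => Complex.exp (t z)) '' returnSet t l w₀ N T = returnSet t l w₀ N T := by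
  refine Set.Subset.antisymm ?_ fun z hz => ?_
  · rintro _ ⟨z, hz, rfl⟩
    exact map_mem_returnSet hz
  have key : ∀ z', z' ∈ returnNhds l w₀ N T → Complex.exp (t z') = z →
      z ∈ (fun z => Complex.exp (t z)) '' returnSet t l w₀ N T := by
    intro z' hz' h1
    refine ⟨z', fun n => ?_, h1⟩
    rcases n with _ | n
    · exact hz'
    · rw [Function.iterate_succ_apply, h1]
      exact hz n
  obtain ⟨ks, hks, i, hi1, hi2, y, hy, rfl⟩ := hz 0
  rcases Nat.lt_or_ge N i with h1 | h1
  · obtain rfl : i = N + 1 := by omega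
    rw [hT.runWord_take_last hks] at key ⊢
    have hy2 : ‖runWord l ks y - w₀‖ < 1 / 100 := by
      linarith [hT.norm_le ks hks y (by linarith)]
    refine key _ ⟨ks, hks, 1, le_rfl, by omega, _, hy2, rfl⟩ ?_
    have h2 := (hT.step hl hks (Nat.zero_le N) (y := runWord l ks y) (by linarith)).2.1
    rwa [List.take_zero, runWord_nil] at h2
  · exact key _ ⟨ks, hks, i + 1, by omega, by omega, y, hy, rfl⟩
      (hT.step hl hks h1 (by linarith)).2.1

/-- As the maximal set of orbits staying in `returnNhds`, the set is repelling by definition;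
compactness and surjectivity carry the content. -/
theorem IsReturnFamily.isExpandingRepeller (hT : IsReturnFamily l w₀ N T)
    (hl : IsLogInverse t φ l Ω) :
    IsExpandingRepeller (fun z => Complex.exp (t z)) Ω (returnSet t l w₀ N T) := by
  have hXV : returnSet t l w₀ N T ⊆ returnNhds l w₀ N T := fun z hz => hz 0
  have hXΩ := hXV.trans (hT.returnNhds_subset hl)
  have hne : (returnSet t l w₀ N T).Nonempty := by
    obtain ⟨y, -, hy⟩ := hT.exists_fixed hl
    exact ⟨_, hy⟩
  have hc := hT.isCompact_returnSet hl
  refine ⟨hne, hc, hXΩ, hT.image_returnSet hl, ?_,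
    ⟨_, hT.isOpen_returnNhds hl, hXV, hT.returnNhds_subset hl, fun z hz => hz⟩⟩
  obtain ⟨z₁, hz₁, hmin⟩ := hc.exists_isMinOn hne continuous_norm.continuousOn
  obtain ⟨z₂, hz₂, hmax⟩ := hc.exists_isMaxOn hne continuous_norm.continuousOn
  have hpos : ∀ z ∈ returnSet t l w₀ N T, 0 < ‖z‖ := fun z hz => norm_pos_iff.2 fun h0 =>
    hl.zero_notMem (h0 ▸ hXΩ hz)
  have h1 := hpos z₁ hz₁
  have h2 := hpos z₂ hz₂
  -- The set is compact and avoids `0`, so passing from `|dz| / |z|` to the Euclidean metric costs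
  -- only the ratio of extreme moduli.
  refine ⟨‖z₁‖ / ‖z₂‖, by positivity, 2, one_lt_two, fun n x hx => ?_⟩
  have h3 := (hT.iterate_deriv hl n fun j _ => hx j).2
  have h4 : ‖z₁‖ ≤ ‖(fun z => Complex.exp (t z))^[n] x‖ := hmin (iterate_mem_returnSet hx n)
  have h5 : ‖x‖ ≤ ‖z₂‖ := hmax hx
  rw [div_mul_eq_mul_div, div_le_iff₀ h2]
  calc ‖z₁‖ * 2 ^ n ≤ ‖(fun z => Complex.exp (t z))^[n] x‖ * 2 ^ n := by gcongr
    _ = 2 ^ n * ‖(fun z => Complex.exp (t z))^[n] x‖ := mul_comm _ _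
    _ ≤ _ := h3
    _ ≤ _ := by gcongr

open Set Metric in
/-- The dimension of the repeller is larger than the exponent whenever the corresponding sum of
derivatives is large. -/
theorem IsReturnFamily.lt_dimH (hT : IsReturnFamily l w₀ N T) (hl : IsLogInverse t φ l Ω) {Θ : ℝ}
    (hΘ : 0 < Θ) (hsum : 2 ^ Θ < ∑ ks ∈ T, ‖deriv (runWord l ks) w₀‖ ^ Θ) :
    ENNReal.ofReal Θ < dimH (returnSet t l w₀ N T) := by
  set g : List ℤ → ℂ → ℂ := fun ks => runWord l ks with hg
  -- The lower Lipschitz constants from distortion; the loss of `1/2` accounts for the threshold `2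
  -- ^ Θ`.
  set c : List ℤ → ℝ≥0 := fun ks => ‖deriv (runWord l ks) w₀‖₊ / 2 with hc
  have hdiff : ∀ ks ∈ T, DifferentiableOn ℂ (runWord l ks) (ball w₀ 1) := by
    intro ks hks
    have h1 := hT.differentiableOn hl hks (i := N + 1) le_rfl
    rwa [List.take_of_length_le (hT.length_eq ks hks).le] at h1
  have hinj : ∀ ks ∈ T, InjOn (runWord l ks) (ball w₀ 1) := by
    intro ks hks x hx y hy hxy
    refine hT.injOn hl hks (i := N + 1) le_rfl hx hy ?_
    simp only [hT.runWord_take_last hks, hxy]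
  have hc0 : ∀ ks ∈ T, 0 < c ks := by
    intro ks hks
    have := deriv_ne_zero_of_injOn isOpen_ball (hdiff ks hks) (hinj ks hks)
      (mem_ball_self one_pos : w₀ ∈ ball w₀ 1)
    simp only [hc]
    exact div_pos (nnnorm_pos.2 this) two_pos
  -- The logarithmic copy of the repeller near `w₀`. Every complete word maps it into itself, so it
  -- plays the role of the limit set.
  set A : Set ℂ := {y | ‖y - w₀‖ < 1 / 100 ∧ Complex.exp y ∈ returnSet t l w₀ N T} with hA
  have hAb : ∀ y ∈ A, y ∈ ball w₀ (1 / 100) := fun y hy => by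
    rw [mem_ball, dist_eq_norm]; exact hy.1
  have hAcore : ∀ y ∈ A, ‖y - w₀‖ ≤ 1 / 500 := by
    rintro y ⟨hy1, hy2⟩
    obtain ⟨ks, hks, y', hy', rfl⟩ := hT.exists_of_mem hy1 (hy2 0)
    exact hT.norm_le ks hks y' (by linarith)
  have hAne : A.Nonempty := hT.exists_fixed hl
  have hAc : IsCompact A := by
    have h1 : A = closedBall w₀ (1 / 500) ∩ Complex.exp ⁻¹' returnSet t l w₀ N T := by
      ext y
      rw [mem_inter_iff, mem_closedBall, dist_eq_norm]
      exact ⟨fun hy => ⟨hAcore y hy, hy.2⟩, fun hy => ⟨by linarith [hy.1], hy.2⟩⟩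
    rw [h1]
    exact (isCompact_closedBall _ _).inter_right
      ((hT.isCompact_returnSet hl).isClosed.preimage Complex.continuous_exp)
  have hgA : ∀ ks ∈ T, ∀ x ∈ A, g ks x ∈ A := by
    rintro ks hks x ⟨hx1, hx2⟩
    exact ⟨by linarith [hT.norm_le ks hks x (by linarith)], hT.runWord_mem_returnSet hl hks hx1 hx2⟩
  have hlow : ∀ ks ∈ T, ∀ x ∈ A, ∀ y ∈ A, (c ks : ℝ) * ‖x - y‖ ≤ ‖g ks x - g ks y‖ := by
    intro ks hks x hx y hy
    have := mul_norm_sub_le_of_injOn (hdiff ks hks) (hinj ks hks) (hAb x hx) (hAb y hy)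
    simpa [hc] using this
  have hcs : ∀ ks ∈ T, c ks < 1 := by
    intro ks hks
    have hre : ∀ y : ℂ, ‖y - w₀‖ ≤ 1 → ∀ i < ks.length, 12000 ≤ (runWord l (ks.take i) y).re :=
      fun y hy i hi => hT.re_ge ks hks y hy i (by rw [hT.length_eq ks hks] at hi; omega)
    have h1 : ‖(w₀ + (1 / 200 : ℝ)) - w₀‖ = 1 / 200 := by
      rw [add_sub_cancel_left, Complex.norm_real]; norm_num
    have h2 := hl.runWord_contract (hre (w₀ + (1 / 200 : ℝ)) (by rw [h1]; norm_num))
      (hre w₀ (by simp))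
    have h3 := mul_norm_sub_le_of_injOn (hdiff ks hks) (hinj ks hks)
      (show w₀ + (1 / 200 : ℝ) ∈ ball w₀ (1 / 100) by
        rw [mem_ball, dist_eq_norm, h1]; norm_num)
      (mem_ball_self (by norm_num))
    rw [h1] at h2 h3
    rw [hT.length_eq ks hks, pow_succ] at h2
    have h4 : (1 / 1000 : ℝ) ^ N ≤ 1 := pow_le_one₀ (by norm_num) (by norm_num)
    rw [← NNReal.coe_lt_coe]
    simp only [hc, NNReal.coe_div, coe_nnnorm, NNReal.coe_ofNat, NNReal.coe_one]
    linarith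
  have hsum2 : 1 < ∑ ks ∈ T, (c ks : ℝ) ^ Θ := by
    have h2 : ∀ ks, (c ks : ℝ) ^ Θ = ‖deriv (runWord l ks) w₀‖ ^ Θ / 2 ^ Θ := by
      intro ks
      simp only [hc, NNReal.coe_div, coe_nnnorm, NNReal.coe_ofNat]
      rw [Real.div_rpow (norm_nonneg _) (by norm_num)]
    simp only [h2]
    rw [← Finset.sum_div, one_lt_div (by positivity)]
    exact hsum
  have hcont : Continuous fun s : ℝ => ∑ ks ∈ T, (c ks : ℝ) ^ s := by
    refine continuous_finsetSum _ fun ks hks => ?_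
    exact continuous_const.rpow continuous_id fun s => Or.inl (by exact_mod_cast (hc0 ks hks).ne')
  -- The sum is continuous in the exponent, so the strict inequality persists slightly beyond `Θ`;
  -- this makes the final inequality strict.
  obtain ⟨s, hs1, hs2⟩ : ∃ s : ℝ, 1 < ∑ ks ∈ T, (c ks : ℝ) ^ s ∧ Θ < s :=
    (((hcont.tendsto Θ).eventually_const_lt hsum2).filter_mono nhdsWithin_le_nhds |>.and
      (self_mem_nhdsWithin : Ioi Θ ∈ 𝓝[>] Θ)).exists
  have hs0 : 0 < s := hΘ.trans hs2
  set s' : ℝ≥0 := ⟨s, hs0.le⟩ with hs'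
  -- A single factor below `1` cannot have a power exceeding `1`.
  have hcard : 2 ≤ T.card := by
    by_contra hlt
    push Not at hlt
    obtain ⟨ks, hks⟩ := hT.nonempty
    have h1 : T = {ks} := by
      have hpos : 0 < T.card := Finset.card_pos.2 ⟨ks, hks⟩
      obtain ⟨a, ha⟩ := Finset.card_eq_one.1 (by omega : T.card = 1)
      rw [ha] at hks ⊢
      rw [Finset.mem_singleton.1 hks]
    rw [h1, Finset.sum_singleton] at hs1
    have h2 : (c ks : ℝ) ^ s ≤ 1 := Real.rpow_le_one (NNReal.coe_nonneg _)
      (by exact_mod_cast (hcs ks hks).le) hs0.le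
    linarith
  have hdim : (s' : ℝ≥0∞) ≤ dimH A := by
    refine le_dimH_of_separated_images (T := T) (g := g) (c := c) hs0 hAne hAc hcard hgA
      (fun ks hks => (hdiff ks hks).continuousOn.mono fun y hy =>
        ball_subset_ball (by norm_num) (hAb y hy)) hc0 (fun ks hks x hx y hy => ?_)
      (fun ks hks ks' hks' hne x hx y hy hxy => hne ?_) ?_
    · rw [edist_nndist, edist_nndist, ← ENNReal.coe_mul, ENNReal.coe_le_coe, ← NNReal.coe_le_coe,
        NNReal.coe_mul, coe_nndist, coe_nndist, dist_eq_norm, dist_eq_norm]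
      exact hlow ks hks x hx y hy
    · have hpos : ∀ ks ∈ T, ∀ y ∈ A, ∀ j < ks.length, 0 < (runWord l (ks.take j) y).re := by
        intro ks hks y hy j hj
        rw [hT.length_eq ks hks] at hj
        have := hT.re_ge ks hks y (by linarith [hAcore y hy]) j (by omega)
        linarith
      obtain ⟨h1, h2⟩ := hl.exp_runWord_inj
        (by rw [hT.length_eq ks hks, hT.length_eq ks' hks']) (hpos ks hks x hx)
        (hpos ks' hks' y hy) (congrArg Complex.exp hxy)
      refine h2 (eq_of_exp_eq_of_norm_sub_lt h1 ?_)
      have h3 : x - y = (x - w₀) - (y - w₀) := by ring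
      rw [h3]
      exact (norm_sub_le _ _).trans_lt (by linarith [hAcore x hx, hAcore y hy])
    · have h1 : ∀ ks, (c ks : ℝ≥0∞) ^ (s' : ℝ) = ((c ks ^ s : ℝ≥0) : ℝ≥0∞) := fun ks =>
        (ENNReal.coe_rpow_of_nonneg _ hs0.le).symm
      simp only [h1]
      rw [← ENNReal.ofNNReal_finsetSum, ← ENNReal.coe_one, ENNReal.coe_le_coe, ← NNReal.coe_le_coe]
      push_cast
      exact hs1.le
  have himage : dimH A ≤ dimH (Complex.exp '' A) := by
    have hEinj : InjOn Complex.exp (ball w₀ 1) := by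
      intro x hx y hy hxy
      rw [mem_ball, dist_eq_norm] at hx hy
      refine eq_of_exp_eq_of_norm_sub_lt hxy ?_
      have h3 : x - y = (x - w₀) - (y - w₀) := by ring
      rw [h3]
      exact (norm_sub_le _ _).trans_lt (by linarith)
    have hE0 : 0 < ‖Complex.exp w₀‖₊ := nnnorm_pos.2 (Complex.exp_ne_zero _)
    refine dimH_le_dimH_image (K := 2 / ‖Complex.exp w₀‖₊) fun x hx y hy => ?_
    have h1 := mul_norm_sub_le_of_injOn Complex.differentiable_exp.differentiableOn hEinj
      (hAb x hx) (hAb y hy)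
    rw [Complex.deriv_exp] at h1
    rw [edist_nndist, edist_nndist, ← ENNReal.coe_mul, ENNReal.coe_le_coe, ← NNReal.coe_le_coe,
      NNReal.coe_mul, coe_nndist, coe_nndist, dist_eq_norm, dist_eq_norm, NNReal.coe_div, coe_nnnorm,
      NNReal.coe_ofNat, div_mul_eq_mul_div, le_div_iff₀ (by exact_mod_cast hE0)]
    linarith
  have hsub : dimH (Complex.exp '' A) ≤ dimH (returnSet t l w₀ N T) :=
    dimH_mono (by rintro _ ⟨y, hy, rfl⟩; exact hy.2)
  refine lt_of_lt_of_le ?_ ((hdim.trans himage).trans hsub)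
  have : (s' : ℝ≥0∞) = ENNReal.ofReal s := by
    rw [ENNReal.ofReal, Real.toNNReal_of_nonneg hs0.le]
    rfl
  rw [this]
  exact (ENNReal.ofReal_lt_ofReal_iff hs0).2 hs2

end Repeller

/-! ### Conclusion -/

section GeneratingCurve

variable {h : ℂ ≃ₜ ℂ}

/-- The affine map `w ↦ aw + ib` has a purely imaginary fixed point; subtracting it leaves real
parts unchanged and makes the map linear. -/
theorem IsTractModel.re_zpow_mul {τ : ℂ → ℂ} {Ω : Set ℂ} (hΩ : IsDyadicDomain Ω) {a b : ℝ} (ha : 1 < a)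
    (hab : ∀ z ∈ Ω, τ (2 * z) = a * τ z + b * Complex.I) {z : ℂ} (hz : z ∈ Ω) (n : ℤ) :
    (τ ((2 : ℂ) ^ n * z)).re = a ^ n * (τ z).re := by
  have ha1 : (a : ℂ) - 1 ≠ 0 := by
    have : a - 1 ≠ 0 := by linarith
    exact_mod_cast this
  set y : ℝ := -b / (a - 1) with hy
  have h1 := hΩ.map_zpow_mul (t := fun z => τ z - y * Complex.I) (a := a) (by linarith)
    (fun z hz => by
      simp only [hab z hz, hy]
      push_cast
      field_simp
      ring) n hz
  have h2 := congrArg Complex.re h1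
  have h3 : (a : ℂ) ^ n = ((a ^ n : ℝ) : ℂ) := by push_cast; rfl
  rw [h3, Complex.re_ofReal_mul] at h2
  simpa using h2

open Set Metric in
/-- The hyperbolic dimension exceeds every exponent below two for which the generating curve has
positive Hausdorff measure. -/
theorem IsGeneratingCurve.lt_hypDim (hσ : IsGeneratingCurve (h '' sphere 0 1))
    (hq : IsQuasiconformalPlane h) {e : ℝ} (he : |e| = 1) {τ : ℂ → ℂ} {Ω : Set ℂ}
    (hΩ : Ω = connectedComponentIn (selfSimilarCurve (h '' sphere 0 1))ᶜ (e:ℂ))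
    (hτ : IsTractModel τ Ω) {Θ : ℝ} (hΘ : 0 < Θ) (hlt : Θ < 2) (hpos : 0 < μH[Θ] (h '' sphere 0 1)) :
    ENNReal.ofReal Θ < hypDim (fun z => Complex.exp (τ z)) Ω := by
  have hdy : IsDyadicDomain Ω := hΩ ▸ hσ.isDyadicDomain he
  have hB := hτ.isBiholo
  obtain ⟨a, b, ha, hab⟩ := hτ.exists_affine hdy
  obtain ⟨E, hE, H, r, R, u, hH, hr, hrR, hu, hacc⟩ := hσ.exists_accessible hq he hΘ hpos hΩ hτ
  obtain ⟨c, hc, hcont⟩ := exists_content_pos hΘ hE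
  have hA : AccessibleTract τ (Function.invFunOn τ Ω) Ω E a b Θ H r R u c :=
    { biholo := hB
      zero_notMem := hdy.zero_notMem
      one_lt := ha
      zpow_mem := fun n z hz => hdy.zpow_mul_mem n hz
      affine := fun z hz n => IsTractModel.re_zpow_mul hdy ha hab hz n
      norm_lt := hτ.norm_lt_of_norm_lt
      dim_pos := hΘ
      one_le_H := hH
      r_pos := hr
      r_le := hrR
      u_pos := hu
      c_pos := hc
      access := hacc
      content := hcont
      nonempty := nonempty_of_measure_ne_zero hE.ne'
      small := fun κ hκ => hτ.exists_re_ge hdy.zero_notMem R hκ }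
  obtain ⟨l, hl, hle⟩ := exists_log_of_rightHalfPlane hB.diff_inv
    (fun w hw h0 => hdy.zero_notMem (h0 ▸ hB.mapsTo_inv w hw))
  have hL : IsLogInverse τ (Function.invFunOn τ Ω) l Ω := ⟨hB, hdy.zero_notMem, hl, hle⟩
  obtain ⟨w₀, N, T, -, hT, hsum⟩ := hA.exists_words hlt hL (2 ^ Θ)
  have hTne : T.Nonempty := by
    by_contra hne
    rw [Finset.not_nonempty_iff_eq_empty] at hne
    rw [hne, Finset.sum_empty] at hsum
    exact absurd hsum (not_lt.2 (by positivity))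
  have hF : IsReturnFamily l w₀ N T :=
    { nonempty := hTne
      length_eq := fun ks hks => (hT ks hks).1
      re_ge := fun ks hks y hy => ((hT ks hks).2 y hy).1
      re_le := fun ks hks y hy => ((hT ks hks).2 y hy).2.1
      norm_le := fun ks hks y hy => ((hT ks hks).2 y hy).2.2 }
  exact (hF.lt_dimH hL hΘ hsum).trans_le
    (le_iSup₂ (f := fun X (_ : IsExpandingRepeller (fun z => Complex.exp (τ z)) Ω X) => dimH X) _
      (hF.isExpandingRepeller hL))

end GeneratingCurve

open Set Metric in
theorem hausdorffMeasure_one_pos_image_sphere (h : ℂ ≃ₜ ℂ) : 0 < μH[1] (h '' sphere 0 1) := by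
  have hS : IsPreconnected (h '' sphere (0:ℂ) 1) := by
    refine IsPreconnected.image ?_ _ h.continuous.continuousOn
    exact isPreconnected_sphere (by simp) 0 1
  refine hausdorffMeasure_one_pos_of_isPreconnected hS (x := h 1) (y := h (-1)) ⟨1, by simp, rfl⟩
    ⟨-1, by simp, rfl⟩ fun h1 => ?_
  have := h.injective h1
  norm_num [Complex.ext_iff] at this

theorem proposition4p3 (σ : Set ℂ) (hσ : IsGeneratingCurve σ)
    (Ω : Set ℂ) (hΩ : ∃ z ∈ (selfSimilarCurve σ)ᶜ, Ω = connectedComponentIn (selfSimilarCurve σ)ᶜ z)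
    (τ : ℂ → ℂ) (hτ : IsTractModel τ Ω)
    (Θ : ℝ) (hdim : minkowskiDim σ = (Θ : EReal)) (hlt : Θ < 2)
    (hpos : 0 < μH[Θ] σ) :
    ENNReal.ofReal Θ < hypDim (fun z => Complex.exp (τ z)) Ω := by
  obtain ⟨h, hq, rfl⟩ := hσ.quasicircle
  obtain ⟨z, hz, hΩz⟩ := hΩ
  obtain ⟨e, he, hze⟩ := hσ.exists_ray hz
  rcases lt_or_ge 0 Θ with hΘ | hΘ
  · exact hσ.lt_hypDim hq he (hΩz.trans hze) hτ hΘ hlt hpos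
  -- For `Θ ≤ 0` the left side is `0`, and the argument is run with exponent `1` instead: a
  -- nondegenerate connected set has positive one-dimensional measure.
  · rw [ENNReal.ofReal_of_nonpos hΘ]
    refine lt_of_le_of_lt zero_le (hσ.lt_hypDim hq he (hΩz.trans hze) hτ one_pos one_lt_two
      (hausdorffMeasure_one_pos_image_sphere h))
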